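/- Let $b>0$ be real and $Q=b+b^{-1}$. For real $\omega_1,\omega_2>0$ and complex $s\notin\{-n_1\omega_1-n_2\omega_2 : n_1,n_2\in\mathbb Z_{\ge 0}\}$ let $\zeta_2(t;s|\omega_1,\omega_2)$ be the analytic continuation in $t$ to $\mathbb C\setminus\{1,2\}$ of the double series $\sum_{n_1,n_2\ge 0}(s+n_1\omega_1+n_2\omega_2)^{-t}$ (convergent for $\operatorname{Re}t>2$), and let $\Gamma_2(s|\omega_1,\omega_2)=\exp\bigl(\partial_t\zeta_2(t;s|\omega_1,\omega_2)|_{t=0}\bigr)$ be the Barnes double Gamma function. Put $$\Gamma_b(x)=\Gamma_2(x|b,b^{-1}),\qquad S_b(x)=\frac{\Gamma_b(x)}{\Gamma_b(Q-x)},\qquad G_b(x)=e^{\frac{\pi i}{2}x(x-Q)}S_b(x).$$ Let $\alpha,\beta\in\mathbb C$ satisfy $\operatorname{Re}\alpha>0$, $\operatorname{Re}\beta>0$ and $\operatorname{Re}(\alpha+\beta)<Q$. Then $$\frac1i\int_{-i\infty}^{i\infty}d\tau\; e^{2\pi i\tau\beta}\,\frac{G_b(\tau+\alpha)}{G_b(\tau+Q)}=\frac{G_b(\alpha)\,G_b(\beta)}{G_b(\alpha+\beta)},$$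 where the contour passes to the left of the pole of the integrand at $\tau=0$ and to the right of the poles of $G_b(\tau+\alpha)$; that is, the integral is taken upwards along any line $\operatorname{Re}\tau=c$ with $-\operatorname{Re}\alpha<c<0$, on which it converges absolutely. -/

import Mathlib

open Complex MeasureTheory

noncomputable section

namespace BBeta

/-- `Z` is the analytic continuation, in the variable `t`, of the Barnes double zeta function
`∑_{n₁,n₂ ≥ 0} (s + n₁ ω₁ + n₂ ω₂) ^ (-t)`: it is holomorphic on `ℂ` without `1` and `2`, and is
the (absolutely convergent) double series for `Re t > 2`. -/
def IsDoubleZeta (ω₁ ω₂ : ℝ) (s : ℂ) (Z : ℂ → ℂ) : Prop :=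
  DifferentiableOn ℂ Z ({1, 2}ᶜ : Set ℂ) ∧
    ∀ t : ℂ, 2 < t.re →
      HasSum (fun n : ℕ × ℕ => (s + n.1 * ω₁ + n.2 * ω₂) ^ (-t)) (Z t)

/-- The continuation is unique away from the two points `1` and `2`. -/
theorem IsDoubleZeta.eqOn {ω₁ ω₂ : ℝ} {s : ℂ} {Z Z' : ℂ → ℂ}
    (h : IsDoubleZeta ω₁ ω₂ s Z) (h' : IsDoubleZeta ω₁ ω₂ s Z') :
    Set.EqOn Z Z' ({1, 2}ᶜ : Set ℂ) := by
  have hc : (({1, 2} : Set ℂ)).Countable := Set.to_countable _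
  have ho : IsOpen ({1, 2}ᶜ : Set ℂ) := (Set.toFinite _).isClosed.isOpen_compl
  have hp : IsPreconnected ({1, 2}ᶜ : Set ℂ) :=
    (hc.isPathConnected_compl_of_one_lt_rank (by simp)).isConnected.isPreconnected
  refine (h.1.analyticOnNhd ho).eqOn_of_preconnected_of_eventuallyEq (h'.1.analyticOnNhd ho) hp
    (z₀ := 3) (by simp) ?_
  have hU : {t : ℂ | 2 < t.re} ∈ nhds (3 : ℂ) :=
    (isOpen_lt continuous_const Complex.continuous_re).mem_nhds (by simp; norm_num)
  filter_upwards [hU] with t ht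
  exact (h.2 t ht).unique (h'.2 t ht)

open Classical in
/-- The Barnes double zeta function `t ↦ ζ₂(t; s | ω₁, ω₂)`, analytically continued in `t`. -/
def doubleZeta (ω₁ ω₂ : ℝ) (s : ℂ) : ℂ → ℂ :=
  if h : ∃ Z : ℂ → ℂ, IsDoubleZeta ω₁ ω₂ s Z then h.choose else 0

theorem isDoubleZeta_doubleZeta {ω₁ ω₂ : ℝ} {s : ℂ} {Z : ℂ → ℂ}
    (h : IsDoubleZeta ω₁ ω₂ s Z) : IsDoubleZeta ω₁ ω₂ s (doubleZeta ω₁ ω₂ s) := by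
  have h' : ∃ Z : ℂ → ℂ, IsDoubleZeta ω₁ ω₂ s Z := ⟨Z, h⟩
  rw [doubleZeta, dif_pos h']
  exact h'.choose_spec

open Classical in
/-- Barnes' double Gamma function `Γ₂(s | ω₁, ω₂) = exp (∂/∂t ζ₂(t; s | ω₁, ω₂) at t = 0)`.
At its poles `s = -n₁ ω₁ - n₂ ω₂` it is given the value `0`, like Mathlib's `Complex.Gamma`. -/
def doubleGamma (s : ℂ) (ω₁ ω₂ : ℝ) : ℂ :=
  if ∃ n₁ n₂ : ℕ, s = -(n₁ * ω₁ + n₂ * ω₂ : ℂ) then 0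
  else exp (deriv (doubleZeta ω₁ ω₂ s) 0)

/-- `Γ_b(x) = Γ₂(x | b, b⁻¹)`. -/
def Gammab (b : ℝ) (x : ℂ) : ℂ := doubleGamma x b b⁻¹

/-- `Q = b + b⁻¹`. -/
def Qb (b : ℝ) : ℝ := b + b⁻¹

/-- The double Sine function `S_b(x) = Γ_b(x) / Γ_b(Q - x)`. -/
def Sb (b : ℝ) (x : ℂ) : ℂ := Gammab b x / Gammab b (Qb b - x)

/-- `G_b(x) = e^{(π i / 2) x (x - Q)} S_b(x)`. -/
def Gb (b : ℝ) (x : ℂ) : ℂ := exp (Real.pi * I / 2 * x * (x - Qb b)) * Sb b x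

/-- The integrand `e^{2 π i τ β} G_b(τ + α) / G_b(τ + Q)` of the b-beta integral. -/
def bbetaIntegrand (b : ℝ) (α β τ : ℂ) : ℂ :=
  exp (2 * Real.pi * I * τ * β) * (Gb b (τ + α) / Gb b (τ + Qb b))

/-- The contour integral `∫ f(τ) dτ` over the upward oriented line `τ = c + i t`, `t ∈ ℝ`. -/
def lineIntegral (c : ℝ) (f : ℂ → ℂ) : ℂ := ∫ t : ℝ, f (c + t * I) * I

end BBeta

end

/-! ### Decay estimates, shifting horizontal lines, holomorphy of parametric integrals. -/

noncomputable section

namespace BBeta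

open Filter Topology Set

/-! Everything is reduced to one integral. For 0 < Re x < Q let W(x) be the integral of e^{(x -
Q/2)u} / (4u sinh(bu/2) sinh(u/(2b))) over a horizontal line above the real axis and below the other
poles. Barnes' function enters only through `Gb_eq`, which says that G_b = g e^{-W} on this strip,
with g a constant. The double zeta series is a Mellin integral over the half line; replacing the
half line by the line ℝ + ih gives an entire function of t whose value at t = 0 is W. This yields
the continuation of ζ₂ and S_b(x) = exp((W(Q - x) - W(x))/2) (`deriv_zetaCont_sub`). The reflection
formula `W_add_W_sub`, a residue at 0, turns the exponent into -W(x) plus a quadratic polynomial,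
whose nonconstant part is cancelled by the Gaussian prefactor of G_b.

The integral also gives the analytic properties of G_b: the equation G_b(x + b) = (1 - e^{2πibx})
G_b(x) (`exp_neg_W_add`), the symmetry b ↔ 1/b, the size for large |Im x| (`exists_re_W_bound`), and
x G_b(x) → 1/(2π) as x → 0+ (`tendsto_mul_Gb`).

Let J(α, β) be the beta integral. Applying the functional equation in the numerator and in the
denominator of the integrand, and moving the line by b, gives a first-order difference equation in β
(`betaInt_add`), which G_b(β)/G_b(α + β) satisfies too. The quotient of the two is therefore
b-periodic in β. If Re α < 1/b, it grows at most like e^{π Re α |Im β|}, which is slower than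
e^{2π|Im β|/b}, so all its nonzero Fourier modes vanish and it is constant (`eq_of_periodic_strip`).
The single period b suffices, so no irrationality of b² is needed. The constant is read off at β →
0+, where J and G_b(β) both behave like 1/(2πβ). The identity theorem in α then removes the
restriction Re α < 1/b. -/

theorem integrable_div_one_add_sq (C : ℝ) : Integrable fun v : ℝ => C / (1 + v ^ 2) := by
  simpa [div_eq_mul_inv] using integrable_inv_one_add_sq.const_mul C

theorem tendsto_div_one_add_sq_atTop (C : ℝ) :
    Tendsto (fun v : ℝ => C / (1 + v ^ 2)) atTop (𝓝 0) :=
  tendsto_const_nhds.div_atTop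
    (tendsto_atTop_add_const_left _ _ (tendsto_pow_atTop two_ne_zero))

/-- A polynomial times a decaying exponential is dominated by a multiple of `(1 + v²)⁻¹`. -/
theorem exists_pow_mul_exp_le {A δ : ℝ} (hA : 0 ≤ A) (hδ : 0 < δ) (k : ℕ) :
    ∃ C : ℝ, 0 ≤ C ∧ ∀ v : ℝ, (A + |v|) ^ k * Real.exp (-δ * |v|) ≤ C / (1 + v ^ 2) := by
  refine ⟨(k + 2).factorial / δ ^ (k + 2) * Real.exp (δ * (A + 1)), by positivity, fun v => ?_⟩
  rw [le_div_iff₀ (by positivity)]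
  have h1 : (δ * (A + 1 + |v|)) ^ (k + 2) / (k + 2).factorial ≤ Real.exp (δ * (A + 1 + |v|)) :=
    Real.pow_div_factorial_le_exp _ (by positivity) _
  have h2 : (A + |v|) ^ k * (1 + v ^ 2) ≤ (A + 1 + |v|) ^ (k + 2) := by
    rw [pow_add]
    have h3 : 1 + v ^ 2 ≤ (A + 1 + |v|) ^ 2 := by
      rw [← sq_abs v]; nlinarith [abs_nonneg v]
    gcongr
    linarith
  have h4 : (A + 1 + |v|) ^ (k + 2) ≤
      (k + 2).factorial / δ ^ (k + 2) * Real.exp (δ * (A + 1 + |v|)) := by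
    rw [mul_pow, div_le_iff₀ (by positivity)] at h1
    rw [div_mul_eq_mul_div, le_div_iff₀ (by positivity)]
    linarith
  calc (A + |v|) ^ k * Real.exp (-δ * |v|) * (1 + v ^ 2)
      = (A + |v|) ^ k * (1 + v ^ 2) * Real.exp (-δ * |v|) := by ring
    _ ≤ (k + 2).factorial / δ ^ (k + 2) * Real.exp (δ * (A + 1 + |v|)) * Real.exp (-δ * |v|) := by
        exact mul_le_mul_of_nonneg_right (h2.trans h4) (Real.exp_nonneg _)
    _ = _ := by
        rw [mul_assoc, ← Real.exp_add]; ring_nf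

theorem continuous_horizontal_line {g : ℂ → ℂ} {y : ℝ} {S : Set ℝ}
    (hg : ContinuousOn g (univ ×ℂ S)) (hy : y ∈ S) : Continuous fun v : ℝ => g (v + y * I) := by
  refine continuousOn_univ.1 (hg.comp (by fun_prop) fun v _ => ?_)
  simp [mem_reProdIm, hy]

theorem integrable_horizontal_line {g : ℂ → ℂ} {y : ℝ} {S : Set ℝ} {C : ℝ}
    (hg : ContinuousOn g (univ ×ℂ S)) (hy : y ∈ S)
    (hle : ∀ u : ℂ, u.im ∈ S → ‖g u‖ ≤ C / (1 + u.re ^ 2)) :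
    Integrable fun v : ℝ => g (v + y * I) := by
  refine (integrable_div_one_add_sq C).mono'
    (continuous_horizontal_line hg hy).aestronglyMeasurable (ae_of_all _ fun v => ?_)
  simpa using hle (v + y * I) (by simpa using hy)

/-- Shifting a horizontal line of integration inside a strip of holomorphy. -/
theorem integral_horizontal_line_eq {g : ℂ → ℂ} {y₁ y₂ C : ℝ}
    (hc : ContinuousOn g (univ ×ℂ Icc y₁ y₂))
    (hd : ∀ u : ℂ, u.im ∈ Ioo y₁ y₂ → DifferentiableAt ℂ g u)
    (hle : ∀ u : ℂ, u.im ∈ Icc y₁ y₂ → ‖g u‖ ≤ C / (1 + u.re ^ 2)) (h : y₁ ≤ y₂) :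
    ∫ v : ℝ, g (v + y₁ * I) = ∫ v : ℝ, g (v + y₂ * I) := by
  have hrect (T : ℝ) := integral_boundary_rect_eq_zero_of_continuousOn_of_differentiableOn g
    (-T + y₁ * I) (T + y₂ * I)
    (hc.mono (by simp [uIcc_of_le h, reProdIm_subset_iff, Set.prod_mono]))
    (fun u hu => (hd u (by simpa [mem_reProdIm, h] using hu.2)).differentiableWithinAt)
  simp only [add_re, neg_re, ofReal_re, mul_re, I_re, mul_zero, ofReal_im, I_im, mul_one, sub_self,
    add_zero, add_im, neg_im, neg_zero, mul_im, zero_add] at hrect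
  have hl (y : ℝ) (hy : y ∈ Icc y₁ y₂) :
      Tendsto (fun T : ℝ => ∫ v in (-T)..T, g (v + y * I)) atTop (𝓝 (∫ v : ℝ, g (v + y * I))) :=
    intervalIntegral_tendsto_integral (integrable_horizontal_line hc hy hle)
      tendsto_neg_atTop_atBot tendsto_id
  -- The vertical sides have fixed length y₂ - y₁ and the integrand on them is at most C/(1 + T²),
  -- so they disappear as T → ∞.
  have hv (s : ℝ → ℝ) (hs : Tendsto (fun T => C / (1 + s T ^ 2)) atTop (𝓝 0)) :
      Tendsto (fun T : ℝ => I • ∫ y in y₁..y₂, g ((s T : ℝ) + y * I)) atTop (𝓝 0) := by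
    refine squeeze_zero_norm (a := fun T => C / (1 + s T ^ 2) * |y₂ - y₁|) (fun T => ?_)
      (by simpa using hs.mul_const |y₂ - y₁|)
    rw [norm_smul, norm_I, one_mul]
    refine intervalIntegral.norm_integral_le_of_norm_le_const fun y hy => ?_
    rw [uIoc_of_le h] at hy
    simpa using hle (s T + y * I) (by simpa using Ioc_subset_Icc_self hy)
  have hlim := (((hl y₁ ⟨le_rfl, h⟩).sub (hl y₂ ⟨h, le_rfl⟩)).add
    (hv (fun T => T) (tendsto_div_one_add_sq_atTop C))).sub
    (hv (fun T => -T) (by simpa using tendsto_div_one_add_sq_atTop C))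
  have hz : Tendsto (fun _ : ℝ => (0 : ℂ)) atTop
      (𝓝 ((∫ v : ℝ, g (v + y₁ * I)) - (∫ v : ℝ, g (v + y₂ * I)) + 0 - 0)) := by
    refine hlim.congr fun T => ?_
    have := hrect T
    push_cast at this ⊢
    exact this
  have := tendsto_nhds_unique hz tendsto_const_nhds
  simpa [sub_eq_zero] using this

/-- Holomorphy of parametric integrals, and differentiation under the integral sign. -/
theorem hasDerivAt_integral_of_locally_dominated {μ : Measure ℝ} {U : Set ℂ} (hU : IsOpen U)
    {F : ℂ → ℝ → ℂ} (hm : ∀ z ∈ U, AEStronglyMeasurable (F z) μ)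
    (hd : ∀ t, DifferentiableOn ℂ (F · t) U)
    (hb : ∀ z₀ ∈ U, ∃ ε > 0, ∃ bd : ℝ → ℝ, Integrable bd μ ∧
      ∀ᵐ t ∂μ, ∀ z ∈ Metric.ball z₀ ε ∩ U, ‖F z t‖ ≤ bd t) {z₀ : ℂ} (hz₀ : z₀ ∈ U) :
    HasDerivAt (fun z => ∫ t, F z t ∂μ) (∫ t, deriv (F · t) z₀ ∂μ) z₀ := by
  obtain ⟨ε₀, hε₀, bd, hbi, hbd⟩ := hb z₀ hz₀
  obtain ⟨ε₁, hε₁, hball⟩ := Metric.isOpen_iff.1 hU z₀ hz₀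
  set ε := min ε₀ ε₁
  have hε : 0 < ε := lt_min hε₀ hε₁
  have hsub : Metric.ball z₀ ε ⊆ Metric.ball z₀ ε₀ ∩ U := fun z hz =>
    ⟨Metric.ball_subset_ball (min_le_left _ _) hz,
      hball (Metric.ball_subset_ball (min_le_right _ _) hz)⟩
  -- Cauchy's estimate on circles of radius ε/3: about points of the ball of radius ε/2 they stay
  -- inside the ball of radius ε, where F is dominated.
  have hderiv : ∀ᵐ t ∂μ, ∀ z ∈ Metric.ball z₀ (ε / 2), ‖deriv (F · t) z‖ ≤ bd t / (ε / 3) := by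
    filter_upwards [hbd] with t hbd z hz
    have hcl : Metric.closedBall z (ε / 3) ⊆ Metric.ball z₀ ε := fun w hw => by
      simp only [Metric.mem_ball, Metric.mem_closedBall] at *
      linarith [dist_triangle w z z₀]
    refine norm_deriv_le_of_forall_mem_sphere_norm_le (by positivity) ?_ fun w hw =>
      hbd w (hsub (hcl (Metric.sphere_subset_closedBall hw)))
    refine ((hd t).mono ?_).diffContOnCl
    exact (Metric.closure_ball_subset_closedBall.trans hcl).trans (hsub.trans inter_subset_right)
  -- The derivative is a pointwise limit of difference quotients along a sequence, and so inherits
  -- measurability in t.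
  have hmeas : AEStronglyMeasurable (fun t => deriv (F · t) z₀) μ := by
    have hseq : Tendsto (fun n : ℕ => z₀ + (ε / 2 * (1 / ((n : ℝ) + 1)) : ℝ)) atTop (𝓝[≠] z₀) := by
      refine tendsto_nhdsWithin_iff.2 ⟨?_, Eventually.of_forall fun n => ?_⟩
      · have := (tendsto_one_div_add_atTop_nhds_zero_nat (𝕜 := ℝ)).const_mul (ε / 2)
        have h2 := (continuous_ofReal.tendsto _).comp this
        simpa using h2.const_add z₀
      · simp only [mem_compl_iff, mem_singleton_iff, add_eq_left, ofReal_eq_zero]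
        positivity
    refine aestronglyMeasurable_of_tendsto_ae atTop
      (f := fun n : ℕ => fun t => slope (F · t) z₀ (z₀ + (ε / 2 * (1 / ((n : ℝ) + 1)) : ℝ)))
      (fun n => ?_) (ae_of_all _ fun t => ?_)
    · simp only [slope_def_module]
      refine AEStronglyMeasurable.const_smul (𝕜 := ℂ) ((hm _ (hsub ?_).2).sub (hm _ hz₀)) _
      simp only [Metric.mem_ball, dist_self_add_left, norm_real, Real.norm_eq_abs]
      rw [abs_of_pos (by positivity)]
      have : 1 / ((n : ℝ) + 1) ≤ 1 := by
        rw [div_le_one (by positivity)]; linarith [n.cast_nonneg (α := ℝ)]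
      nlinarith
    · exact (hasDerivAt_iff_tendsto_slope.1
        (((hd t).differentiableAt (hU.mem_nhds hz₀)).hasDerivAt)).comp hseq
  exact (hasDerivAt_integral_of_dominated_loc_of_deriv_le
    (Metric.ball_mem_nhds z₀ (half_pos hε))
    (by filter_upwards [hU.mem_nhds hz₀] with z hz using hm z hz)
    (hbi.mono' (hm z₀ hz₀) (hbd.mono fun t ht => ht z₀ (hsub (Metric.mem_ball_self hε))))
    hmeas hderiv (hbi.div_const _)
    (ae_of_all _ fun t z hz => ((hd t).differentiableAt
      (hU.mem_nhds (hsub (Metric.ball_subset_ball (by linarith) hz)).2)).hasDerivAt)).2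

theorem differentiableOn_integral_of_locally_dominated {μ : Measure ℝ} {U : Set ℂ} (hU : IsOpen U)
    {F : ℂ → ℝ → ℂ} (hm : ∀ z ∈ U, AEStronglyMeasurable (F z) μ)
    (hd : ∀ t, DifferentiableOn ℂ (F · t) U)
    (hb : ∀ z₀ ∈ U, ∃ ε > 0, ∃ bd : ℝ → ℝ, Integrable bd μ ∧
      ∀ᵐ t ∂μ, ∀ z ∈ Metric.ball z₀ ε ∩ U, ‖F z t‖ ≤ bd t) :
    DifferentiableOn ℂ (fun z => ∫ t, F z t ∂μ) U := fun _ hz =>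
  (hasDerivAt_integral_of_locally_dominated hU hm hd hb hz).differentiableAt.differentiableWithinAt

end BBeta

end

/-! ### A residue computation on two lines, and a Liouville theorem on a periodic strip. -/

noncomputable section

namespace BBeta

open Filter Topology Set

/-- Pulling the real factors |v| and v² out of the two logarithms cancels log |v|, and what remains
converges to log(±i). These are the boundary values of the primitive used in
`integral_inv_mul_lower_line`. -/
theorem tendsto_log_mul_I_sub {A η : ℝ} (l : Filter ℝ) (ε : ℝ) (hε : ε = 1 ∨ ε = -1)
    (hpos : ∀ᶠ v in l, 0 < ε * v) (hl : Tendsto (fun v : ℝ => v⁻¹) l (𝓝 0)) :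
    Tendsto (fun v : ℝ => log (I * (v + (-η : ℝ) * I)) -
      1 / 2 * log ((A : ℂ) ^ 2 + (v + (-η : ℝ) * I) ^ 2)) l (𝓝 (ε * (Real.pi / 2 * I))) := by
  have hcont (c : ℂ) : Tendsto (fun v : ℝ => c * ((v⁻¹ : ℝ) : ℂ)) l (𝓝 0) := by
    simpa using ((continuous_ofReal.tendsto 0).comp hl).const_mul c
  have h1 : Tendsto (fun v : ℝ => log (ε * I + ε * η * ((v⁻¹ : ℝ) : ℂ))) l
      (𝓝 (ε * (Real.pi / 2 * I))) := by
    have h : Tendsto (fun v : ℝ => ε * I + ε * η * ((v⁻¹ : ℝ) : ℂ)) l (𝓝 (ε * I)) := by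
      simpa using (hcont (ε * η)).const_add ((ε : ℂ) * I)
    have hlog : log (ε * I) = ε * (Real.pi / 2 * I) := by
      rcases hε with rfl | rfl
      · simp [log_I]
      · simp [log_neg_I]
    rw [← hlog]
    refine (continuousAt_clog ?_).tendsto.comp h
    rcases hε with rfl | rfl <;> simp [mem_slitPlane_iff]
  have h : Tendsto (fun v : ℝ => (A : ℂ) ^ 2 * ((v⁻¹ : ℝ) : ℂ) * ((v⁻¹ : ℝ) : ℂ) +
      (1 + -η * I * ((v⁻¹ : ℝ) : ℂ)) ^ 2) l (𝓝 1) := by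
      simpa using ((hcont ((A : ℂ) ^ 2)).mul (by simpa using hcont 1)).add
        (((hcont (-η * I)).const_add 1).pow 2)
  have h2 : Tendsto (fun v : ℝ => log ((A : ℂ) ^ 2 * ((v⁻¹ : ℝ) : ℂ) * ((v⁻¹ : ℝ) : ℂ) +
      (1 + -η * I * ((v⁻¹ : ℝ) : ℂ)) ^ 2)) l (𝓝 0) := by
    rw [← log_one]
    exact (continuousAt_clog (by simp)).tendsto.comp h
  have h3 := h1.sub (h2.const_mul (1 / 2))
  rw [mul_zero, sub_zero] at h3
  refine h3.congr' ?_
  filter_upwards [hpos, h.eventually_ne one_ne_zero] with v hv hX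
  have hv0 : v ≠ 0 := by rintro rfl; simp at hv
  have hvC : (v : ℂ) ≠ 0 := ofReal_ne_zero.2 hv0
  have hε2 : (ε : ℂ) * ε = 1 := by rcases hε with rfl | rfl <;> simp
  have hY : (ε * I + ε * η * ((v⁻¹ : ℝ) : ℂ)) ≠ 0 := fun h0 => by
    have := congrArg Complex.im h0
    rcases hε with rfl | rfl <;> simp at this
  have e1 : I * (v + (-η : ℝ) * I) = (ε * v : ℝ) * (ε * I + ε * η * ((v⁻¹ : ℝ) : ℂ)) := by
    push_cast
    field_simp
    linear_combination (-I * v - η) * hε2 - η * I_sq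
  have e2 : (A : ℂ) ^ 2 + (v + (-η : ℝ) * I) ^ 2 = (v ^ 2 : ℝ) * ((A : ℂ) ^ 2 * ((v⁻¹ : ℝ) : ℂ) *
      ((v⁻¹ : ℝ) : ℂ) + (1 + -η * I * ((v⁻¹ : ℝ) : ℂ)) ^ 2) := by
    push_cast
    field_simp
  rw [e1, e2, log_ofReal_mul hv hY, log_ofReal_mul (by positivity) hX, Real.log_pow]
  have : Real.log (ε * v) = Real.log v := by
    rcases hε with rfl | rfl <;> simp
  rw [this]
  push_cast
  ring

theorem min_mul_le_norm_sq_add_sq {A η : ℝ} {u : ℂ} (hu : |u.im| ≤ η) :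
    min (A ^ 2 - η ^ 2) 1 * (1 + u.re ^ 2) ≤ ‖(A : ℂ) ^ 2 + u ^ 2‖ := by
  refine le_trans ?_ (re_le_norm _)
  have h : ((A : ℂ) ^ 2 + u ^ 2).re = A ^ 2 + (u.re ^ 2 - u.im ^ 2) := by
    simp [pow_two]
  have h1 : u.im ^ 2 ≤ η ^ 2 := by rw [← sq_abs]; gcongr
  have h2 := min_le_left (A ^ 2 - η ^ 2) 1
  have h3 := mul_le_of_le_one_left (sq_nonneg u.re) (min_le_right (A ^ 2 - η ^ 2) 1)
  rw [h]
  linarith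

/-- A primitive of A²/(u(A² + u²)) is log(iu) - ½ log(A² + u²). On the line Im u = -η both arguments
have positive real part, so the principal branch has no jump. -/
theorem integral_inv_mul_lower_line {A η : ℝ} (hη : 0 < η) (hA : η < A) :
    Integrable (fun v : ℝ => (A : ℂ) ^ 2 / (A ^ 2 + (v + (-η : ℝ) * I) ^ 2) /
      (v + (-η : ℝ) * I)) ∧
    ∫ v : ℝ, (A : ℂ) ^ 2 / (A ^ 2 + (v + (-η : ℝ) * I) ^ 2) / (v + (-η : ℝ) * I) =
      Real.pi * I := by
  have hre (v : ℝ) : 0 < ((A : ℂ) ^ 2 + (v + (-η : ℝ) * I) ^ 2).re := by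
    simp only [pow_two, add_re, mul_re, ofReal_re, ofReal_im, I_re, I_im, add_im, mul_im]
    nlinarith [sq_nonneg v]
  have hu0 (v : ℝ) : (v + (-η : ℝ) * I : ℂ) ≠ 0 := fun h => by
    have := congrArg Complex.im h; simp at this; linarith
  have hk0 (v : ℝ) : ((A : ℂ) ^ 2 + (v + (-η : ℝ) * I) ^ 2) ≠ 0 := fun h => by
    have := hre v; rw [h] at this; simp at this
  have h_integ : Integrable (fun v : ℝ => (A : ℂ) ^ 2 / (A ^ 2 + (v + (-η : ℝ) * I) ^ 2) /
      (v + (-η : ℝ) * I)) := by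
    refine (integrable_div_one_add_sq (A ^ 2 / min (A ^ 2 - η ^ 2) 1 / η)).mono'
      (Continuous.aestronglyMeasurable ?_) (ae_of_all _ fun v => ?_)
    · exact (continuous_const.div (by fun_prop) hk0).div (by fun_prop) hu0
    · have hm : 0 < min (A ^ 2 - η ^ 2) 1 := lt_min (by nlinarith) one_pos
      have h1 : min (A ^ 2 - η ^ 2) 1 * (1 + v ^ 2) ≤ ‖(A : ℂ) ^ 2 + (v + (-η : ℝ) * I) ^ 2‖ := by
        simpa using min_mul_le_norm_sq_add_sq (A := A) (η := η) (u := v + (-η : ℝ) * I)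
          (by simp [abs_of_pos hη])
      have h2 : η ≤ ‖(v + (-η : ℝ) * I : ℂ)‖ := by
        refine le_trans ?_ (abs_im_le_norm _)
        simp [abs_of_pos hη]
      rw [norm_div, norm_div, norm_pow, norm_real, Real.norm_eq_abs, sq_abs]
      calc A ^ 2 / ‖(A : ℂ) ^ 2 + (v + (-η : ℝ) * I) ^ 2‖ / ‖(v + (-η : ℝ) * I : ℂ)‖
          ≤ A ^ 2 / (min (A ^ 2 - η ^ 2) 1 * (1 + v ^ 2)) / η := by gcongr
        _ = _ := by
          have : (1 + v ^ 2) ≠ 0 := by positivity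
          field_simp
  refine ⟨h_integ, ?_⟩
  have htop := tendsto_log_mul_I_sub (A := A) (η := η) atTop 1 (Or.inl rfl)
    (by simpa using eventually_gt_atTop (0 : ℝ)) tendsto_inv_atTop_zero
  have hbot := tendsto_log_mul_I_sub (A := A) (η := η) atBot (-1) (Or.inr rfl)
    (by simpa using eventually_lt_atBot (0 : ℝ)) tendsto_inv_atBot_zero
  rw [integral_of_hasDerivAt_of_tendsto (fun v => ?_) h_integ hbot htop]
  · push_cast; ring
  · have hd : HasDerivAt (fun v : ℝ => (v + (-η : ℝ) * I : ℂ)) 1 v := by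
      simpa using (hasDerivAt_id v).ofReal_comp.add_const ((-η : ℝ) * I : ℂ)
    have h1 := (hd.const_mul I).clog_real (by
      simp [mem_slitPlane_iff, hη])
    have h2 := ((hd.fun_pow 2).const_add ((A : ℂ) ^ 2)).clog_real (Or.inl (hre v))
    refine (h1.sub (h2.const_mul (1 / 2 : ℂ))).congr_deriv ?_
    have h3 := hu0 v
    have h4 := hk0 v
    have h5 := I_ne_zero
    generalize (v + (-η : ℝ) * I : ℂ) = u at *
    field_simp
    push_cast
    ring

theorem integral_inv_mul_upper_line {A η : ℝ} (hη : 0 < η) (hA : η < A) :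
    Integrable (fun v : ℝ => (A : ℂ) ^ 2 / (A ^ 2 + (v + η * I) ^ 2) / (v + η * I)) ∧
    ∫ v : ℝ, (A : ℂ) ^ 2 / (A ^ 2 + (v + η * I) ^ 2) / (v + η * I) = -(Real.pi * I) := by
  obtain ⟨hki, hkv⟩ := integral_inv_mul_lower_line hη hA
  have h (v : ℝ) : -((A : ℂ) ^ 2 / (A ^ 2 + (((-v : ℝ) : ℂ) + (-η : ℝ) * I) ^ 2) /
      (((-v : ℝ) : ℂ) + (-η : ℝ) * I)) = (A : ℂ) ^ 2 / (A ^ 2 + (v + η * I) ^ 2) / (v + η * I) := by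
    have e : ((-v : ℝ) : ℂ) + (-η : ℝ) * I = -(v + η * I) := by push_cast; ring
    rw [e, neg_sq, div_neg, neg_neg]
  refine ⟨hki.comp_neg.neg.congr (ae_of_all _ h), ?_⟩
  rw [← hkv, ← integral_neg, ← integral_neg_eq_self (fun v : ℝ => -((A : ℂ) ^ 2 /
    (A ^ 2 + (v + (-η : ℝ) * I) ^ 2) / (v + (-η : ℝ) * I)))]
  exact integral_congr_ae (ae_of_all _ fun v => (h v).symm)

/-- When H(0) = 0 the singularity of H(u)/u is removable; `dslope` is its holomorphic extension, so
the line may cross 0. -/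
theorem integral_dslope_line_eq {H : ℂ → ℂ} {η D : ℝ} (hη : 0 < η)
    (hHd : ∀ u : ℂ, u.im ∈ Icc (-η) η → DifferentiableAt ℂ H u) (hH0 : H 0 = 0)
    (hHle : ∀ u : ℂ, u.im ∈ Icc (-η) η → ‖H u‖ ≤ D / (1 + u.re ^ 2)) :
    (∫ v : ℝ, dslope H 0 (v + (-η : ℝ) * I)) = (∫ v : ℝ, dslope H 0 (v + η * I)) ∧
      ∀ y ∈ Icc (-η) η, Integrable fun v : ℝ => dslope H 0 (v + y * I) := by
  have hsub : univ ×ℂ Ioo (-η) η ⊆ univ ×ℂ Icc (-η) η := by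
    rw [reProdIm_subset_iff]; exact Set.prod_mono le_rfl Ioo_subset_Icc_self
  have hnhds (u : ℂ) (hu : u.im ∈ Ioo (-η) η) : univ ×ℂ Icc (-η) η ∈ 𝓝 u :=
    mem_of_superset ((isOpen_univ.reProdIm isOpen_Ioo).mem_nhds
      (by simpa [mem_reProdIm] using hu)) hsub
  have hg : DifferentiableOn ℂ (dslope H 0) (univ ×ℂ Icc (-η) η) :=
    (differentiableOn_dslope (hnhds 0 (by simp [hη]))).2 fun u hu =>
      (hHd u (by simpa [mem_reProdIm] using hu)).differentiableWithinAt
  obtain ⟨M, hM⟩ :=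
    ((isCompact_Icc (a := (-1 : ℝ)) (b := 1)).reProdIm
      (isCompact_Icc (a := -η) (b := η))).exists_bound_of_continuousOn
      (hg.continuousOn.mono (by
        rw [reProdIm_subset_iff]; exact Set.prod_mono (subset_univ _) le_rfl))
  have hD0 : 0 ≤ D := by
    have := (norm_nonneg _).trans (hHle 0 (by simp [hη.le]))
    simpa using this
  have hgle (u : ℂ) (hu : u.im ∈ Icc (-η) η) :
      ‖dslope H 0 u‖ ≤ (2 * |M| + D) / (1 + u.re ^ 2) := by
    rcases le_or_gt |u.re| 1 with h1 | h1
    · have h2 : u.re ^ 2 ≤ 1 := by rw [← sq_abs]; nlinarith [abs_nonneg u.re]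
      refine (hM u ⟨abs_le.1 h1, hu⟩).trans ?_
      rw [le_div_iff₀ (by positivity)]
      nlinarith [le_abs_self M, abs_nonneg M, sq_nonneg u.re]
    · have h2 : 1 ≤ ‖u‖ := h1.le.trans (abs_re_le_norm u)
      have hu0 : u ≠ 0 := norm_pos_iff.1 (by linarith)
      rw [dslope_of_ne _ hu0, slope_def_field, hH0, sub_zero, sub_zero, norm_div]
      refine (div_le_self (norm_nonneg _) h2).trans ((hHle u hu).trans ?_)
      gcongr
      linarith [abs_nonneg M]
  exact ⟨integral_horizontal_line_eq hg.continuousOn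
    (fun u hu => hg.differentiableAt (hnhds u hu)) hgle (by linarith),
    fun y hy => integrable_horizontal_line hg.continuousOn hy hgle⟩

/-- The two integrals of `F(u) / u` along horizontal lines above and below the simple pole at `0`
differ by `2 π i F(0)`. -/
theorem integral_lower_sub_integral_upper {F : ℂ → ℂ} {η C : ℝ} (hη : 0 < η)
    (hd : ∀ u : ℂ, u.im ∈ Icc (-η) η → DifferentiableAt ℂ F u)
    (hle : ∀ u : ℂ, u.im ∈ Icc (-η) η → ‖F u‖ ≤ C / (1 + u.re ^ 2)) :
    (∫ v : ℝ, F (v + (-η : ℝ) * I) / (v + (-η : ℝ) * I)) -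
      ∫ v : ℝ, F (v + η * I) / (v + η * I) = 2 * Real.pi * I * F 0 := by
  -- Any A > η would do: the poles ±iA of the model function A²/(A² + u²) must lie outside the
  -- strip.
  obtain ⟨A, hAdef⟩ : ∃ A : ℝ, A = 2 * η := ⟨_, rfl⟩
  have hA : η < A := by linarith
  have hA0 : (A : ℂ) ≠ 0 := ofReal_ne_zero.2 (by linarith)
  have hm : 0 < min (A ^ 2 - η ^ 2) 1 := lt_min (by nlinarith) one_pos
  have hkb (u : ℂ) (hu : u.im ∈ Icc (-η) η) :
      min (A ^ 2 - η ^ 2) 1 * (1 + u.re ^ 2) ≤ ‖(A : ℂ) ^ 2 + u ^ 2‖ :=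
    min_mul_le_norm_sq_add_sq (abs_le.2 hu)
  have hk0 (u : ℂ) (hu : u.im ∈ Icc (-η) η) : ((A : ℂ) ^ 2 + u ^ 2) ≠ 0 :=
    norm_pos_iff.1 (lt_of_lt_of_le (by positivity) (hkb u hu))
  -- Subtracting a multiple of the model that agrees with F at 0 leaves a function vanishing there,
  -- so the residue comes entirely from the explicitly integrable model.
  obtain ⟨H, hH⟩ : ∃ H : ℂ → ℂ, H = fun u => F u - F 0 * ((A : ℂ) ^ 2 / (A ^ 2 + u ^ 2)) :=
    ⟨_, rfl⟩
  have hH0 : H 0 = 0 := by simp [hH, hA0]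
  have hHd (u : ℂ) (hu : u.im ∈ Icc (-η) η) : DifferentiableAt ℂ H u := by
    rw [hH]
    have h1 : DifferentiableAt ℂ (fun u : ℂ => (A : ℂ) ^ 2 + u ^ 2) u := by fun_prop
    exact (hd u hu).sub (((differentiableAt_const _).div h1 (hk0 u hu)).const_mul _)
  have hHle (u : ℂ) (hu : u.im ∈ Icc (-η) η) :
      ‖H u‖ ≤ (C + ‖F 0‖ * (A ^ 2 / min (A ^ 2 - η ^ 2) 1)) / (1 + u.re ^ 2) := by
    rw [hH]
    refine (norm_sub_le _ _).trans ?_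
    rw [add_div]
    refine add_le_add (hle u hu) ?_
    rw [norm_mul, mul_div_assoc, norm_div, norm_pow, norm_real, Real.norm_eq_abs, sq_abs,
      div_div]
    gcongr
    exact hkb u hu
  obtain ⟨hline, hgi⟩ := integral_dslope_line_eq hη hHd hH0 hHle
  have hsplit (y : ℝ) (hy0 : y ≠ 0) (hy : y ∈ Icc (-η) η)
      (hi : Integrable fun v : ℝ => (A : ℂ) ^ 2 / (A ^ 2 + (v + y * I) ^ 2) / (v + y * I)) :
      ∫ v : ℝ, F (v + y * I) / (v + y * I) = (∫ v : ℝ, dslope H 0 (v + y * I)) +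
        F 0 * ∫ v : ℝ, (A : ℂ) ^ 2 / (A ^ 2 + (v + y * I) ^ 2) / (v + y * I) := by
    have h1 := integral_add (hgi y hy) (hi.const_mul (F 0))
    rw [integral_const_mul] at h1
    rw [← h1]
    refine integral_congr_ae (ae_of_all _ fun v => ?_)
    have hne : (v + y * I : ℂ) ≠ 0 := fun h => hy0 (by simpa using congrArg Complex.im h)
    simp only
    rw [dslope_of_ne _ hne, slope_def_field, hH0, sub_zero, sub_zero, hH]
    ring
  obtain ⟨hki, hkv⟩ := integral_inv_mul_lower_line hη hA
  obtain ⟨hki', hkv'⟩ := integral_inv_mul_upper_line hη hA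
  rw [hsplit (-η) (by linarith) ⟨le_rfl, by linarith⟩ hki, hsplit η hη.ne' ⟨by linarith, le_rfl⟩
      hki',
    hline, hkv, hkv']
  ring

/-- A function on a closed vertical strip of width `b`, taking equal values at corresponding points
of the two sides and of exponential growth less than `2 π / b`, is constant. -/
theorem eq_of_periodic_strip {R : ℂ → ℂ} {b x₀ κ C : ℝ} (hb : 0 < b) (hκ : κ < 2 * Real.pi / b)
    (hd : ∀ z : ℂ, z.re ∈ Icc x₀ (x₀ + b) → DifferentiableAt ℂ R z)
    (hper : ∀ z : ℂ, z.re = x₀ → R (z + b) = R z)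
    (hle : ∀ z : ℂ, z.re ∈ Icc x₀ (x₀ + b) → ‖R z‖ ≤ C * Real.exp (κ * |z.im|)) :
    ∃ a : ℂ, ∀ z : ℂ, z.re ∈ Ico x₀ (x₀ + b) → R z = a := by
  have hbC : (b : ℂ) ≠ 0 := ofReal_ne_zero.2 hb.ne'
  have hC : 0 ≤ C := by
    have := (norm_nonneg _).trans (hle x₀ (by simp [hb.le]))
    simpa using this
  -- The n-th Fourier coefficient at height y, with its dependence on y built into the holomorphic
  -- character e^{-2πinz/b}. Cauchy's theorem on a rectangle makes it independent of y, since the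
  -- vertical sides cancel by periodicity.
  obtain ⟨f, hf⟩ : ∃ f : ℤ → ℂ → ℂ,
      f = fun (n : ℤ) (z : ℂ) => R z * exp (-(2 * Real.pi * I * n * z / b)) := ⟨_, rfl⟩
  obtain ⟨c, hc⟩ : ∃ c : ℤ → ℝ → ℂ, c = fun (n : ℤ) (y : ℝ) =>
      ∫ x in x₀..(x₀ + b), f n (x + y * I) := ⟨_, rfl⟩
  have hfd (n : ℤ) (z : ℂ) (hz : z.re ∈ Icc x₀ (x₀ + b)) : DifferentiableAt ℂ (f n) z := by
    rw [hf]
    exact (hd z hz).mul (by fun_prop)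
  have hfper (n : ℤ) (y : ℝ) : f n ((x₀ + b : ℝ) + y * I) = f n (x₀ + y * I) := by
    have e1 : (((x₀ + b : ℝ) : ℂ) + y * I) = (x₀ + y * I) + b := by push_cast; ring
    have e2 : -(2 * Real.pi * I * n * ((x₀ + y * I) + b) / b) =
        -(2 * Real.pi * I * n * (x₀ + y * I) / b) + (-n : ℤ) * (2 * Real.pi * I) := by
      push_cast; field_simp; ring
    simp only [hf]
    rw [e1, hper _ (by simp), e2, exp_add, exp_int_mul_two_pi_mul_I, mul_one]
  have hconst (n : ℤ) (y₁ y₂ : ℝ) : c n y₁ = c n y₂ := by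
    have hrect := integral_boundary_rect_eq_zero_of_differentiableOn (f n) (x₀ + y₁ * I)
      ((x₀ + b : ℝ) + y₂ * I) (fun z hz => (hfd n z (by
        have := hz.1; simpa [uIcc_of_le (show x₀ ≤ x₀ + b by linarith)] using
            this)).differentiableWithinAt)
    simp only [add_re, ofReal_re, mul_re, I_re, mul_zero, ofReal_im, I_im, mul_one, sub_self,
      add_zero, add_im, mul_im, zero_add, hfper] at hrect
    simpa [sub_eq_zero, hc] using hrect
  have hfn (n : ℤ) (x y : ℝ) (hx : x ∈ Icc x₀ (x₀ + b)) :
      ‖f n (x + y * I)‖ ≤ C * Real.exp (κ * |y| + 2 * Real.pi * n * y / b) := by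
    have h1 := hle (x + y * I) (by simpa using hx)
    have h2 : (-(2 * Real.pi * I * n * (x + y * I) / b)).re = 2 * Real.pi * n * y / b := by
      have : -(2 * Real.pi * I * n * (x + y * I) / b) =
        ((2 * Real.pi * n * y / b : ℝ) : ℂ) + ((-(2 * Real.pi * n * x / b) : ℝ) : ℂ) * I := by
        push_cast; field_simp; linear_combination (-(n * y : ℂ)) * I_sq
      rw [this]; simp
    simp only [hf]
    rw [norm_mul, norm_exp, h2, Real.exp_add, ← mul_assoc]
    gcongr
    simpa using h1
  have hcn (n : ℤ) (y : ℝ) : ‖c n y‖ ≤ C * Real.exp (κ * |y| + 2 * Real.pi * n * y / b) * b := by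
    have := intervalIntegral.norm_integral_le_of_norm_le_const (a := x₀) (b := x₀ + b)
      (f := fun x : ℝ => f n (x + y * I)) (fun x hx => hfn n x y (by
        rw [uIoc_of_le (by linarith)] at hx; exact Ioc_subset_Icc_self hx))
    simpa [hc, abs_of_pos hb] using this
  have hzero (n : ℤ) (hn : n ≠ 0) : c n 0 = 0 := by
    have hn1 : (1 : ℝ) ≤ |(n : ℝ)| := by exact_mod_cast Int.one_le_abs hn
    have key : ∀ T : ℝ, 0 ≤ T → ‖c n 0‖ ≤ C * Real.exp ((κ - 2 * Real.pi / b) * T) * b := by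
      intro T hT
      -- Go to the end of the strip where the n-th character decays: y = sT, with s of sign opposite
      -- to n. Since |n| ≥ 1 and κ < 2π/b, the bound tends to 0.
      obtain ⟨s, hs, hsn⟩ : ∃ s : ℝ, |s| = 1 ∧ n * s = -|(n : ℝ)| := by
        rcases le_total 0 (n : ℝ) with h | h
        · exact ⟨-1, by simp, by rw [abs_of_nonneg h]; ring⟩
        · exact ⟨1, by simp, by rw [abs_of_nonpos h]; ring⟩
      rw [hconst n 0 (s * T)]
      refine (hcn n _).trans ?_
      have e : 2 * Real.pi * n * (s * T) / b = -(2 * Real.pi / b * (|(n : ℝ)| * T)) := by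
        rw [show 2 * Real.pi * n * (s * T) / b = 2 * Real.pi / b * ((n * s) * T) by ring, hsn]
        ring
      have h3 : 2 * Real.pi / b * (1 * T) ≤ 2 * Real.pi / b * (|(n : ℝ)| * T) := by gcongr
      rw [abs_mul, hs, abs_of_nonneg hT, e]
      gcongr
      linarith
    have hlim : Tendsto (fun T : ℝ => C * Real.exp ((κ - 2 * Real.pi / b) * T) * b) atTop
        (𝓝 (C * 0 * b)) :=
      ((Real.tendsto_exp_atBot.comp
        (tendsto_id.const_mul_atTop_of_neg (by linarith))).const_mul C).mul_const b
    have := ge_of_tendsto hlim (by filter_upwards [eventually_ge_atTop 0] with T hT using key T hT)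
    simpa using this
  refine ⟨1 / b * c 0 0, fun z hz => ?_⟩
  have : Fact (0 < b) := ⟨hb⟩
  obtain ⟨g, hg⟩ : ∃ g : ℝ → ℂ, g = fun x : ℝ => R (x + z.im * I) := ⟨_, rfl⟩
  have hgc : ContinuousOn g (Icc x₀ (x₀ + b)) := fun x hx => by
    have h1 : ContinuousAt (fun x : ℝ => (x + z.im * I : ℂ)) x := by fun_prop
    rw [hg]
    exact (ContinuousAt.comp (f := fun x : ℝ => (x + z.im * I : ℂ)) (g := R)
      (hd _ (by simpa using hx)).continuousAt h1).continuousWithinAt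
  have hgp : g x₀ = g (x₀ + b) := by
    simp only [hg]
    rw [← hper _ (by simp)]
    congr 1
    push_cast; ring
  -- Only the zeroth coefficient of this continuous function on the circle survives, so its Fourier
  -- series is summable and converges pointwise to a constant.
  let G : C(AddCircle b, ℂ) := ⟨AddCircle.liftIco b x₀ g, AddCircle.liftIco_continuous hgp hgc⟩
  have hco (n : ℤ) : fourierCoeff G n =
      exp (-(2 * Real.pi * n * z.im / b : ℝ)) * (1 / b * c n z.im) := by
    have h1 : fourierCoeff G n = _ := fourierCoeff_liftIco_eq (a := x₀) g n
    rw [h1, fourierCoeffOn_eq_integral]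
    simp only [hc, add_sub_cancel_left]
    rw [real_smul, mul_left_comm (exp _),
      ← intervalIntegral.integral_const_mul (exp (-(2 * Real.pi * n * z.im / b : ℝ)))]
    push_cast
    refine congrArg (1 / (b : ℂ) * ·) (intervalIntegral.integral_congr fun x _ => ?_)
    simp only [hg, hf, smul_eq_mul]
    rw [mul_left_comm, ← exp_add, mul_comm, fourier_coe_apply]
    congr 2
    push_cast
    rw [add_sub_cancel_left]
    field_simp
    linear_combination (z.im * n : ℂ) * I_sq
  have hco0 (n : ℤ) (hn : n ≠ 0) : fourierCoeff G n = 0 := by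
    rw [hco, hconst n _ 0, hzero n hn]; simp
  have hsum := has_pointwise_sum_fourier_series_of_summable
    (summable_of_ne_finset_zero (s := {0}) fun n hn => hco0 n (by simpa using hn))
    (z.re : AddCircle b)
  have hsum2 := hasSum_single (f := fun n : ℤ => fourierCoeff G n • fourier n (z.re : AddCircle b))
    0 (fun n hn => by simp only [hco0 n hn, zero_smul])
  have h := hsum.unique hsum2
  have hGz : G (z.re : AddCircle b) = R z := by
    change AddCircle.liftIco b x₀ g (z.re : AddCircle b) = R z
    rw [AddCircle.liftIco_coe_apply hz, hg]
    simp only [re_add_im]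
  rw [hGz, hco 0, hconst 0 _ 0] at h
  simpa using h

end BBeta

end

/-! ### The function sinh z / z, and the kernel of the integral representation. -/

noncomputable section

namespace BBeta

open Filter Topology Set

theorem normSq_sinh_eq (z : ℂ) : ‖sinh z‖ ^ 2 = Real.sinh z.re ^ 2 + Real.sin z.im ^ 2 := by
  have h : sinh z = (Real.sinh z.re * Real.cos z.im : ℝ) +
      (Real.cosh z.re * Real.sin z.im : ℝ) * I := by
    conv_lhs => rw [← re_add_im z, sinh_add, sinh_mul_I, cosh_mul_I]
    push_cast
    ring
  rw [← normSq_eq_norm_sq, h, normSq_add_mul_I]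
  nlinarith [Real.cosh_sq z.re, Real.sin_sq_add_cos_sq z.im]

/-- Uses |sinh z|² = sinh²(Re z) + sin²(Im z), with sinh x ≥ x for the first term and Jordan's
inequality sin y ≥ 2y/π for the second. -/
theorem two_div_pi_mul_norm_le_norm_sinh {z : ℂ} (hz : |z.im| ≤ Real.pi / 2) :
    2 / Real.pi * ‖z‖ ≤ ‖sinh z‖ := by
  refine le_of_sq_le_sq ?_ (norm_nonneg _)
  rw [normSq_sinh_eq, mul_pow, ← normSq_eq_norm_sq, normSq_apply]
  have h1 : 2 / Real.pi ≤ 1 := by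
    rw [div_le_one Real.pi_pos]; exact Real.two_le_pi
  have h2 : (2 / Real.pi) ^ 2 ≤ 1 := pow_le_one₀ (by positivity) h1
  have h3 : z.re ^ 2 ≤ Real.sinh z.re ^ 2 := by
    rw [← sq_abs, ← sq_abs (Real.sinh _), Real.abs_sinh]
    have := Real.self_le_sinh_iff.2 (abs_nonneg z.re)
    gcongr
  have h4 : (2 / Real.pi) ^ 2 * z.im ^ 2 ≤ Real.sin z.im ^ 2 := by
    rw [← mul_pow, ← sq_abs, ← sq_abs (Real.sin _), abs_mul, abs_of_pos (by positivity)]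
    have h5 : 2 / Real.pi * |z.im| ≤ Real.sin |z.im| := Real.mul_le_sin (abs_nonneg _) hz
    have h6 : Real.sin |z.im| ≤ |Real.sin z.im| := by
      rcases abs_cases z.im with ⟨h, _⟩ | ⟨h, _⟩ <;> rw [h]
      · exact le_abs_self _
      · rw [Real.sin_neg]; exact neg_le_abs _
    gcongr
    exact h5.trans h6
  nlinarith [sq_nonneg z.re]

/-- For |Re z| ≥ 1 the hyperbolic sine is comparable to its leading exponential; for |Re z| ≤ 1 the
exponential is bounded and the previous linear bound suffices. -/
theorem norm_mul_exp_le_norm_sinh {z : ℂ} (hz : |z.im| ≤ Real.pi / 2) :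
    ‖z‖ * Real.exp |z.re| ≤ 8 * (1 + ‖z‖) * ‖sinh z‖ := by
  rcases le_or_gt 1 |z.re| with h | h
  · have h1 : Real.sinh |z.re| ≤ ‖sinh z‖ := by
      refine le_of_sq_le_sq ?_ (norm_nonneg _)
      rw [normSq_sinh_eq, ← Real.abs_sinh, sq_abs]
      linarith [sq_nonneg (Real.sin z.im)]
    have h2 : Real.exp |z.re| ≤ 4 * Real.sinh |z.re| := by
      rw [Real.sinh_eq]
      have h3 : Real.exp (-|z.re|) ≤ 1 := Real.exp_le_one_iff.2 (by linarith)
      have h4 : 2 ≤ Real.exp |z.re| := by linarith [Real.add_one_le_exp |z.re|]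
      linarith
    have h5 : Real.exp |z.re| ≤ 4 * ‖sinh z‖ := by linarith
    nlinarith [norm_nonneg z, norm_nonneg (sinh z), Real.exp_pos |z.re|]
  · have h1 := two_div_pi_mul_norm_le_norm_sinh hz
    have h2 : Real.exp |z.re| ≤ 3 := by
      have := Real.exp_one_lt_d9
      linarith [Real.exp_le_exp.2 h.le]
    have h3 : 1 / 2 ≤ 2 / Real.pi := by
      rw [div_le_div_iff₀ two_pos Real.pi_pos]; linarith [Real.pi_le_four]
    have h4 : 1 / 2 * ‖z‖ ≤ ‖sinh z‖ := le_trans (by gcongr) h1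
    nlinarith [norm_nonneg z, norm_nonneg (sinh z), Real.exp_pos |z.re|]

/-- The entire function `sinh z / z`. -/
def sinhc : ℂ → ℂ := dslope sinh 0

theorem mul_sinhc (z : ℂ) : z * sinhc z = sinh z := by
  have := sub_smul_dslope sinh 0 z
  simpa [sinhc] using this

theorem sinhc_zero : sinhc 0 = 1 := by
  simp [sinhc, Complex.deriv_sinh]

theorem differentiable_sinhc : Differentiable ℂ sinhc := by
  rw [← differentiableOn_univ, sinhc, differentiableOn_dslope univ_mem]
  exact differentiable_sinh.differentiableOn

theorem sinhc_neg (z : ℂ) : sinhc (-z) = sinhc z := by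
  rcases eq_or_ne z 0 with rfl | hz
  · simp
  · have h1 := mul_sinhc z
    have h2 := mul_sinhc (-z)
    rw [sinh_neg, ← h1] at h2
    exact mul_left_cancel₀ hz (by linear_combination -h2)

theorem exp_le_norm_sinhc {z : ℂ} (hz : |z.im| ≤ Real.pi / 2) :
    Real.exp |z.re| ≤ 8 * (1 + ‖z‖) * ‖sinhc z‖ := by
  rcases eq_or_ne z 0 with rfl | h0
  · simp [sinhc_zero]
  · have h := norm_mul_exp_le_norm_sinh hz
    rw [← mul_sinhc, norm_mul] at h
    have h1 : 0 < ‖z‖ := norm_pos_iff.2 h0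
    exact le_of_mul_le_mul_left (by linarith) h1

theorem sinhc_ne_zero {z : ℂ} (hz : |z.im| ≤ Real.pi / 2) : sinhc z ≠ 0 := fun h => by
  have := exp_le_norm_sinhc hz
  rw [h, norm_zero, mul_zero] at this
  linarith [Real.exp_pos |z.re|]

theorem norm_inv_sinhc_le {z : ℂ} (hz : |z.im| ≤ Real.pi / 2) :
    ‖(sinhc z)⁻¹‖ ≤ 8 * (1 + ‖z‖) * Real.exp (-|z.re|) := by
  have h := exp_le_norm_sinhc hz
  have h0 : 0 < ‖sinhc z‖ := norm_pos_iff.2 (sinhc_ne_zero hz)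
  rw [norm_inv, Real.exp_neg, ← div_eq_mul_inv, inv_eq_one_div,
    div_le_div_iff₀ h0 (Real.exp_pos _)]
  linarith

/-- The mean value inequality for sinh on the vertical strip |Re w| ≤ |Re z|, where |cosh w| ≤
e^{|Re z|}. -/
theorem norm_sinhc_le (z : ℂ) : ‖sinhc z‖ ≤ Real.exp |z.re| := by
  rcases eq_or_ne z 0 with rfl | h0
  · simp [sinhc_zero]
  have hconv : Convex ℝ {w : ℂ | w.re ∈ Icc (-|z.re|) |z.re|} :=
    (convex_Icc _ _).linear_preimage reLm
  have hb : ∀ w ∈ {w : ℂ | w.re ∈ Icc (-|z.re|) |z.re|}, ‖cosh w‖ ≤ Real.exp |z.re| := by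
    intro w hw
    have h1 : |w.re| ≤ |z.re| := abs_le.2 hw
    rw [cosh, norm_div, norm_ofNat]
    have h2 := norm_add_le (exp w) (exp (-w))
    rw [norm_exp, norm_exp, neg_re] at h2
    have h3 : Real.exp w.re ≤ Real.exp |z.re| := Real.exp_le_exp.2 ((le_abs_self _).trans h1)
    have h4 : Real.exp (-w.re) ≤ Real.exp |z.re| := Real.exp_le_exp.2 ((neg_le_abs _).trans h1)
    linarith
  have h := hconv.norm_image_sub_le_of_norm_hasDerivWithin_le (f := sinh) (f' := cosh)
    (C := Real.exp |z.re|) (fun w _ => (hasDerivAt_sinh w).hasDerivWithinAt) hb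
    (x := 0) (y := z) (by simp) (by exact abs_le.1 le_rfl)
  rw [sinh_zero, sub_zero, sub_zero, ← mul_sinhc, norm_mul, mul_comm] at h
  exact le_of_mul_le_mul_right h (norm_pos_iff.2 h0)

theorem Qb_inv (b : ℝ) : Qb b⁻¹ = Qb b := by simp [Qb, add_comm]

theorem Qb_pos {b : ℝ} (hb : 0 < b) : 0 < Qb b := by unfold Qb; positivity

/-- The height of the lines of integration. -/
def height (b : ℝ) : ℝ := Real.pi * min b b⁻¹

theorem height_inv (b : ℝ) : height b⁻¹ = height b := by simp [height, min_comm]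

theorem height_pos {b : ℝ} (hb : 0 < b) : 0 < height b := by
  unfold height
  have := inv_pos.2 hb
  positivity

theorem height_le {b : ℝ} : height b ≤ Real.pi * b := by
  unfold height; gcongr; exact min_le_left _ _

theorem abs_im_mul_le {b : ℝ} (hb : 0 < b) {u : ℂ} (hu : |u.im| ≤ Real.pi * b⁻¹) :
    |((b : ℂ) * u / 2).im| ≤ Real.pi / 2 := by
  have : ((b : ℂ) * u / 2).im = b * u.im / 2 := by simp
  rw [this, abs_div, abs_mul, abs_of_pos hb, abs_two]
  have h := mul_le_mul_of_nonneg_left hu hb.le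
  have e : b * (Real.pi * b⁻¹) = Real.pi := by field_simp
  linarith

/-- The function `u² / (4 sinh(b u / 2) sinh(u / (2 b)))`, holomorphic near `0`. -/
def kern (b : ℝ) (u : ℂ) : ℂ := (sinhc (b * u / 2))⁻¹ * (sinhc ((b⁻¹ : ℝ) * u / 2))⁻¹

theorem kern_inv (b : ℝ) (u : ℂ) : kern b⁻¹ u = kern b u := by
  simp only [kern, inv_inv]; ring

theorem kern_neg (b : ℝ) (u : ℂ) : kern b (-u) = kern b u := by
  simp only [kern, mul_neg, neg_div, sinhc_neg]

theorem kern_zero (b : ℝ) : kern b 0 = 1 := by simp [kern, sinhc_zero]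

theorem abs_im_mul_left_le {b : ℝ} (hb : 0 < b) {u : ℂ} (hu : |u.im| ≤ height b) :
    |((b : ℂ) * u / 2).im| ≤ Real.pi / 2 :=
  abs_im_mul_le hb (hu.trans (by rw [← height_inv]; exact height_le))

theorem abs_im_mul_right_le {b : ℝ} (hb : 0 < b) {u : ℂ} (hu : |u.im| ≤ height b) :
    |(((b⁻¹ : ℝ) : ℂ) * u / 2).im| ≤ Real.pi / 2 :=
  abs_im_mul_le (inv_pos.2 hb) (hu.trans (by rw [inv_inv]; exact height_le))

theorem differentiableAt_kern {b : ℝ} (hb : 0 < b) {u : ℂ} (hu : |u.im| ≤ height b) :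
    DifferentiableAt ℂ (kern b) u := by
  unfold kern
  have h := differentiable_sinhc
  have h1 : DifferentiableAt ℂ (fun u => sinhc (b * u / 2)) u := by fun_prop
  have h2 : DifferentiableAt ℂ (fun u => sinhc ((b⁻¹ : ℝ) * u / 2)) u := by fun_prop
  exact (h1.inv (sinhc_ne_zero (abs_im_mul_left_le hb hu))).mul
    (h2.inv (sinhc_ne_zero (abs_im_mul_right_le hb hu)))

theorem norm_kern_le {b : ℝ} (hb : 0 < b) {u : ℂ} (hu : |u.im| ≤ height b) :
    ‖kern b u‖ ≤ 64 * ((1 + Qb b) * (1 + ‖u‖)) ^ 2 * Real.exp (-(Qb b / 2) * |u.re|) := by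
  have h1 := norm_inv_sinhc_le (abs_im_mul_left_le hb hu)
  have h2 := norm_inv_sinhc_le (abs_im_mul_right_le hb hu)
  have hbi := inv_pos.2 hb
  have n1 : ‖(b : ℂ) * u / 2‖ = b * ‖u‖ / 2 := by simp [abs_of_pos hb]
  have n2 : ‖((b⁻¹ : ℝ) : ℂ) * u / 2‖ = b⁻¹ * ‖u‖ / 2 := by simp [abs_of_pos hb]
  have r1 : |((b : ℂ) * u / 2).re| = b * |u.re| / 2 := by
    simp [abs_mul, abs_of_pos hb, abs_div]
  have r2 : |(((b⁻¹ : ℝ) : ℂ) * u / 2).re| = b⁻¹ * |u.re| / 2 := by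
    have : (((b⁻¹ : ℝ) : ℂ) * u / 2).re = b⁻¹ * u.re / 2 := by
      rw [div_ofNat_re, re_ofReal_mul]
    rw [this, abs_div, abs_mul, abs_of_pos hbi, abs_two]
  rw [n1, r1] at h1
  rw [n2, r2] at h2
  rw [kern, norm_mul]
  have hu0 := norm_nonneg u
  have e1 : 1 + b * ‖u‖ / 2 ≤ (1 + Qb b) * (1 + ‖u‖) := by
    unfold Qb; nlinarith [mul_nonneg hb.le hu0, mul_nonneg hbi.le hu0]
  have e2 : 1 + b⁻¹ * ‖u‖ / 2 ≤ (1 + Qb b) * (1 + ‖u‖) := by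
    unfold Qb; nlinarith [mul_nonneg hb.le hu0, mul_nonneg hbi.le hu0]
  calc _ ≤ (8 * (1 + b * ‖u‖ / 2) * Real.exp (-(b * |u.re| / 2))) *
        (8 * (1 + b⁻¹ * ‖u‖ / 2) * Real.exp (-(b⁻¹ * |u.re| / 2))) := by gcongr
    _ = 64 * ((1 + b * ‖u‖ / 2) * (1 + b⁻¹ * ‖u‖ / 2)) * Real.exp (-(Qb b / 2) * |u.re|) := by
        rw [show -(Qb b / 2) * |u.re| = -(b * |u.re| / 2) + -(b⁻¹ * |u.re| / 2) by
          unfold Qb; ring, Real.exp_add]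
        ring
    _ ≤ _ := by
        rw [pow_two ((1 + Qb b) * (1 + ‖u‖))]
        have := Qb_pos hb
        gcongr

/-- The margin δ is what makes the integrals converge: the kernels it multiplies decay like e^{-a|Re
u|}, up to polynomial factors, leaving e^{-δ|Re u|}. -/
theorem norm_exp_mul_le {a δ : ℝ} {x u : ℂ} (h1 : δ ≤ x.re) (h2 : x.re ≤ 2 * a - δ) :
    ‖exp ((x - a) * u)‖ ≤ Real.exp ((a - δ) * |u.re|) * Real.exp (-x.im * u.im) := by
  rw [norm_exp, ← Real.exp_add]
  have e : ((x - a) * u).re = (x.re - a) * u.re + -x.im * u.im := by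
    simp only [mul_re, sub_re, ofReal_re, sub_im, ofReal_im, sub_zero]; ring
  rw [e]
  have : (x.re - a) * u.re ≤ (a - δ) * |u.re| :=
    (le_abs_self _).trans (by
      rw [abs_mul]
      gcongr
      exact abs_le.2 ⟨by linarith, by linarith⟩)
  gcongr

/-- The basic bound for the integrands. -/
theorem exists_kern_bound {b δ : ℝ} (hb : 0 < b) (hδ : 0 < δ) (k : ℕ) :
    ∃ C : ℝ, 0 ≤ C ∧ ∀ x u : ℂ, δ ≤ x.re → x.re ≤ Qb b - δ → |u.im| ≤ height b →
      (1 + ‖u‖) ^ k * ‖kern b u * exp ((x - (Qb b / 2 : ℝ)) * u)‖ ≤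
        C / (1 + u.re ^ 2) * Real.exp (-x.im * u.im) := by
  have hh := height_pos hb
  have hQ := Qb_pos hb
  obtain ⟨C, hC0, hC⟩ := exists_pow_mul_exp_le (A := 1 + height b) (by positivity) hδ (k + 2)
  refine ⟨64 * (1 + Qb b) ^ 2 * C, by positivity, fun x u h1 h2 hu => ?_⟩
  rw [norm_mul]
  have hn : ‖u‖ ≤ height b + |u.re| := (norm_le_abs_re_add_abs_im u).trans (by linarith)
  calc (1 + ‖u‖) ^ k * (‖kern b u‖ * ‖exp ((x - (Qb b / 2 : ℝ)) * u)‖)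
      ≤ (1 + ‖u‖) ^ k * ((64 * ((1 + Qb b) * (1 + ‖u‖)) ^ 2 * Real.exp (-(Qb b / 2) * |u.re|)) *
        (Real.exp ((Qb b / 2 - δ) * |u.re|) * Real.exp (-x.im * u.im))) := by
        gcongr
        · exact norm_kern_le hb hu
        · exact norm_exp_mul_le h1 (by linarith)
    _ = 64 * (1 + Qb b) ^ 2 * ((1 + ‖u‖) ^ (k + 2) * Real.exp (-δ * |u.re|)) *
        Real.exp (-x.im * u.im) := by
        rw [show -δ * |u.re| = -(Qb b / 2) * |u.re| + (Qb b / 2 - δ) * |u.re| by ring,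
          Real.exp_add]
        ring
    _ ≤ 64 * (1 + Qb b) ^ 2 * ((1 + height b + |u.re|) ^ (k + 2) * Real.exp (-δ * |u.re|)) *
        Real.exp (-x.im * u.im) := by
        have : 1 + ‖u‖ ≤ 1 + height b + |u.re| := by linarith
        gcongr
    _ ≤ 64 * (1 + Qb b) ^ 2 * (C / (1 + u.re ^ 2)) * Real.exp (-x.im * u.im) := by
        gcongr
        exact hC _
    _ = _ := by ring

end BBeta

end

/-! ### The function W and its reflection formula. -/

noncomputable section

namespace BBeta

open Filter Topology Set

/-- The open strip `0 < Re x < Q`. -/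
def strip (b : ℝ) : Set ℂ := {x | 0 < x.re ∧ x.re < Qb b}

theorem isOpen_strip (b : ℝ) : IsOpen (strip b) :=
  (isOpen_lt continuous_const continuous_re).inter (isOpen_lt continuous_re continuous_const)

theorem strip_inv (b : ℝ) : strip b⁻¹ = strip b := by simp [strip, Qb_inv]

theorem sub_mem_strip {b : ℝ} {x : ℂ} (hx : x ∈ strip b) : (Qb b : ℂ) - x ∈ strip b := by
  obtain ⟨h1, h2⟩ := hx
  exact ⟨by simpa using h2, by simpa using h1⟩

/-- Turns membership in the open strip into the uniform bounds on a ball that the dominated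
integrals require. -/
theorem exists_margin {b : ℝ} {x : ℂ} (hx : x ∈ strip b) :
    ∃ δ > 0, ∀ z ∈ Metric.ball x δ, δ ≤ z.re ∧ z.re ≤ Qb b - δ ∧ |z.im| ≤ |x.im| + δ := by
  obtain ⟨h1, h2⟩ := hx
  have l1 := min_le_left x.re (Qb b - x.re)
  have l2 := min_le_right x.re (Qb b - x.re)
  refine ⟨min x.re (Qb b - x.re) / 2, half_pos (lt_min h1 (by linarith)), fun z hz => ?_⟩
  rw [Metric.mem_ball, dist_eq] at hz
  have h3 := abs_le.1 ((abs_re_le_norm (z - x)).trans hz.le)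
  have h4 := (abs_im_le_norm (z - x)).trans hz.le
  rw [sub_re] at h3
  rw [sub_im] at h4
  refine ⟨by linarith, by linarith, ?_⟩
  linarith [abs_sub_abs_le_abs_sub z.im x.im]

/-- The point of the line of integration with real part `v`. -/
def pt (b v : ℝ) : ℂ := v + height b * I

theorem pt_re (b v : ℝ) : (pt b v).re = v := by simp [pt]

theorem pt_im (b v : ℝ) : (pt b v).im = height b := by simp [pt]

theorem abs_pt_im {b : ℝ} (hb : 0 < b) (v : ℝ) : |(pt b v).im| ≤ height b := by
  rw [pt_im, abs_of_pos (height_pos hb)]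

theorem height_le_norm_pt {b : ℝ} (hb : 0 < b) (v : ℝ) : height b ≤ ‖pt b v‖ := by
  have := abs_im_le_norm (pt b v)
  rwa [pt_im, abs_of_pos (height_pos hb)] at this

theorem pt_ne_zero {b : ℝ} (hb : 0 < b) (v : ℝ) : pt b v ≠ 0 :=
  norm_pos_iff.1 ((height_pos hb).trans_le (height_le_norm_pt hb v))

theorem pt_inv (b v : ℝ) : pt b⁻¹ v = pt b v := by simp [pt, height_inv]

theorem continuous_pt (b : ℝ) : Continuous (pt b) := by unfold pt; fun_prop

theorem continuous_kern_pt {b : ℝ} (hb : 0 < b) : Continuous fun v => kern b (pt b v) :=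
  continuous_iff_continuousAt.2 fun v =>
    ContinuousAt.comp (differentiableAt_kern hb (abs_pt_im hb v)).continuousAt
      (continuous_pt b).continuousAt

/-- `G_b(x)` is a constant times `exp (-W b x)`, see `Gb_eq`. -/
def W (b : ℝ) (x : ℂ) : ℂ :=
  ∫ v : ℝ, kern b (pt b v) * exp ((x - (Qb b / 2 : ℝ)) * pt b v) / pt b v ^ 3

theorem W_inv (b : ℝ) (x : ℂ) : W b⁻¹ x = W b x := by
  simp only [W, kern_inv, pt_inv, Qb_inv]

theorem continuous_W_integrand {b : ℝ} (hb : 0 < b) (x : ℂ) (k : ℕ) :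
    Continuous fun v => kern b (pt b v) * exp ((x - (Qb b / 2 : ℝ)) * pt b v) / pt b v ^ k := by
  have h1 := continuous_kern_pt hb
  have h2 := continuous_pt b
  exact (h1.mul (by fun_prop)).div (by fun_prop) fun v => pow_ne_zero _ (pt_ne_zero hb v)

theorem exists_W_integrand_bound {b δ : ℝ} (hb : 0 < b) (hδ : 0 < δ) :
    ∃ C : ℝ, 0 ≤ C ∧ ∀ x : ℂ, δ ≤ x.re → x.re ≤ Qb b - δ → ∀ v : ℝ,
      ‖kern b (pt b v) * exp ((x - (Qb b / 2 : ℝ)) * pt b v) / pt b v ^ 3‖ ≤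
        C * Real.exp (-height b * x.im) / (1 + v ^ 2) := by
  obtain ⟨C, hC0, hC⟩ := exists_kern_bound hb hδ 0
  have hh := height_pos hb
  refine ⟨C / height b ^ 3, by positivity, fun x h1 h2 v => ?_⟩
  have h := hC x (pt b v) h1 h2 (abs_pt_im hb v)
  rw [pow_zero, one_mul, pt_re, pt_im] at h
  rw [norm_div, norm_pow]
  calc _ ≤ C / (1 + v ^ 2) * Real.exp (-x.im * height b) / height b ^ 3 := by
        have := height_le_norm_pt hb v
        gcongr
    _ = _ := by
      rw [show -x.im * height b = -height b * x.im by ring]; ring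

theorem integrable_W_integrand {b : ℝ} (hb : 0 < b) {x : ℂ} (hx : x ∈ strip b) :
    Integrable fun v => kern b (pt b v) * exp ((x - (Qb b / 2 : ℝ)) * pt b v) / pt b v ^ 3 := by
  obtain ⟨δ, hδ, hm⟩ := exists_margin hx
  obtain ⟨h1, h2, -⟩ := hm x (Metric.mem_ball_self hδ)
  obtain ⟨C, hC0, hC⟩ := exists_W_integrand_bound hb hδ
  exact (integrable_div_one_add_sq _).mono' (continuous_W_integrand hb x 3).aestronglyMeasurable
    (ae_of_all _ fun v => hC x h1 h2 v)

theorem hasDerivAt_W_integrand (a : ℝ) (k u x : ℂ) (n : ℕ) :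
    HasDerivAt (fun x : ℂ => k * exp ((x - a) * u) / u ^ n)
      (k * (exp ((x - a) * u) * u) / u ^ n) x := by
  have h := ((((hasDerivAt_id x).sub_const (a : ℂ)).mul_const u).cexp.const_mul k).div_const (u ^ n)
  simpa using h

theorem hasDerivAt_W {b : ℝ} (hb : 0 < b) {x : ℂ} (hx : x ∈ strip b) :
    HasDerivAt (W b) (∫ v : ℝ, kern b (pt b v) *
      (exp ((x - (Qb b / 2 : ℝ)) * pt b v) * pt b v) / pt b v ^ 3) x := by
  have h := hasDerivAt_integral_of_locally_dominated (μ := volume) (isOpen_strip b)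
    (F := fun x v => kern b (pt b v) * exp ((x - (Qb b / 2 : ℝ)) * pt b v) / pt b v ^ 3)
    (fun z _ => (continuous_W_integrand hb z 3).aestronglyMeasurable)
    (fun v z _ => (hasDerivAt_W_integrand _ _ _ z 3).differentiableAt.differentiableWithinAt)
    (fun z hz => ?_) hx
  · exact h.congr_deriv (integral_congr_ae (ae_of_all _ fun v =>
      (hasDerivAt_W_integrand _ _ _ x 3).deriv))
  · obtain ⟨δ, hδ, hm⟩ := exists_margin hz
    obtain ⟨C, hC0, hC⟩ := exists_W_integrand_bound hb hδ
    refine ⟨δ, hδ, _, integrable_div_one_add_sq (C * Real.exp (height b * (|z.im| + δ))),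
      ae_of_all _ fun v w hw => ?_⟩
    obtain ⟨h1, h2, h3⟩ := hm w hw.1
    refine (hC w h1 h2 v).trans ?_
    have hh := height_pos hb
    have : -height b * w.im ≤ height b * (|z.im| + δ) := by
      have := neg_abs_le w.im
      nlinarith
    gcongr

theorem continuousAt_W {b : ℝ} (hb : 0 < b) {x : ℂ} (hx : x ∈ strip b) : ContinuousAt (W b) x :=
  (hasDerivAt_W hb hx).continuousAt

/-- Since the line of integration lies at height h above the real axis, |e^{xu}| carries the factor
e^{-h Im x}; hence W decays as Im x → +∞. -/
theorem exists_norm_W_le {b δ : ℝ} (hb : 0 < b) (hδ : 0 < δ) :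
    ∃ C : ℝ, 0 ≤ C ∧ ∀ x : ℂ, δ ≤ x.re → x.re ≤ Qb b - δ →
      ‖W b x‖ ≤ C * Real.exp (-height b * x.im) := by
  obtain ⟨C, hC0, hC⟩ := exists_W_integrand_bound hb hδ
  refine ⟨C * Real.pi, by positivity, fun x h1 h2 => ?_⟩
  refine (norm_integral_le_of_norm_le (integrable_div_one_add_sq _)
    (ae_of_all _ (hC x h1 h2))).trans (le_of_eq ?_)
  simp only [div_eq_mul_inv]
  rw [integral_const_mul, integral_univ_inv_one_add_sq]
  ring

theorem two_cosh_sub_two (w : ℂ) : exp w + exp (-w) - 2 = w ^ 2 * sinhc (w / 2) ^ 2 := by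
  have h1 := mul_sinhc (w / 2)
  have h2 := cosh_two_mul (w / 2)
  have h3 := cosh_sq (w / 2)
  have h4 : 2 * cosh w = exp w + exp (-w) := by rw [cosh]; ring
  rw [mul_div_cancel₀ w two_ne_zero, h3, ← h1] at h2
  rw [← h4, h2]
  ring

/-- The reflection formula for `W`. -/
theorem W_add_W_sub {b : ℝ} (hb : 0 < b) {x : ℂ} (hx : x ∈ strip b) :
    W b x + W b (Qb b - x) =
      2 * W b (Qb b / 2 : ℝ) - Real.pi * I * (x - (Qb b / 2 : ℝ)) ^ 2 := by
  obtain ⟨a, ha⟩ : ∃ a : ℂ, a = x - (Qb b / 2 : ℝ) := ⟨_, rfl⟩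
  have ha' : (Qb b : ℂ) - x - (Qb b / 2 : ℝ) = -a := by rw [ha]; push_cast; ring
  have hx0 : ((Qb b / 2 : ℝ) : ℂ) ∈ strip b := by
    have := Qb_pos hb
    exact ⟨by simpa using this, by simpa using this⟩
  -- Subtracting 2W(Q/2) from W(x) + W(Q - x) puts e^{au} + e^{-au} - 2 in the numerator. Its double
  -- zero at u = 0 reduces the triple pole to the simple pole of F(u)/u.
  obtain ⟨F, hF⟩ : ∃ F : ℂ → ℂ, F = fun u => kern b u * (a ^ 2 * sinhc (a * u / 2) ^ 2) :=
    ⟨_, rfl⟩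
  have hFeq (u : ℂ) (hu : u ≠ 0) :
      F u = kern b u * (exp (a * u) + exp (-a * u) - 2) / u ^ 2 := by
    rw [neg_mul, two_cosh_sub_two, hF]
    field_simp
  have hFneg (u : ℂ) : F (-u) = F u := by
    simp only [hF, kern_neg, mul_neg, neg_div, sinhc_neg]
  obtain ⟨δ, hδ, hm⟩ := exists_margin hx
  obtain ⟨m1, m2, -⟩ := hm x (Metric.mem_ball_self hδ)
  obtain ⟨C, hC0, hC⟩ := exists_kern_bound hb hδ 0
  have hh := height_pos hb
  have hexpim (y : ℝ) (u : ℂ) (hu : u.im ∈ Icc (-height b) (height b)) :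
      Real.exp (-y * u.im) ≤ Real.exp (|y| * height b) := by
    have : -y * u.im ≤ |y| * height b := by
      refine (le_abs_self _).trans ?_
      rw [abs_mul, abs_neg]
      gcongr
      exact abs_le.2 hu
    gcongr
  have hFd (u : ℂ) (hu : u.im ∈ Icc (-height b) (height b)) : DifferentiableAt ℂ F u := by
    have := differentiable_sinhc
    rw [hF]
    exact (differentiableAt_kern hb (abs_le.2 hu)).mul (by fun_prop)
  have hFle (u : ℂ) (hu : u.im ∈ Icc (-height b) (height b)) :
      ‖F u‖ ≤ ‖a‖ ^ 2 * (2 * C * Real.exp (|x.im| * height b)) / (1 + u.re ^ 2) := by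
    have h1 := hC x u m1 m2 (abs_le.2 hu)
    have h2 := hC (Qb b - x) u (by simp; linarith) (by simp; linarith) (abs_le.2 hu)
    rw [pow_zero, one_mul, norm_mul] at h1 h2
    rw [← ha] at h1
    rw [ha'] at h2
    have h3 : ‖sinhc (a * u / 2) ^ 2‖ ≤ ‖exp (a * u)‖ + ‖exp (-a * u)‖ := by
      rw [norm_pow, norm_exp, norm_exp, neg_mul, neg_re]
      refine (pow_le_pow_left₀ (norm_nonneg _) (norm_sinhc_le _) 2).trans ?_
      rw [← Real.exp_nat_mul, div_ofNat_re, abs_div, abs_two]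
      push_cast
      rw [mul_div_cancel₀ _ two_ne_zero]
      rcases abs_cases (a * u).re with ⟨h, _⟩ | ⟨h, _⟩ <;> rw [h] <;>
        linarith [Real.exp_pos (a * u).re, Real.exp_pos (-(a * u).re)]
    have h4 := hexpim x.im u hu
    have h5 := hexpim ((Qb b - x : ℂ).im) u hu
    rw [show |(Qb b - x : ℂ).im| = |x.im| by simp] at h5
    rw [hF]
    simp only
    rw [norm_mul, norm_mul, norm_pow]
    calc ‖kern b u‖ * (‖a‖ ^ 2 * ‖sinhc (a * u / 2) ^ 2‖)
        ≤ ‖kern b u‖ * (‖a‖ ^ 2 * (‖exp (a * u)‖ + ‖exp (-a * u)‖)) := by gcongr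
      _ = ‖a‖ ^ 2 * (‖kern b u‖ * ‖exp (a * u)‖ + ‖kern b u‖ * ‖exp (-a * u)‖) := by ring
      _ ≤ ‖a‖ ^ 2 * (C / (1 + u.re ^ 2) * Real.exp (|x.im| * height b) +
            C / (1 + u.re ^ 2) * Real.exp (|x.im| * height b)) := by
          have hp : 0 ≤ C / (1 + u.re ^ 2) := by positivity
          exact mul_le_mul_of_nonneg_left (add_le_add
            (h1.trans (mul_le_mul_of_nonneg_left h4 hp))
            (h2.trans (mul_le_mul_of_nonneg_left h5 hp))) (by positivity)
      _ = _ := by ring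
  have hres := integral_lower_sub_integral_upper hh hFd hFle
  -- F is even, so F(u)/u is odd and its integrals on the two lines are opposite. Each is thus half
  -- of the residue term 2πi F(0) = 2πi a², up to sign.
  have hlow : ∫ v : ℝ, F (v + (-height b : ℝ) * I) / (v + (-height b : ℝ) * I) =
      -∫ v : ℝ, F (v + height b * I) / (v + height b * I) := by
    rw [← integral_neg, ← integral_neg_eq_self (fun v : ℝ =>
      -(F (v + height b * I) / (v + height b * I)))]
    refine integral_congr_ae (ae_of_all _ fun v => ?_)
    have e : (((-v : ℝ) : ℂ) + height b * I) = -(v + (-height b : ℝ) * I) := by push_cast; ring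
    simp only
    rw [e, hFneg, div_neg, neg_neg]
  have hF0 : F 0 = a ^ 2 := by simp [hF, kern_zero, sinhc_zero]
  have hsum : W b x + W b (Qb b - x) - 2 * W b (Qb b / 2 : ℝ) =
      ∫ v : ℝ, F (v + height b * I) / (v + height b * I) := by
    have i1 := integrable_W_integrand hb hx
    have i2 := integrable_W_integrand hb (sub_mem_strip hx)
    have i3 := (integrable_W_integrand hb hx0).const_mul 2
    unfold W
    rw [← integral_add i1 i2, ← integral_const_mul]
    refine (integral_sub (i1.add i2) i3).symm.trans ?_
    refine integral_congr_ae (ae_of_all _ fun v => ?_)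
    have hp := pt_ne_zero hb v
    simp only [Pi.add_apply]
    rw [show (v + height b * I : ℂ) = pt b v from rfl, hFeq _ hp, ← ha, ha', sub_self, zero_mul,
      exp_zero]
    field_simp
  rw [hlow, hF0] at hres
  rw [← ha]
  linear_combination hsum - (1 / 2) * hres

end BBeta

end

/-! ### The functional equation in the step b. -/

noncomputable section

namespace BBeta

open Filter Topology Set

/-- `b u e^{(x - 1/(2b)) u} / (2 b sinh (u / (2 b)))`, holomorphic near `0`. -/
def stepKern (b : ℝ) (x u : ℂ) : ℂ :=
  b * exp ((x - (b⁻¹ / 2 : ℝ)) * u) * (sinhc ((b⁻¹ : ℝ) * u / 2))⁻¹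

theorem stepKern_zero (b : ℝ) (x : ℂ) : stepKern b x 0 = b := by simp [stepKern, sinhc_zero]

theorem abs_im_le_of_mem {b : ℝ} (hb : 0 < b) {u : ℂ}
    (hu : u.im ∈ Icc (-(Real.pi * b)) (Real.pi * b)) :
    |(((b⁻¹ : ℝ) : ℂ) * u / 2).im| ≤ Real.pi / 2 :=
  abs_im_mul_le (inv_pos.2 hb) (by rw [inv_inv]; exact abs_le.2 hu)

theorem differentiableAt_stepKern {b : ℝ} (hb : 0 < b) (x : ℂ) {u : ℂ}
    (hu : u.im ∈ Icc (-(Real.pi * b)) (Real.pi * b)) : DifferentiableAt ℂ (stepKern b x) u := by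
  have := differentiable_sinhc
  have h : DifferentiableAt ℂ (fun u => sinhc ((b⁻¹ : ℝ) * u / 2)) u := by fun_prop
  unfold stepKern
  exact DifferentiableAt.mul (by fun_prop) (h.inv (sinhc_ne_zero (abs_im_le_of_mem hb hu)))

theorem exists_stepKern_bound {b : ℝ} (hb : 0 < b) {x : ℂ} (h0 : 0 < x.re) (h1 : x.re < b⁻¹) :
    ∃ C : ℝ, 0 ≤ C ∧ ∀ u : ℂ, u.im ∈ Icc (-(Real.pi * b)) (Real.pi * b) →
      ‖stepKern b x u‖ ≤ C / (1 + u.re ^ 2) := by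
  have hbi := inv_pos.2 hb
  obtain ⟨δ, hδ, hδ1, hδ2⟩ : ∃ δ > 0, δ ≤ x.re ∧ x.re ≤ 2 * (b⁻¹ / 2) - δ :=
    ⟨min x.re (b⁻¹ - x.re), lt_min h0 (by linarith), min_le_left _ _, by
      linarith [min_le_right x.re (b⁻¹ - x.re)]⟩
  obtain ⟨C, hC0, hC⟩ := exists_pow_mul_exp_le (A := 1 + b⁻¹ * (Real.pi * b))
    (by positivity) (show 0 < δ from hδ) 1
  refine ⟨b * 8 * (1 + b⁻¹) * Real.exp (|x.im| * (Real.pi * b)) * (1 + Real.pi * b) * C,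
    by positivity, fun u hu => ?_⟩
  have e1 := norm_exp_mul_le (u := u) hδ1 hδ2
  have e2 := norm_inv_sinhc_le (abs_im_le_of_mem hb hu)
  have n2 : ‖((b⁻¹ : ℝ) : ℂ) * u / 2‖ = b⁻¹ * ‖u‖ / 2 := by simp [abs_of_pos hb]
  have r2 : |(((b⁻¹ : ℝ) : ℂ) * u / 2).re| = b⁻¹ * |u.re| / 2 := by
    have : (((b⁻¹ : ℝ) : ℂ) * u / 2).re = b⁻¹ * u.re / 2 := by
      rw [div_ofNat_re, re_ofReal_mul]
    rw [this, abs_div, abs_mul, abs_of_pos hbi, abs_two]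
  rw [n2, r2] at e2
  have hn : ‖u‖ ≤ |u.re| + Real.pi * b := (norm_le_abs_re_add_abs_im u).trans (by
    linarith [abs_le.2 hu])
  have e3 : 1 + b⁻¹ * ‖u‖ / 2 ≤ (1 + b⁻¹) * (1 + Real.pi * b) *
      (1 + b⁻¹ * (Real.pi * b) + |u.re|) := by
    have hA : 0 ≤ Real.pi * b := by positivity
    have hv := abs_nonneg u.re
    have h1 : b⁻¹ * ‖u‖ / 2 ≤ b⁻¹ * (|u.re| + Real.pi * b) := by
      have := mul_le_mul_of_nonneg_left hn hbi.le
      have := mul_nonneg hbi.le (norm_nonneg u)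
      linarith
    have h2 : 1 + b⁻¹ * (|u.re| + Real.pi * b) ≤
        (1 + b⁻¹) * (1 + |u.re| + b⁻¹ * (Real.pi * b)) := by
      have := mul_nonneg hbi.le (mul_nonneg hbi.le hA)
      nlinarith
    refine (add_le_add_right h1 1).trans (h2.trans ?_)
    have h3 : 0 ≤ (1 + b⁻¹) * (1 + |u.re| + b⁻¹ * (Real.pi * b)) := by positivity
    nlinarith
  have e4 : Real.exp (-x.im * u.im) ≤ Real.exp (|x.im| * (Real.pi * b)) := by
    have : -x.im * u.im ≤ |x.im| * (Real.pi * b) := by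
      refine (le_abs_self _).trans ?_
      rw [abs_mul, abs_neg]
      gcongr
      exact abs_le.2 hu
    gcongr
  rw [stepKern, norm_mul, norm_mul, norm_real, Real.norm_of_nonneg hb.le]
  calc b * ‖exp ((x - (b⁻¹ / 2 : ℝ)) * u)‖ * ‖(sinhc ((b⁻¹ : ℝ) * u / 2))⁻¹‖
      ≤ b * (Real.exp ((b⁻¹ / 2 - δ) * |u.re|) * Real.exp (|x.im| * (Real.pi * b))) *
        (8 * ((1 + b⁻¹) * (1 + Real.pi * b) * (1 + b⁻¹ * (Real.pi * b) + |u.re|)) *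
          Real.exp (-(b⁻¹ * |u.re| / 2))) := by
        gcongr
        · exact e1.trans (by gcongr)
        · exact e2.trans (by gcongr)
    _ = b * 8 * (1 + b⁻¹) * Real.exp (|x.im| * (Real.pi * b)) * (1 + Real.pi * b) *
        ((1 + b⁻¹ * (Real.pi * b) + |u.re|) ^ 1 * Real.exp (-δ * |u.re|)) := by
        rw [show -δ * |u.re| = (b⁻¹ / 2 - δ) * |u.re| + -(b⁻¹ * |u.re| / 2) by ring, Real.exp_add]
        ring
    _ ≤ b * 8 * (1 + b⁻¹) * Real.exp (|x.im| * (Real.pi * b)) * (1 + Real.pi * b) *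
        (C / (1 + u.re ^ 2)) := by
        gcongr
        exact hC _
    _ = _ := by ring

theorem stepKern_div {b : ℝ} (hb : 0 < b) (x : ℂ) {u : ℂ} (hu : u ≠ 0) :
    stepKern b x u / u = exp ((x - (b⁻¹ / 2 : ℝ)) * u) / (2 * sinh ((b⁻¹ : ℝ) * u / 2)) := by
  have hbC : (b : ℂ) ≠ 0 := ofReal_ne_zero.2 hb.ne'
  rw [stepKern, ← mul_sinhc]
  push_cast
  by_cases h : sinhc ((b : ℂ)⁻¹ * u / 2) = 0
  · simp [h]
  · field_simp

/-- Translation by 2πib multiplies the integrand by an exponential, so its integrals on Im u = -πb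
and Im u = πb are proportional. Their difference is 2πi times the residue b at 0, which determines
both. The line at `height b` can be raised to πb because the only poles are in 2πibℤ. -/
theorem integral_stepKern_div {b : ℝ} (hb : 0 < b) {x : ℂ} (h0 : 0 < x.re) (h1 : x.re < b⁻¹) :
    (∫ v : ℝ, stepKern b x (pt b v) / pt b v) * (exp (-(2 * Real.pi * I * b * x)) - 1) =
      2 * Real.pi * I * b := by
  obtain ⟨C, hC0, hC⟩ := exists_stepKern_bound hb h0 h1
  have hη : 0 < Real.pi * b := by positivity
  have hh := height_pos hb
  have hbC : (b : ℂ) ≠ 0 := ofReal_ne_zero.2 hb.ne'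
  have hres := integral_lower_sub_integral_upper hη
    (fun u hu => differentiableAt_stepKern hb x hu) hC
  have hne (u : ℂ) (hu : u.im ∈ Icc (height b) (Real.pi * b)) : u ≠ 0 := by
    rintro rfl
    have := hu.1
    simp at this
    linarith
  have hsub (u : ℂ) (hu : u.im ∈ Icc (height b) (Real.pi * b)) :
      u.im ∈ Icc (-(Real.pi * b)) (Real.pi * b) := ⟨by linarith [hu.1], hu.2⟩
  have hdiff (u : ℂ) (hu : u.im ∈ Icc (height b) (Real.pi * b)) :
      DifferentiableAt ℂ (fun u => stepKern b x u / u) u :=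
    (differentiableAt_stepKern hb x (hsub u hu)).div differentiableAt_id (hne u hu)
  have hshift := integral_horizontal_line_eq (g := fun u => stepKern b x u / u)
    (C := C / height b)
    (fun u hu => (hdiff u (by simpa [mem_reProdIm] using hu)).continuousAt.continuousWithinAt)
    (fun u hu => hdiff u (Ioo_subset_Icc_self hu)) (fun u hu => ?_) (height_le (b := b))
  · have hlow : ∫ v : ℝ, stepKern b x (v + (-(Real.pi * b) : ℝ) * I) /
        (v + (-(Real.pi * b) : ℝ) * I) = exp (-(2 * Real.pi * I * b * x)) *
        ∫ v : ℝ, stepKern b x (v + (Real.pi * b : ℝ) * I) / (v + (Real.pi * b : ℝ) * I) := by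
      rw [← integral_const_mul]
      refine integral_congr_ae (ae_of_all _ fun v => ?_)
      have n1 : (v + (-(Real.pi * b) : ℝ) * I : ℂ) ≠ 0 := fun h => hη.ne' (by
        have := congrArg Complex.im h; simp [hb.ne'] at this)
      have n2 : (v + (Real.pi * b : ℝ) * I : ℂ) ≠ 0 := fun h => hη.ne' (by
        have := congrArg Complex.im h; simp [hb.ne'] at this)
      simp only
      rw [stepKern_div hb x n1, stepKern_div hb x n2]
      have e1 : (x - (b⁻¹ / 2 : ℝ)) * (v + (-(Real.pi * b) : ℝ) * I) =
          -(2 * Real.pi * I * b * x) + (x - (b⁻¹ / 2 : ℝ)) * (v + (Real.pi * b : ℝ) * I) +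
            Real.pi * I := by
        push_cast; field_simp; ring
      have e2 : ((b⁻¹ : ℝ) : ℂ) * (v + (-(Real.pi * b) : ℝ) * I) / 2 =
          ((b⁻¹ : ℝ) : ℂ) * (v + (Real.pi * b : ℝ) * I) / 2 - Real.pi * I := by
        push_cast; field_simp; ring
      rw [e1, e2, exp_add, exp_add, exp_pi_mul_I, sinh_sub, sinh_mul_I, cosh_mul_I, sin_pi, cos_pi]
      simp only [mul_neg, mul_one, zero_mul, mul_zero, sub_zero, neg_div_neg_eq, mul_div_assoc]
    have hup : ∫ v : ℝ, stepKern b x (pt b v) / pt b v = ∫ v : ℝ,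
      stepKern b x (v + (Real.pi * b : ℝ) * I) / (v + (Real.pi * b : ℝ) * I) := hshift
    rw [hup]
    rw [hlow, stepKern_zero] at hres
    linear_combination hres
  · have hn : height b ≤ ‖u‖ := hu.1.trans ((le_abs_self _).trans (abs_im_le_norm u))
    rw [norm_div]
    calc _ ≤ C / (1 + u.re ^ 2) / height b := by
          gcongr
          exact hC u (hsub u hu)
      _ = _ := by ring

theorem mem_strip_of_lt_inv {b : ℝ} (hb : 0 < b) {x : ℂ} (h0 : 0 < x.re) (h1 : x.re < b⁻¹) :
    x ∈ strip b ∧ x + b ∈ strip b := by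
  simp only [strip, Qb, mem_ofPred_eq, add_re, ofReal_re]
  refine ⟨⟨h0, ?_⟩, ?_, ?_⟩ <;> linarith

/-- In W'(x + b) - W'(x) the exponentials combine to 2 sinh(bu/2), which cancels one of the two
factors in the denominator of the kernel. -/
theorem hasDerivAt_W_step {b : ℝ} (hb : 0 < b) {x : ℂ} (h0 : 0 < x.re) (h1 : x.re < b⁻¹) :
    HasDerivAt (fun x => W b (x + b) - W b x) (∫ v : ℝ, stepKern b x (pt b v) / pt b v) x := by
  obtain ⟨hx, hxb⟩ := mem_strip_of_lt_inv hb h0 h1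
  have d1 := (hasDerivAt_W hb hxb).comp_add_const x (b : ℂ)
  have h_integ (z : ℂ) (hz : z ∈ strip b) : Integrable fun v : ℝ =>
      kern b (pt b v) * (exp ((z - (Qb b / 2 : ℝ)) * pt b v) * pt b v) / pt b v ^ 3 := by
    obtain ⟨δ, hδ, hm⟩ := exists_margin hz
    obtain ⟨m1, m2, -⟩ := hm z (Metric.mem_ball_self hδ)
    obtain ⟨C, hC0, hC⟩ := exists_kern_bound hb hδ 1
    have hh := height_pos hb
    refine (integrable_div_one_add_sq (C * Real.exp (-z.im * height b) / height b ^ 3)).mono'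
      (Continuous.aestronglyMeasurable ?_) (ae_of_all _ fun v => ?_)
    · have c1 := continuous_kern_pt hb
      have c2 := continuous_pt b
      exact (c1.mul (by fun_prop)).div (by fun_prop) fun v => pow_ne_zero _ (pt_ne_zero hb v)
    · have h := hC z (pt b v) m1 m2 (abs_pt_im hb v)
      rw [pt_re, pt_im, pow_one] at h
      have hn := height_le_norm_pt hb v
      rw [← mul_assoc, norm_div, norm_mul, norm_pow]
      calc _ ≤ (1 + ‖pt b v‖) * ‖kern b (pt b v) * exp ((z - (Qb b / 2 : ℝ)) * pt b v)‖ /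
            height b ^ 3 := by
            rw [mul_comm]
            gcongr
            linarith
        _ ≤ C / (1 + v ^ 2) * Real.exp (-z.im * height b) / height b ^ 3 := by gcongr
        _ = _ := by ring
  refine (d1.sub (hasDerivAt_W hb hx)).congr_deriv ?_
  rw [← integral_sub (h_integ _ hxb) (h_integ _ hx)]
  refine integral_congr_ae (ae_of_all _ fun v => ?_)
  have hp := pt_ne_zero hb v
  have hs := sinhc_ne_zero (abs_im_mul_left_le hb (abs_pt_im hb v))
  have hs' := sinhc_ne_zero (abs_im_mul_right_le hb (abs_pt_im hb v))
  simp only [kern, stepKern]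
  generalize pt b v = u at *
  have e1 : (x + b - (Qb b / 2 : ℝ)) * u = (x - (b⁻¹ / 2 : ℝ)) * u + b * u / 2 := by
    unfold Qb; push_cast; ring
  have e2 : (x - (Qb b / 2 : ℝ)) * u = (x - (b⁻¹ / 2 : ℝ)) * u + -(b * u / 2) := by
    unfold Qb; push_cast; ring
  have e3 : exp (b * u / 2) = exp (-(b * u / 2)) + b * u * sinhc (b * u / 2) := by
    have h := mul_sinhc (b * u / 2)
    rw [sinh] at h
    linear_combination -2 * h
  rw [e1, e2, exp_add, exp_add, e3]
  field_simp
  ring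

/-- The functional equation for `exp (-W)`. -/
theorem exp_neg_W_add {b : ℝ} (hb : 0 < b) {x : ℂ} (h0 : 0 < x.re) (h1 : x.re < b⁻¹) :
    exp (-W b (x + b)) = (1 - exp (2 * Real.pi * I * b * x)) * exp (-W b x) := by
  -- By the previous integral, (W(x + b) - W(x))' is minus the logarithmic derivative of 1 -
  -- e^{2πibx}, so E is constant. Letting Im x → +∞, where W and e^{2πibx} tend to 0, shows that E =
  -- 1.
  obtain ⟨E, hE⟩ : ∃ E : ℂ → ℂ, E = fun x =>
    (1 - exp (2 * Real.pi * I * b * x)) * exp (W b (x + b) - W b x) := ⟨_, rfl⟩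
  have hEd (z : ℂ) (hz0 : 0 < z.re) (hz1 : z.re < b⁻¹) : HasDerivAt E 0 z := by
    have d1 := (((hasDerivAt_id z).const_mul (2 * Real.pi * I * b)).cexp.const_sub 1).mul
      (hasDerivAt_W_step hb hz0 hz1).cexp
    rw [hE]
    refine d1.congr_deriv ?_
    have hK := integral_stepKern_div hb hz0 hz1
    rw [exp_neg] at hK
    have hne := exp_ne_zero (2 * Real.pi * I * b * z)
    generalize (∫ v : ℝ, stepKern b z (pt b v) / pt b v) = K at *
    have hK' : K * (1 - exp (2 * Real.pi * I * b * z)) =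
        2 * Real.pi * I * b * exp (2 * Real.pi * I * b * z) := by
      field_simp at hK
      linear_combination hK
    simp only [id, mul_one]
    linear_combination exp (W b (z + b) - W b z) * hK'
  have hU : IsOpen {z : ℂ | 0 < z.re ∧ z.re < b⁻¹} :=
    (isOpen_lt continuous_const continuous_re).inter (isOpen_lt continuous_re continuous_const)
  have hconv : Convex ℝ {z : ℂ | 0 < z.re ∧ z.re < b⁻¹} :=
    (convex_Ioo 0 b⁻¹).linear_preimage reLm
  have hconst (T : ℝ) : E x = E (x + T * I) := by
    refine hU.is_const_of_deriv_eq_zero hconv.isPreconnected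
      (fun z hz => (hEd z hz.1 hz.2).differentiableAt.differentiableWithinAt)
      (fun z hz => (hEd z hz.1 hz.2).deriv) ⟨h0, h1⟩ ?_
    simpa using ⟨h0, h1⟩
  have hWlim (z : ℂ) (hz : z ∈ strip b) :
      Tendsto (fun T : ℝ => W b (z + T * I)) atTop (𝓝 0) := by
    obtain ⟨δ, hδ, hm⟩ := exists_margin hz
    obtain ⟨m1, m2, -⟩ := hm z (Metric.mem_ball_self hδ)
    obtain ⟨C, hC0, hC⟩ := exists_norm_W_le hb hδ
    refine squeeze_zero_norm (fun T => hC (z + T * I) (by simpa using m1) (by simpa using m2)) ?_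
    have : Tendsto (fun T : ℝ => -height b * (z + T * I).im) atTop atBot := by
      simp only [add_im, mul_im, ofReal_re, I_im, mul_one, ofReal_im, I_re, mul_zero, add_zero]
      exact (tendsto_atTop_add_const_left _ _ tendsto_id).const_mul_atTop_of_neg
        (by linarith [height_pos hb])
    simpa using (Real.tendsto_exp_atBot.comp this).const_mul C
  obtain ⟨hx, hxb⟩ := mem_strip_of_lt_inv hb h0 h1
  have hexp : Tendsto (fun T : ℝ => exp (2 * Real.pi * I * b * (x + T * I))) atTop (𝓝 0) := by
    rw [tendsto_zero_iff_norm_tendsto_zero]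
    have e (T : ℝ) : ‖exp (2 * Real.pi * I * b * (x + T * I))‖ =
        Real.exp (-(2 * Real.pi * b) * (x.im + T)) := by
      rw [norm_exp]
      congr 1
      simp
    simp only [e]
    exact Real.tendsto_exp_atBot.comp
      ((tendsto_atTop_add_const_left _ _ tendsto_id).const_mul_atTop_of_neg
        (by have := Real.pi_pos; simp; positivity))
  have hElim : Tendsto (fun T : ℝ => E (x + T * I)) atTop (𝓝 1) := by
    have l1 := (hWlim _ hxb).sub (hWlim _ hx)
    have l2 := (hexp.const_sub 1).mul ((continuous_exp.tendsto _).comp l1)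
    rw [sub_zero, sub_zero, exp_zero, mul_one] at l2
    rw [hE]
    refine l2.congr fun T => ?_
    simp only [Function.comp_apply]
    rw [show x + b + T * I = x + T * I + b by ring]
  have hE1 : E x = 1 := tendsto_nhds_unique
    (tendsto_const_nhds.congr hconst) hElim
  rw [hE] at hE1
  have h2 := exp_ne_zero (W b x)
  have h3 := exp_ne_zero (W b (x + b))
  simp only [exp_sub] at hE1
  rw [exp_neg, exp_neg]
  field_simp at hE1 ⊢
  linear_combination -hE1

end BBeta

end

/-! ### The double zeta series as a Mellin transform. -/

noncomputable section

namespace BBeta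

open Filter Topology Set

theorem integrableOn_rpow_mul_exp {σ δ : ℝ} (hσ : 0 < σ) (hδ : 0 < δ) :
    IntegrableOn (fun t : ℝ => t ^ (σ - 1) * Real.exp (-(δ * t))) (Ioi 0) := by
  simpa using integrableOn_rpow_mul_exp_neg_mul_rpow (p := 1) (s := σ - 1) (by linarith)
    one_pos hδ

theorem norm_cpow_mul_exp {t : ℝ} (ht : 0 < t) (a r : ℂ) :
    ‖(t : ℂ) ^ (a - 1) * exp (-(r * t))‖ = t ^ (a.re - 1) * Real.exp (-(r.re * t)) := by
  rw [norm_mul, norm_cpow_eq_rpow_re_of_pos ht, norm_exp]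
  simp

theorem continuousOn_cpow_mul_exp (a r : ℂ) :
    ContinuousOn (fun t : ℝ => (t : ℂ) ^ (a - 1) * exp (-(r * t))) (Ioi 0) := by
  intro t ht
  exact ((continuousAt_ofReal_cpow_const t (a - 1) (Or.inr (ne_of_gt ht))).mul
    (by fun_prop)).continuousWithinAt

theorem integrableOn_cpow_mul_exp {a r : ℂ} (ha : 0 < a.re) (hr : 0 < r.re) :
    IntegrableOn (fun t : ℝ => (t : ℂ) ^ (a - 1) * exp (-(r * t))) (Ioi 0) := by
  refine (integrableOn_rpow_mul_exp ha hr).mono'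
    ((continuousOn_cpow_mul_exp a r).aestronglyMeasurable measurableSet_Ioi) ?_
  filter_upwards [ae_restrict_mem measurableSet_Ioi] with t ht
  exact (norm_cpow_mul_exp ht a r).le

/-- The Gamma integral with a complex rate. -/
theorem integral_cpow_mul_exp {a r : ℂ} (ha : 0 < a.re) (hr : 0 < r.re) :
    ∫ t : ℝ in Ioi 0, (t : ℂ) ^ (a - 1) * exp (-(r * t)) = r ^ (-a) * Gamma a := by
  have hU : IsOpen {r : ℂ | 0 < r.re} := isOpen_lt continuous_const continuous_re
  have hconv : Convex ℝ {r : ℂ | 0 < r.re} := (convex_Ioi 0).linear_preimage reLm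
  have h1 : DifferentiableOn ℂ
      (fun r : ℂ => ∫ t : ℝ in Ioi 0, (t : ℂ) ^ (a - 1) * exp (-(r * t))) {r : ℂ | 0 < r.re} := by
    refine differentiableOn_integral_of_locally_dominated hU
      (fun r _ => (continuousOn_cpow_mul_exp a r).aestronglyMeasurable measurableSet_Ioi)
      (fun t => by fun_prop) fun r₀ hr₀ => ?_
    have hr₀' : 0 < r₀.re := hr₀
    refine ⟨r₀.re / 2, by positivity, _, integrableOn_rpow_mul_exp ha (half_pos hr₀'),
      ?_⟩
    filter_upwards [ae_restrict_mem measurableSet_Ioi] with t ht r hr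
    have ht' : 0 < t := ht
    rw [norm_cpow_mul_exp ht']
    have h1 := hr.1
    rw [Metric.mem_ball, dist_eq] at h1
    have h2 := (abs_le.1 ((abs_re_le_norm (r - r₀)).trans h1.le)).1
    rw [sub_re] at h2
    gcongr
    linarith
  have h2 : DifferentiableOn ℂ (fun r : ℂ => r ^ (-a) * Gamma a) {r : ℂ | 0 < r.re} := by
    intro r hr
    have : r ∈ slitPlane := Or.inl hr
    exact ((differentiableAt_id.cpow_const this).mul_const _).differentiableWithinAt
  have h3 := (h1.analyticOnNhd hU).eqOn_of_preconnected_of_frequently_eq (h2.analyticOnNhd hU)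
    hconv.isPreconnected (z₀ := 1) (by simp) ?_
  · exact h3 hr
  -- Positive real rates accumulating at 1, where the real-rate Gamma integral applies; this is
  -- enough for the identity theorem.
  · have hseq : Tendsto (fun n : ℕ => (1 : ℂ) + ((1 / ((n : ℝ) + 1) : ℝ) : ℂ)) atTop (𝓝[≠] 1) := by
      refine tendsto_nhdsWithin_iff.2 ⟨?_, Eventually.of_forall fun n => ?_⟩
      · have h2 := (continuous_ofReal.tendsto _).comp
          (tendsto_one_div_add_atTop_nhds_zero_nat (𝕜 := ℝ))
        simpa using h2.const_add 1
      · simp only [mem_compl_iff, mem_singleton_iff, add_eq_left, ofReal_eq_zero]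
        positivity
    refine hseq.frequently (Eventually.of_forall fun n => ?_).frequently
    obtain ⟨ρ, hρ, hρe⟩ : ∃ ρ : ℝ, 0 < ρ ∧ (1 : ℂ) + ((1 / ((n : ℝ) + 1) : ℝ) : ℂ) = ρ :=
      ⟨1 + 1 / ((n : ℝ) + 1), by positivity, by push_cast; ring⟩
    rw [hρe, integral_cpow_mul_exp_neg_mul_Ioi ha hρ, one_div, inv_cpow _ _ (by
      rw [arg_ofReal_of_nonneg hρ.le]; exact Real.pi_pos.ne), cpow_neg]

/-- The square of each lattice term dominates c²(n₁ + 1)(n₂ + 1), so the double series is bounded by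
a product of two single series with exponent σ/2 > 1. -/
theorem summable_lattice {b x σ : ℝ} (hb : 0 < b) (hx : 0 < x) (hσ : 2 < σ) :
    Summable fun n : ℕ × ℕ => (x + n.1 * b + n.2 * b⁻¹) ^ (-σ) := by
  have hbi := inv_pos.2 hb
  obtain ⟨c, hc, c1, c2, c3⟩ : ∃ c > 0, 2 * c ≤ x ∧ c ≤ b ∧ c ≤ b⁻¹ := by
    refine ⟨min (x / 2) (min b b⁻¹), by positivity, ?_, ?_, ?_⟩
    · linarith [min_le_left (x / 2) (min b b⁻¹)]
    · exact (min_le_right _ _).trans (min_le_left _ _)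
    · exact (min_le_right _ _).trans (min_le_right _ _)
  have hs : Summable fun n : ℕ => ((n : ℝ) + 1) ^ (-(σ / 2)) := by
    have h := (summable_nat_add_iff 1).2 (Real.summable_nat_rpow.2 (show -(σ / 2) < -1 by linarith))
    simpa using h
  have hprod := (hs.mul_of_nonneg hs (fun n => by positivity) (fun n => by positivity)).mul_left
    ((c ^ 2) ^ (-(σ / 2)))
  refine Summable.of_nonneg_of_le (fun n => by positivity) (fun n => ?_) hprod
  have hp : (0 : ℝ) ≤ n.1 := Nat.cast_nonneg _
  have hq : (0 : ℝ) ≤ n.2 := Nat.cast_nonneg _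
  have hr0 : 0 < x + n.1 * b + n.2 * b⁻¹ := by positivity
  have h1 : c * ((n.1 + 1) + (n.2 + 1)) ≤ x + n.1 * b + n.2 * b⁻¹ := by
    have := mul_le_mul_of_nonneg_left c2 hp
    have := mul_le_mul_of_nonneg_left c3 hq
    nlinarith
  have h2 : c ^ 2 * ((n.1 + 1) * (n.2 + 1)) ≤ (x + n.1 * b + n.2 * b⁻¹) ^ 2 := by
    refine le_trans ?_ (pow_le_pow_left₀ (by positivity) h1 2)
    rw [mul_pow]
    gcongr
    nlinarith
  rw [← Real.mul_rpow (by positivity) (by positivity),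
    ← Real.mul_rpow (by positivity) (by positivity)]
  calc (x + n.1 * b + n.2 * b⁻¹) ^ (-σ)
      = ((x + n.1 * b + n.2 * b⁻¹) ^ 2) ^ (-(σ / 2)) := by
        rw [← Real.rpow_natCast, ← Real.rpow_mul hr0.le]
        congr 1
        push_cast; ring
    _ ≤ _ := Real.rpow_le_rpow_of_nonpos (by positivity) h2 (by linarith)

/-- The Mellin kernel on the positive half line. -/
def mellinKern (b : ℝ) (y : ℂ) (u : ℝ) : ℂ :=
  kern b u * exp ((y - (Qb b / 2 : ℝ)) * u) / (u : ℂ) ^ 2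

/-- A product of two geometric series, with 1 - e^{-cu} rewritten as e^{-cu/2} · 2 sinh(cu/2).
Pulling out the half exponentials moves x to Q - x in the normalisation of the kernel. -/
theorem hasSum_mellinKern {b : ℝ} (hb : 0 < b) (x : ℂ) {u : ℝ} (hu : 0 < u) :
    HasSum (fun n : ℕ × ℕ => exp (-((x + n.1 * b + n.2 * (b⁻¹ : ℝ)) * u)))
      (mellinKern b (Qb b - x) u) := by
  have hbi := inv_pos.2 hb
  have hgeom (c : ℝ) (hc : 0 < c) : HasSum (fun n : ℕ => exp (-(c * u)) ^ n)
      (1 - exp (-(c * u)))⁻¹ := by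
    refine hasSum_geometric_of_norm_lt_one ?_
    rw [norm_exp]
    simpa using mul_pos hc hu
  have hs (c : ℝ) (hc : 0 < c) : Summable fun n : ℕ => ‖exp (-((c : ℂ) * u)) ^ n‖ := by
    simp only [norm_pow]
    refine summable_geometric_of_lt_one (norm_nonneg _) ?_
    rw [norm_exp]
    simpa using mul_pos hc hu
  have h := ((hgeom b hb).mul (hgeom b⁻¹ hbi)
    (summable_mul_of_summable_norm (hs b hb) (hs b⁻¹ hbi))).mul_left (exp (-(x * u)))
  have huC : (u : ℂ) ≠ 0 := ofReal_ne_zero.2 hu.ne'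
  have hbC : (b : ℂ) ≠ 0 := ofReal_ne_zero.2 hb.ne'
  have hker (c : ℝ) (hc : 0 < c) : (1 - exp (-((c : ℂ) * u)))⁻¹ =
      exp (c * u / 2) * (sinhc (c * u / 2))⁻¹ / (c * u) := by
    have hcC : (c : ℂ) ≠ 0 := ofReal_ne_zero.2 hc.ne'
    have e : 1 - exp (-((c : ℂ) * u)) = exp (-(c * u / 2)) * (c * u * sinhc (c * u / 2)) := by
      have h := mul_sinhc ((c : ℂ) * u / 2)
      rw [sinh] at h
      have h2 : (c : ℂ) * u * sinhc (c * u / 2) = exp (c * u / 2) - exp (-(c * u / 2)) := by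
        linear_combination 2 * h
      rw [h2, mul_sub, ← exp_add, ← exp_add, neg_add_cancel, exp_zero]
      congr 2
      ring
    rw [e, mul_inv, mul_inv, exp_neg, inv_inv]
    ring
  have hfun : (fun n : ℕ × ℕ => exp (-((x + n.1 * b + n.2 * (b⁻¹ : ℝ)) * u))) = fun n : ℕ × ℕ =>
      exp (-(x * u)) * (exp (-((b : ℂ) * u)) ^ n.1 * exp (-(((b⁻¹ : ℝ) : ℂ) * u)) ^ n.2) := by
    funext n
    rw [← exp_nat_mul, ← exp_nat_mul, ← exp_add, ← exp_add]
    congr 1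
    ring
  have hval : mellinKern b (Qb b - x) u = exp (-(x * u)) *
      ((1 - exp (-((b : ℂ) * u)))⁻¹ * (1 - exp (-(((b⁻¹ : ℝ) : ℂ) * u)))⁻¹) := by
    rw [hker b hb, hker b⁻¹ hbi, mellinKern, kern]
    have e : ((Qb b : ℂ) - x - (Qb b / 2 : ℝ)) * u =
        -(x * u) + (b * u / 2 + (b⁻¹ : ℝ) * u / 2) := by
      unfold Qb; push_cast; ring
    rw [e, exp_add, exp_add]
    have hbC' : ((b⁻¹ : ℝ) : ℂ) = (b : ℂ)⁻¹ := by push_cast; ring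
    generalize sinhc (b * u / 2) = s1
    generalize sinhc ((b⁻¹ : ℝ) * u / 2) = s2
    rw [hbC']
    field_simp
  rw [hfun, hval]
  exact h

/-- Termwise integration of the geometric expansion. The sum of the integrals of norms is Γ(Re t)
times the lattice sum for Re x and Re t, which is where Re t > 2 is used. -/
theorem hasSum_doubleZeta {b : ℝ} (hb : 0 < b) {x t : ℂ} (hx : 0 < x.re) (ht : 2 < t.re) :
    HasSum (fun n : ℕ × ℕ => (x + n.1 * b + n.2 * (b⁻¹ : ℝ)) ^ (-t))
      (mellin (mellinKern b (Qb b - x)) t / Gamma t) := by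
  have ht0 : 0 < t.re := by linarith
  have hG : Gamma t ≠ 0 := Gamma_ne_zero_of_re_pos ht0
  have hbi := inv_pos.2 hb
  have hr (n : ℕ × ℕ) : (x + n.1 * b + n.2 * (b⁻¹ : ℝ)).re = x.re + n.1 * b + n.2 * b⁻¹ := by
    simp [-ofReal_inv]
  have hrpos (n : ℕ × ℕ) : 0 < (x + n.1 * b + n.2 * (b⁻¹ : ℝ)).re := by
    rw [hr]; positivity
  have hsum := hasSum_integral_of_summable_integral_norm (μ := volume.restrict (Ioi (0 : ℝ)))
    (F := fun (n : ℕ × ℕ) (u : ℝ) =>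
      (u : ℂ) ^ (t - 1) * exp (-((x + n.1 * b + n.2 * (b⁻¹ : ℝ)) * u)))
    (fun n => integrableOn_cpow_mul_exp ht0 (hrpos n)) ?_
  · have e1 : ∫ u : ℝ in Ioi 0, ∑' n : ℕ × ℕ,
        (u : ℂ) ^ (t - 1) * exp (-((x + n.1 * b + n.2 * (b⁻¹ : ℝ)) * u)) =
        mellin (mellinKern b (Qb b - x)) t := by
      refine setIntegral_congr_fun measurableSet_Ioi fun u hu => ?_
      exact ((hasSum_mellinKern hb x hu).mul_left _).tsum_eq
    rw [e1] at hsum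
    refine (hsum.div_const (Gamma t)).congr_fun fun n => ?_
    rw [integral_cpow_mul_exp ht0 (hrpos n), mul_div_cancel_right₀ _ hG]
  · have e2 (n : ℕ × ℕ) : ∫ u : ℝ in Ioi 0,
        ‖(u : ℂ) ^ (t - 1) * exp (-((x + n.1 * b + n.2 * (b⁻¹ : ℝ)) * u))‖ =
        (x.re + n.1 * b + n.2 * b⁻¹) ^ (-t.re) * Real.Gamma t.re := by
      have hp := hrpos n
      rw [setIntegral_congr_fun measurableSet_Ioi fun u hu => norm_cpow_mul_exp hu t _,
        Real.integral_rpow_mul_exp_neg_mul_Ioi ht0 hp, hr, one_div, Real.inv_rpow (by positivity),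
        Real.rpow_neg (by positivity)]
    simp only [e2]
    exact (summable_lattice hb hx ht).mul_right _

end BBeta

end

/-! ### Powers on the upper half plane and the contour form of the Mellin integral. -/

noncomputable section

namespace BBeta

open Filter Topology Set

/-- The branch of the logarithm with imaginary part in `[0, π]` on the closed upper half plane. -/
def upperLog (u : ℂ) : ℂ := log (-I * u) + Real.pi / 2 * I

/-- The power `u ^ (t - 1)` for `u` in the closed upper half plane. -/
def upperPow (t u : ℂ) : ℂ := exp ((t - 1) * upperLog u)

theorem exp_upperLog {u : ℂ} (hu : u ≠ 0) : exp (upperLog u) = u := by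
  rw [upperLog, exp_add, exp_log (mul_ne_zero (neg_ne_zero.2 I_ne_zero) hu), exp_pi_div_two_mul_I]
  linear_combination (-u) * I_sq

theorem neg_I_mul_mem_slitPlane {u : ℂ} (hu : 0 ≤ u.im) (hu0 : u ≠ 0) : -I * u ∈ slitPlane := by
  rw [mem_slitPlane_iff]
  rcases hu.lt_or_eq with h | h
  · left; simpa using h
  · right
    have : u.re ≠ 0 := fun h' => hu0 (Complex.ext h' h.symm)
    simpa using this

theorem upperLog_re {u : ℂ} : (upperLog u).re = Real.log ‖u‖ := by
  simp [upperLog, log_re]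

theorem abs_upperLog_im_le {u : ℂ} (hu : 0 ≤ u.im) : |(upperLog u).im| ≤ Real.pi := by
  have h1 : |arg (-I * u)| ≤ Real.pi / 2 := abs_arg_le_pi_div_two_iff.2 (by simpa using hu)
  have h2 : (upperLog u).im = arg (-I * u) + Real.pi / 2 := by
    simp [upperLog, log_im]
  rw [h2]
  have h3 := abs_le.1 h1
  exact abs_le.2 ⟨by linarith [Real.pi_pos], by linarith⟩

theorem norm_upperPow_le (t : ℂ) {u : ℂ} (hu : 0 ≤ u.im) (hu0 : u ≠ 0) :
    ‖upperPow t u‖ ≤ ‖u‖ ^ (t.re - 1) * Real.exp (Real.pi * |t.im|) := by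
  have hn : 0 < ‖u‖ := norm_pos_iff.2 hu0
  rw [upperPow, norm_exp, Real.rpow_def_of_pos hn, ← Real.exp_add]
  have e : ((t - 1) * upperLog u).re = Real.log ‖u‖ * (t.re - 1) - t.im * (upperLog u).im := by
    rw [mul_re, upperLog_re]; simp; ring
  have h2 : -(t.im * (upperLog u).im) ≤ Real.pi * |t.im| := by
    refine (neg_le_abs _).trans ?_
    rw [abs_mul, mul_comm]
    gcongr
    exact abs_upperLog_im_le hu
  rw [e]
  gcongr
  linarith

theorem upperPow_zero {u : ℂ} (hu : u ≠ 0) : upperPow 0 u = u⁻¹ := by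
  rw [upperPow, zero_sub, neg_one_mul, exp_neg, exp_upperLog hu]

theorem upperPow_ofReal (t : ℂ) {v : ℝ} (hv : 0 < v) : upperPow t v = (v : ℂ) ^ (t - 1) := by
  have h : upperLog v = log v := by
    rw [upperLog, log_mul_ofReal v hv _ (neg_ne_zero.2 I_ne_zero), log_neg_I, ofReal_log hv.le]
    ring
  rw [upperPow, h, cpow_def_of_ne_zero (ofReal_ne_zero.2 hv.ne'), mul_comm]

theorem upperPow_neg_ofReal (t : ℂ) {v : ℝ} (hv : 0 < v) :
    upperPow t (-v) = -exp (Real.pi * I * t) * (v : ℂ) ^ (t - 1) := by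
  have h : upperLog (-v) = log v + Real.pi * I := by
    rw [upperLog, show -I * (-(v : ℂ)) = I * v by ring, log_mul_ofReal v hv _ I_ne_zero, log_I,
      ofReal_log hv.le]
    ring
  rw [upperPow, h, cpow_def_of_ne_zero (ofReal_ne_zero.2 hv.ne'), mul_add, exp_add,
    show (t - 1) * (Real.pi * I) = Real.pi * I * t - Real.pi * I by ring, exp_sub, exp_pi_mul_I,
    mul_comm (t - 1)]
  ring

theorem differentiableAt_upperPow (t : ℂ) {u : ℂ} (hu : 0 ≤ u.im) (hu0 : u ≠ 0) :
    DifferentiableAt ℂ (upperPow t) u := by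
  have h : DifferentiableAt ℂ (fun u => log (-I * u)) u :=
    (show DifferentiableAt ℂ (fun u : ℂ => -I * u) u by fun_prop).clog
      (neg_I_mul_mem_slitPlane hu hu0)
  unfold upperPow upperLog
  fun_prop

/-- The integrand of `contourMellin`. -/
def cmInt (b : ℝ) (y t u : ℂ) : ℂ :=
  upperPow t u * (kern b u * exp ((y - (Qb b / 2 : ℝ)) * u)) / u ^ 2

/-- The Mellin transform of the kernel along the line `ℝ + i height`, an entire function of `t`. -/
def contourMellin (b : ℝ) (y t : ℂ) : ℂ := ∫ v : ℝ, cmInt b y t (pt b v)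

theorem contourMellin_zero {b : ℝ} (hb : 0 < b) (y : ℂ) : contourMellin b y 0 = W b y := by
  unfold contourMellin W
  refine integral_congr_ae (ae_of_all _ fun v => ?_)
  have hp := pt_ne_zero hb v
  simp only [cmInt, upperPow_zero hp]
  field_simp

theorem differentiableAt_cmInt {b : ℝ} (hb : 0 < b) (y t : ℂ) {u : ℂ} (hu : 0 ≤ u.im)
    (hu' : u.im ≤ height b) (hu0 : u ≠ 0) : DifferentiableAt ℂ (cmInt b y t) u := by
  unfold cmInt
  exact ((differentiableAt_upperPow t hu hu0).mul ((differentiableAt_kern hb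
    (by rwa [abs_of_nonneg hu])).mul (by fun_prop))).div (by fun_prop) (pow_ne_zero 2 hu0)

theorem norm_cmInt_le (b : ℝ) (y t : ℂ) {u : ℂ} (hu : 0 ≤ u.im) (hu0 : u ≠ 0) :
    ‖cmInt b y t u‖ ≤ ‖u‖ ^ (t.re - 3) * Real.exp (Real.pi * |t.im|) *
      ‖kern b u * exp ((y - (Qb b / 2 : ℝ)) * u)‖ := by
  have hn : 0 < ‖u‖ := norm_pos_iff.2 hu0
  rw [cmInt, norm_div, norm_mul, norm_pow, div_le_iff₀ (by positivity)]
  have e : ‖u‖ ^ (t.re - 1) = ‖u‖ ^ (t.re - 3) * ‖u‖ ^ 2 := by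
    rw [← Real.rpow_natCast, ← Real.rpow_add hn]
    congr 1
    push_cast; ring
  calc _ ≤ ‖u‖ ^ (t.re - 1) * Real.exp (Real.pi * |t.im|) *
        ‖kern b u * exp ((y - (Qb b / 2 : ℝ)) * u)‖ := by
        gcongr; exact norm_upperPow_le t hu hu0
    _ = _ := by rw [e]; ring

/-- The line avoids u = 0, so no condition on t is needed there, while the exponential decay of the
kernel absorbs any power of u at infinity. -/
theorem differentiable_contourMellin {b : ℝ} (hb : 0 < b) {y : ℂ} (hy : y ∈ strip b) :
    Differentiable ℂ (contourMellin b y) := by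
  have hh := height_pos hb
  have him (v : ℝ) : 0 ≤ (pt b v).im := by rw [pt_im]; exact hh.le
  rw [← differentiableOn_univ]
  refine differentiableOn_integral_of_locally_dominated isOpen_univ (fun t _ => ?_) (fun v => ?_)
    fun t₀ _ => ?_
  · refine (continuous_iff_continuousAt.2 fun v => ?_).aestronglyMeasurable
    exact ContinuousAt.comp (differentiableAt_cmInt hb y t (him v) (by rw [pt_im])
      (pt_ne_zero hb v)).continuousAt (continuous_pt b).continuousAt
  · unfold cmInt upperPow
    fun_prop
  -- N bounds |Re t - 3| on the unit ball about t₀: one unit for the ball and three for the shift of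
  -- the exponent.
  · obtain ⟨N, hN⟩ := exists_nat_ge (|t₀.re| + 4)
    obtain ⟨δ, hδ, hm⟩ := exists_margin hy
    obtain ⟨m1, m2, -⟩ := hm y (Metric.mem_ball_self hδ)
    obtain ⟨C, hC0, hC⟩ := exists_kern_bound hb hδ N
    refine ⟨1, one_pos, _, integrable_div_one_add_sq ((1 + (height b)⁻¹) ^ N *
      Real.exp (Real.pi * (|t₀.im| + 1)) * (C * Real.exp (-y.im * height b))),
      ae_of_all _ fun v t ht => ?_⟩
    have h1 := ht.1
    rw [Metric.mem_ball, dist_eq] at h1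
    have h2 := (abs_re_le_norm (t - t₀)).trans h1.le
    have h3 := (abs_im_le_norm (t - t₀)).trans h1.le
    rw [sub_re] at h2
    rw [sub_im] at h3
    have h4 : |t.im| ≤ |t₀.im| + 1 := by linarith [abs_sub_abs_le_abs_sub t.im t₀.im]
    have h5 : |t.re - 3| ≤ N := by
      have := abs_sub_abs_le_abs_sub t.re t₀.re
      have := abs_sub t.re 3
      rw [abs_of_pos (show (0 : ℝ) < 3 by norm_num)] at this
      linarith
    have hn := height_le_norm_pt hb v
    have hn0 : 0 < ‖pt b v‖ := hh.trans_le hn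
    have h6 : ‖pt b v‖ ^ (t.re - 3) ≤ (1 + (height b)⁻¹) ^ N * (1 + ‖pt b v‖) ^ N := by
      have a1 : (1 : ℝ) ≤ (1 + (height b)⁻¹) ^ N := one_le_pow₀ (by
        have := inv_pos.2 hh; linarith)
      have a2 : (1 : ℝ) ≤ (1 + ‖pt b v‖) ^ N := one_le_pow₀ (by linarith)
      rcases le_total 0 (t.re - 3) with h | h
      · rw [abs_of_nonneg h] at h5
        calc ‖pt b v‖ ^ (t.re - 3) ≤ (1 + ‖pt b v‖) ^ (t.re - 3) := by gcongr; linarith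
          _ ≤ (1 + ‖pt b v‖) ^ (N : ℝ) := by
            gcongr; linarith
          _ = 1 * (1 + ‖pt b v‖) ^ N := by rw [Real.rpow_natCast, one_mul]
          _ ≤ _ := by gcongr
      · rw [abs_of_nonpos h] at h5
        calc ‖pt b v‖ ^ (t.re - 3) ≤ height b ^ (t.re - 3) :=
              Real.rpow_le_rpow_of_nonpos hh hn h
          _ = (height b)⁻¹ ^ (-(t.re - 3)) := by
              rw [Real.inv_rpow hh.le, Real.rpow_neg hh.le, inv_inv]
          _ ≤ (1 + (height b)⁻¹) ^ (-(t.re - 3)) := by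
              have := inv_pos.2 hh
              gcongr; linarith
              linarith
          _ ≤ (1 + (height b)⁻¹) ^ (N : ℝ) := by
              have := inv_pos.2 hh
              gcongr; linarith
          _ = (1 + (height b)⁻¹) ^ N * 1 := by rw [Real.rpow_natCast, mul_one]
          _ ≤ _ := by gcongr
    have h7 := hC y (pt b v) m1 m2 (abs_pt_im hb v)
    rw [pt_re, pt_im] at h7
    refine (norm_cmInt_le b y t (him v) (pt_ne_zero hb v)).trans ?_
    calc _ ≤ ((1 + (height b)⁻¹) ^ N * (1 + ‖pt b v‖) ^ N) *
          Real.exp (Real.pi * (|t₀.im| + 1)) *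
          ‖kern b (pt b v) * exp ((y - (Qb b / 2 : ℝ)) * pt b v)‖ := by gcongr
      _ = (1 + (height b)⁻¹) ^ N * Real.exp (Real.pi * (|t₀.im| + 1)) * ((1 + ‖pt b v‖) ^ N *
          ‖kern b (pt b v) * exp ((y - (Qb b / 2 : ℝ)) * pt b v)‖) := by ring
      _ ≤ (1 + (height b)⁻¹) ^ N * Real.exp (Real.pi * (|t₀.im| + 1)) *
          (C / (1 + v ^ 2) * Real.exp (-y.im * height b)) := by gcongr
      _ = _ := by ring

/-- For Re t > 3 the integrand behaves like |u|^{Re t - 3} at 0, so the line can be lowered onto ℝ.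
On the negative half line u = -v produces the factor -e^{πit}, and evenness of the kernel exchanges
y and Q - y. -/
theorem contourMellin_eq_of_three_lt {b : ℝ} (hb : 0 < b) {y t : ℂ} (hy : y ∈ strip b)
    (ht : 3 < t.re) :
    contourMellin b y t = mellin (mellinKern b y) t -
      exp (Real.pi * I * t) * mellin (mellinKern b (Qb b - y)) t := by
  have hh := height_pos hb
  obtain ⟨N, hN⟩ := exists_nat_ge (t.re - 3)
  obtain ⟨δ, hδ, hm⟩ := exists_margin hy
  obtain ⟨m1, m2, -⟩ := hm y (Metric.mem_ball_self hδ)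
  obtain ⟨C, hC0, hC⟩ := exists_kern_bound hb hδ N
  obtain ⟨D, hD⟩ : ∃ D : ℝ, D = Real.exp (Real.pi * |t.im|) * (C * Real.exp (|y.im| * height b)) :=
    ⟨_, rfl⟩
  have hD0 : 0 ≤ D := by rw [hD]; positivity
  -- Division by zero gives the value 0, which is also the limit at 0 because Re t > 3; this makes
  -- the integrand continuous on the closed strip.
  have hz : cmInt b y t 0 = 0 := by simp [cmInt]
  have hexp (u : ℂ) (hu : u.im ∈ Icc 0 (height b)) :
      Real.exp (-y.im * u.im) ≤ Real.exp (|y.im| * height b) := by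
    have : -y.im * u.im ≤ |y.im| * height b := by
      refine (le_abs_self _).trans ?_
      rw [abs_mul, abs_neg, abs_of_nonneg hu.1]
      gcongr
      exact hu.2
    gcongr
  have hker (u : ℂ) (hu : u.im ∈ Icc 0 (height b)) : (1 + ‖u‖) ^ N *
      ‖kern b u * exp ((y - (Qb b / 2 : ℝ)) * u)‖ ≤
      C * Real.exp (|y.im| * height b) / (1 + u.re ^ 2) := by
    refine (hC y u m1 m2 (by rw [abs_of_nonneg hu.1]; exact hu.2)).trans ?_
    rw [div_mul_eq_mul_div]
    exact div_le_div_of_nonneg_right (mul_le_mul_of_nonneg_left (hexp u hu) hC0) (by positivity)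
  have hle (u : ℂ) (hu : u.im ∈ Icc 0 (height b)) : ‖cmInt b y t u‖ ≤ D / (1 + u.re ^ 2) := by
    rcases eq_or_ne u 0 with rfl | hu0
    · rw [hz, norm_zero]; positivity
    refine (norm_cmInt_le b y t hu.1 hu0).trans ?_
    have h1 : ‖u‖ ^ (t.re - 3) ≤ (1 + ‖u‖) ^ N := by
      rw [← Real.rpow_natCast]
      have := norm_nonneg u
      calc ‖u‖ ^ (t.re - 3) ≤ (1 + ‖u‖) ^ (t.re - 3) := by
              gcongr
              linarith
        _ ≤ _ := by gcongr; linarith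
    calc _ ≤ (1 + ‖u‖) ^ N * Real.exp (Real.pi * |t.im|) *
          ‖kern b u * exp ((y - (Qb b / 2 : ℝ)) * u)‖ := by gcongr
      _ = Real.exp (Real.pi * |t.im|) * ((1 + ‖u‖) ^ N *
          ‖kern b u * exp ((y - (Qb b / 2 : ℝ)) * u)‖) := by ring
      _ ≤ Real.exp (Real.pi * |t.im|) * (C * Real.exp (|y.im| * height b) / (1 + u.re ^ 2)) := by
          gcongr; exact hker u hu
      _ = _ := by rw [hD]; ring
  have hle0 (u : ℂ) (hu : u.im ∈ Icc 0 (height b)) : ‖cmInt b y t u‖ ≤ ‖u‖ ^ (t.re - 3) * D := by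
    rcases eq_or_ne u 0 with rfl | hu0
    · rw [hz, norm_zero]; positivity
    refine (norm_cmInt_le b y t hu.1 hu0).trans ?_
    rw [mul_assoc, hD]
    gcongr
    have h2 := hker u hu
    have h3 : (1 : ℝ) ≤ (1 + ‖u‖) ^ N := one_le_pow₀ (by linarith [norm_nonneg u])
    calc ‖kern b u * exp ((y - (Qb b / 2 : ℝ)) * u)‖
        = 1 * ‖kern b u * exp ((y - (Qb b / 2 : ℝ)) * u)‖ := (one_mul _).symm
      _ ≤ (1 + ‖u‖) ^ N * ‖kern b u * exp ((y - (Qb b / 2 : ℝ)) * u)‖ := by gcongr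
      _ ≤ _ := h2
      _ ≤ _ := div_le_self (by positivity) (by nlinarith [sq_nonneg u.re])
  have hcont : ContinuousOn (cmInt b y t) (univ ×ℂ Icc 0 (height b)) := by
    intro u hu
    have hu' : u.im ∈ Icc 0 (height b) := by simpa [mem_reProdIm] using hu
    rcases eq_or_ne u 0 with rfl | hu0
    · rw [ContinuousWithinAt, hz]
      refine squeeze_zero_norm' (a := fun u => ‖u‖ ^ (t.re - 3) * D) ?_ ?_
      · filter_upwards [self_mem_nhdsWithin] with w hw
        exact hle0 w (by simpa [mem_reProdIm] using hw)
      · have h1 : Continuous fun u : ℂ => ‖u‖ ^ (t.re - 3) * D :=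
          (continuous_norm.rpow_const fun _ => Or.inr (by linarith)).mul continuous_const
        have h2 := h1.tendsto 0
        rw [norm_zero, Real.zero_rpow (by linarith), zero_mul] at h2
        exact h2.mono_left nhdsWithin_le_nhds
    · exact (differentiableAt_cmInt hb y t hu'.1 hu'.2 hu0).continuousAt.continuousWithinAt
  have hshift := integral_horizontal_line_eq hcont (fun u hu =>
    differentiableAt_cmInt hb y t hu.1.le hu.2.le (by rintro rfl; simp at hu)) hle hh.le
  have h_integ : Integrable fun v : ℝ => cmInt b y t (v + (0 : ℝ) * I) :=
    integrable_horizontal_line hcont ⟨le_rfl, hh.le⟩ hle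
  have hcm : contourMellin b y t = ∫ v : ℝ, cmInt b y t (v + (0 : ℝ) * I) := hshift.symm
  rw [hcm, ← integral_add_compl measurableSet_Ioi h_integ, compl_Ioi, sub_eq_add_neg]
  congr 1
  · refine setIntegral_congr_fun measurableSet_Ioi fun v hv => ?_
    simp only [ofReal_zero, zero_mul, add_zero, smul_eq_mul, cmInt, mellinKern,
      upperPow_ofReal t hv]
    ring
  · have := integral_comp_neg_Ioi (0 : ℝ) (fun v : ℝ => cmInt b y t (v + (0 : ℝ) * I))
    rw [neg_zero] at this
    rw [← this, mellin, ← integral_const_mul, ← integral_neg]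
    refine setIntegral_congr_fun measurableSet_Ioi fun v hv => ?_
    simp only [ofReal_zero, zero_mul, add_zero, smul_eq_mul, cmInt, mellinKern, ofReal_neg,
      upperPow_neg_ofReal t hv, kern_neg]
    rw [show (y - (Qb b / 2 : ℝ)) * -(v : ℂ) = ((Qb b : ℂ) - y - (Qb b / 2 : ℝ)) * v by
      push_cast; ring]
    ring

end BBeta

end

/-! ### Continuation of the double zeta function, and G_b as a constant times exp(-W). -/

noncomputable section

namespace BBeta

open Filter Topology Set Asymptotics

theorem norm_mellinKern {b : ℝ} (y : ℂ) (u : ℝ) : ‖mellinKern b y u‖ =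
    ‖kern b u * exp ((y - (Qb b / 2 : ℝ)) * u)‖ / u ^ 2 := by
  rw [mellinKern, norm_div, norm_pow, norm_real, Real.norm_eq_abs, sq_abs]

theorem continuousOn_mellinKern {b : ℝ} (hb : 0 < b) (y : ℂ) :
    ContinuousOn (mellinKern b y) (Ioi 0) := by
  intro u hu
  have hu0 : (u : ℂ) ^ 2 ≠ 0 := pow_ne_zero 2 (ofReal_ne_zero.2 (ne_of_gt hu))
  have h1 : ContinuousAt (fun u : ℝ => kern b u) u :=
    ContinuousAt.comp (f := fun u : ℝ => (u : ℂ)) (differentiableAt_kern hb (by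
      simp [(height_pos hb).le])).continuousAt continuous_ofReal.continuousAt
  exact ((h1.mul (by fun_prop)).div (by fun_prop) hu0).continuousWithinAt

theorem differentiableAt_mellin_mellinKern {b : ℝ} (hb : 0 < b) {y t : ℂ} (hy : y ∈ strip b)
    (ht : 2 < t.re) : DifferentiableAt ℂ (mellin (mellinKern b y)) t := by
  have hh := height_pos hb
  obtain ⟨δ, hδ, hm⟩ := exists_margin hy
  obtain ⟨m1, m2, -⟩ := hm y (Metric.mem_ball_self hδ)
  have hbound (k : ℕ) : ∃ C : ℝ, ∀ u : ℝ, 0 < u →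
      (1 + u) ^ k * ‖kern b u * exp ((y - (Qb b / 2 : ℝ)) * u)‖ ≤ C := by
    obtain ⟨C, hC0, hC⟩ := exists_kern_bound hb hδ k
    refine ⟨C, fun u hu => ?_⟩
    have h := hC y u m1 m2 (by simp [hh.le])
    rw [ofReal_im, ofReal_re, mul_zero, Real.exp_zero, mul_one, norm_real,
      Real.norm_of_nonneg hu.le] at h
    exact h.trans (div_le_self hC0 (by nlinarith [sq_nonneg u]))
  obtain ⟨k, hk⟩ := exists_nat_gt t.re
  obtain ⟨C₀, hC₀⟩ := hbound 0
  obtain ⟨C₁, hC₁⟩ := hbound k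
  refine mellin_differentiableAt_of_isBigO_rpow (a := k) (b := 2)
    ((continuousOn_mellinKern hb y).locallyIntegrableOn measurableSet_Ioi) ?_ hk ?_ ht
  · refine IsBigO.of_bound C₁ ?_
    filter_upwards [eventually_ge_atTop 1] with u hu
    have hu0 : 0 < u := by linarith
    have hp : 0 < u ^ k := by positivity
    rw [Real.norm_of_nonneg (by positivity), Real.rpow_neg hu0.le, Real.rpow_natCast,
      ← div_eq_mul_inv, le_div_iff₀ hp, norm_mellinKern]
    have h1 : ‖kern b u * exp ((y - (Qb b / 2 : ℝ)) * u)‖ / u ^ 2 ≤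
        ‖kern b u * exp ((y - (Qb b / 2 : ℝ)) * u)‖ :=
      div_le_self (norm_nonneg _) (one_le_pow₀ hu)
    have h2 : u ^ k ≤ (1 + u) ^ k := by gcongr; linarith
    calc _ ≤ ‖kern b u * exp ((y - (Qb b / 2 : ℝ)) * u)‖ * (1 + u) ^ k := by gcongr
      _ ≤ C₁ := by rw [mul_comm]; exact hC₁ u hu0
  · refine IsBigO.of_bound C₀ ?_
    filter_upwards [self_mem_nhdsWithin] with u hu
    have hu0 : 0 < u := hu
    rw [Real.norm_of_nonneg (by positivity), Real.rpow_neg hu0.le, ← div_eq_mul_inv,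
      norm_mellinKern]
    have h := hC₀ u hu0
    rw [pow_zero, one_mul] at h
    rw [Real.rpow_two]
    gcongr

theorem contourMellin_eq {b : ℝ} (hb : 0 < b) {y t : ℂ} (hy : y ∈ strip b) (ht : 2 < t.re) :
    contourMellin b y t = mellin (mellinKern b y) t -
      exp (Real.pi * I * t) * mellin (mellinKern b (Qb b - y)) t := by
  have hU : IsOpen {t : ℂ | 2 < t.re} := isOpen_lt continuous_const continuous_re
  have hconv : Convex ℝ {t : ℂ | 2 < t.re} := (convex_Ioi 2).linear_preimage reLm
  have h1 : DifferentiableOn ℂ (contourMellin b y) {t : ℂ | 2 < t.re} :=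
    (differentiable_contourMellin hb hy).differentiableOn
  have h2 : DifferentiableOn ℂ (fun t => mellin (mellinKern b y) t -
      exp (Real.pi * I * t) * mellin (mellinKern b (Qb b - y)) t) {t : ℂ | 2 < t.re} := fun t ht =>
    ((differentiableAt_mellin_mellinKern hb hy ht).sub
      (DifferentiableAt.mul (by fun_prop)
        (differentiableAt_mellin_mellinKern hb (sub_mem_strip hy) ht))).differentiableWithinAt
  refine (h1.analyticOnNhd hU).eqOn_of_preconnected_of_eventuallyEq (h2.analyticOnNhd hU)
    hconv.isPreconnected (z₀ := 4) (by simp; norm_num) ?_ ht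
  filter_upwards [(isOpen_lt continuous_const continuous_re).mem_nhds
    (show (3 : ℝ) < (4 : ℂ).re by simp; norm_num)] with t ht
  exact contourMellin_eq_of_three_lt hb hy ht

/-- The formula continuing the double zeta function away from the positive integers. -/
def zetaCont (b : ℝ) (x t : ℂ) : ℂ :=
  Gamma (1 - t) * (I / (2 * Real.pi)) *
    (exp (-(Real.pi * I * t)) * contourMellin b (Qb b - x) t + contourMellin b x t)

/-- The relations for x and Q - x form a linear system in the two half-line Mellin transforms.
Eliminating one leaves -2i sin(πt) times the other, and Γ(t)Γ(1 - t) = π/sin(πt) turns this into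
division by Γ(t). -/
theorem zetaCont_eq {b : ℝ} (hb : 0 < b) {x t : ℂ} (hx : x ∈ strip b) (ht : 2 < t.re)
    (hs : sin (Real.pi * t) ≠ 0) :
    zetaCont b x t = mellin (mellinKern b (Qb b - x)) t / Gamma t := by
  have hG : Gamma t ≠ 0 := Gamma_ne_zero_of_re_pos (by linarith)
  have hpi : (Real.pi : ℂ) ≠ 0 := ofReal_ne_zero.2 Real.pi_ne_zero
  rw [zetaCont, contourMellin_eq hb hx ht, contourMellin_eq hb (sub_mem_strip hx) ht,
    sub_sub_cancel, eq_div_iff hG]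
  have h1 := Gamma_mul_Gamma_one_sub t
  rw [eq_div_iff hs] at h1
  have h2 : exp (-(Real.pi * I * t)) * exp (Real.pi * I * t) = 1 := by
    rw [← exp_add, neg_add_cancel, exp_zero]
  have h3 : exp (-(Real.pi * I * t)) - exp (Real.pi * I * t) = -2 * I * sin (Real.pi * t) := by
    rw [sin]
    rw [show -(↑Real.pi * t) * I = -(Real.pi * I * t) by ring,
      show (↑Real.pi * t) * I = Real.pi * I * t by ring]
    linear_combination (exp (-(Real.pi * I * t)) - exp (Real.pi * I * t)) * I_sq
  generalize mellin (mellinKern b x) t = M1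
  generalize mellin (mellinKern b (Qb b - x)) t = M2
  have h4 : exp (-(Real.pi * I * t)) * (M2 - exp (Real.pi * I * t) * M1) +
      (M1 - exp (Real.pi * I * t) * M2) = -2 * I * sin (Real.pi * t) * M2 := by
    linear_combination (-M1) * h2 + M2 * h3
  rw [h4]
  generalize sin (Real.pi * t) = s at *
  field_simp
  linear_combination (-(Gamma (1 - t) * s * M2 * Gamma t)) * I_sq + M2 * h1

theorem differentiableAt_zetaCont {b : ℝ} (hb : 0 < b) {x t : ℂ} (hx : x ∈ strip b)
    (ht : ∀ m : ℕ, t ≠ 1 + m) : DifferentiableAt ℂ (zetaCont b x) t := by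
  have h1 : DifferentiableAt ℂ (fun t => Gamma (1 - t)) t :=
    DifferentiableAt.comp (f := fun t : ℂ => 1 - t) t (differentiableAt_Gamma _ fun m h => ht m (by
      linear_combination -h)) (by fun_prop)
  have h2 := differentiable_contourMellin hb hx
  have h3 := differentiable_contourMellin hb (sub_mem_strip hx)
  unfold zetaCont
  fun_prop

open Classical in
/-- The analytic continuation of the double zeta function. -/
def zetaFun (b : ℝ) (x t : ℂ) : ℂ :=
  if 2 < t.re then mellin (mellinKern b (Qb b - x)) t / Gamma t else zetaCont b x t

theorem isDoubleZeta_zetaFun {b : ℝ} (hb : 0 < b) {x : ℂ} (hx : x ∈ strip b) :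
    IsDoubleZeta b b⁻¹ x (zetaFun b x) := by
  refine ⟨fun t ht => DifferentiableAt.differentiableWithinAt ?_, fun t ht => ?_⟩
  · rcases lt_or_ge 2 t.re with h | h
    · have hev : zetaFun b x =ᶠ[𝓝 t]
          fun t => mellin (mellinKern b (Qb b - x)) t / Gamma t := by
        filter_upwards [(isOpen_lt continuous_const continuous_re).mem_nhds h] with s hs
        rw [zetaFun, if_pos hs]
      refine DifferentiableAt.congr_of_eventuallyEq ?_ hev
      have h0 : 0 < t.re := by linarith
      exact (differentiableAt_mellin_mellinKern hb (sub_mem_strip hx) h).div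
        (differentiableAt_Gamma _ fun m hm => by
          rw [hm] at h0
          simp at h0
          linarith [m.cast_nonneg (α := ℝ)]) (Gamma_ne_zero_of_re_pos h0)
    -- On this open set the contour formula represents the function: where it overlaps Re t > 2 the
    -- point is not an integer, so sin(πt) ≠ 0 there. Of the poles of Γ(1 - t), only the excluded t
    -- = 1 lies in it.
    · have ht2 : t.re < 2 ∨ t.im ≠ 0 := by
        rcases h.lt_or_eq with h | h
        · exact Or.inl h
        · refine Or.inr fun h' => ht (Or.inr (Complex.ext ?_ ?_))
          · simpa using h
          · simpa using h'
      have hopen : IsOpen {s : ℂ | s.re < 2 ∨ s.im ≠ 0} :=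
        (isOpen_lt continuous_re continuous_const).union
          (isOpen_ne_fun continuous_im continuous_const)
      have hev : zetaFun b x =ᶠ[𝓝 t] zetaCont b x := by
        filter_upwards [hopen.mem_nhds ht2] with s hs
        rw [zetaFun]
        split_ifs with h2
        · refine (zetaCont_eq hb hx h2 fun hsin => ?_).symm
          obtain ⟨k, hk⟩ := sin_eq_zero_iff.1 hsin
          have hsk : s = k := by
            have hpi : (Real.pi : ℂ) ≠ 0 := ofReal_ne_zero.2 Real.pi_ne_zero
            exact mul_left_cancel₀ hpi (by rw [hk]; ring)
          rcases hs with hs | hs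
          · linarith
          · exact hs (by rw [hsk]; simp)
        · rfl
      refine DifferentiableAt.congr_of_eventuallyEq ?_ hev
      refine differentiableAt_zetaCont hb hx fun m hm => ?_
      rcases Nat.eq_zero_or_pos m with h0 | h0
      · rw [h0] at hm
        exact ht (Or.inl (by simpa using hm))
      · have h1 : (1 : ℝ) ≤ m := by exact_mod_cast h0
        rcases ht2 with h2 | h2
        · rw [hm] at h2; simp at h2; linarith
        · rw [hm] at h2; simp at h2
  · rw [zetaFun, if_pos ht]
    exact hasSum_doubleZeta hb hx.1 ht

/-- `doubleZeta` is an arbitrary choice among continuations; uniqueness away from 1 and 2 identifies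
it near 0 with the contour formula. -/
theorem deriv_doubleZeta {b : ℝ} (hb : 0 < b) {x : ℂ} (hx : x ∈ strip b) :
    deriv (doubleZeta b b⁻¹ x) 0 = deriv (zetaCont b x) 0 := by
  have h := isDoubleZeta_zetaFun hb hx
  have heq := (isDoubleZeta_doubleZeta h).eqOn h
  refine EventuallyEq.deriv_eq ?_
  filter_upwards [(isOpen_lt continuous_re continuous_const).mem_nhds
    (show (0 : ℂ).re < 1 by simp)] with t ht
  have ht' : t.re < 1 := ht
  rw [heq fun hmem => ?_, zetaFun, if_neg (by linarith)]
  rcases hmem with h1 | h1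
  · rw [h1] at ht'; simp at ht'
  · rw [mem_singleton_iff.1 h1] at ht'; simp at ht'

/-- The difference contains the factor e^{-πit} - 1, which vanishes at t = 0. Only its derivative
-πi contributes, multiplied by the contour integrals at t = 0, which are values of W; no derivative
of a contour integral appears. -/
theorem deriv_zetaCont_sub {b : ℝ} (hb : 0 < b) {x : ℂ} (hx : x ∈ strip b) :
    deriv (zetaCont b x) 0 - deriv (zetaCont b (Qb b - x)) 0 = (W b (Qb b - x) - W b x) / 2 := by
  have hne (m : ℕ) : (0 : ℂ) ≠ 1 + m := fun h => by
    have h1 : ((1 + m : ℕ) : ℂ) = 0 := by push_cast; exact h.symm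
    exact absurd (Nat.cast_eq_zero.1 h1) (by omega)
  have d1 := differentiableAt_zetaCont hb hx hne
  have d2 := differentiableAt_zetaCont hb (sub_mem_strip hx) hne
  rw [← deriv_sub d1 d2]
  have e : zetaCont b x - zetaCont b (Qb b - x) = fun t => (exp (-(Real.pi * I * t)) - 1) *
      (Gamma (1 - t) * (I / (2 * Real.pi)) *
        (contourMellin b (Qb b - x) t - contourMellin b x t)) := by
    funext t
    simp only [Pi.sub_apply, zetaCont, sub_sub_cancel]
    ring
  have h1 : HasDerivAt (fun t : ℂ => exp (-(Real.pi * I * t)) - 1) (-(Real.pi * I)) 0 := by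
    have := (((hasDerivAt_id (0 : ℂ)).const_mul (Real.pi * I : ℂ)).neg.cexp).sub_const 1
    simpa using this
  have h2 : DifferentiableAt ℂ (fun t => Gamma (1 - t) * (I / (2 * Real.pi)) *
        (contourMellin b (Qb b - x) t - contourMellin b x t)) 0 := by
    have g1 : DifferentiableAt ℂ (fun t => Gamma (1 - t)) 0 :=
      DifferentiableAt.comp (f := fun t : ℂ => 1 - t) 0 (differentiableAt_Gamma _ fun m h =>
        hne m (by linear_combination -h)) (by fun_prop)
    have g2 := differentiable_contourMellin hb hx
    have g3 := differentiable_contourMellin hb (sub_mem_strip hx)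
    fun_prop
  rw [e, (h1.fun_mul h2.hasDerivAt).deriv, contourMellin_zero hb, contourMellin_zero hb]
  have hpi : (Real.pi : ℂ) ≠ 0 := ofReal_ne_zero.2 Real.pi_ne_zero
  simp only [mul_zero, neg_zero, exp_zero, sub_self, zero_mul, add_zero, sub_zero, Gamma_one]
  field_simp
  linear_combination (-(W b (Qb b - x) - W b x)) * I_sq

theorem Gammab_eq {b : ℝ} (hb : 0 < b) {x : ℂ} (hx : x ∈ strip b) :
    Gammab b x = exp (deriv (zetaCont b x) 0) := by
  rw [Gammab, doubleGamma, if_neg, deriv_doubleZeta hb hx]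
  rintro ⟨n₁, n₂, h⟩
  have h1 := hx.1
  have h2 : x.re = -(n₁ * b + n₂ * b⁻¹) := by
    rw [h]; simp [-ofReal_inv]
  have hbi := inv_pos.2 hb
  have : 0 ≤ n₁ * b + n₂ * b⁻¹ := by positivity
  linarith

theorem Sb_eq {b : ℝ} (hb : 0 < b) {x : ℂ} (hx : x ∈ strip b) :
    Sb b x = exp ((W b (Qb b - x) - W b x) / 2) := by
  rw [Sb, Gammab_eq hb hx, Gammab_eq hb (sub_mem_strip hx), ← exp_sub, deriv_zetaCont_sub hb hx]

/-- The constant relating `G_b` and `exp (-W)`. -/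
def gConst (b : ℝ) : ℂ := exp (W b (Qb b / 2 : ℝ) - Real.pi * I * (Qb b) ^ 2 / 8)

/-- The reflection formula replaces W(Q - x) by -W(x) and a quadratic in x; the prefactor
e^{πix(x-Q)/2} cancels that quadratic up to a constant. -/
theorem Gb_eq {b : ℝ} (hb : 0 < b) {x : ℂ} (hx : x ∈ strip b) :
    Gb b x = gConst b * exp (-W b x) := by
  rw [Gb, Sb_eq hb hx, gConst, ← exp_add, ← exp_add]
  congr 1
  have h := W_add_W_sub hb hx
  push_cast at h ⊢
  linear_combination (1 / 2 : ℂ) * h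

end BBeta

end

/-! ### Symmetries of G_b, its pole at 0 and its growth. -/

noncomputable section

namespace BBeta

open Filter Topology Set ComplexConjugate

theorem sinhc_conj (z : ℂ) : sinhc (conj z) = conj (sinhc z) := by
  rcases eq_or_ne z 0 with rfl | hz
  · simp [sinhc_zero]
  · have h1 := mul_sinhc (conj z)
    rw [sinh_conj, ← mul_sinhc z, map_mul] at h1
    exact mul_left_cancel₀ ((map_ne_zero _).2 hz) h1

theorem kern_conj (b : ℝ) (u : ℂ) : kern b (conj u) = conj (kern b u) := by
  have h (c : ℝ) : (c : ℂ) * conj u / 2 = conj ((c : ℂ) * u / 2) := by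
    rw [map_div₀, map_mul, conj_ofReal, map_ofNat]
  rw [kern, h, h, sinhc_conj, sinhc_conj, kern, map_mul, map_inv₀, map_inv₀]

/-- The map u ↦ -ū preserves the line of integration, the kernel is even and real on ℝ, and u³
changes sign. This is used to see that S_b(b) is a positive real. -/
theorem W_sub_conj (b : ℝ) (x : ℂ) : W b (Qb b - conj x) = -conj (W b x) := by
  rw [W, W, ← integral_conj, ← integral_neg, ← integral_neg_eq_self]
  refine integral_congr_ae (ae_of_all _ fun v => ?_)
  have hp : pt b (-v) = -conj (pt b v) := by simp [pt, add_comm]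
  have e : ((Qb b : ℂ) - conj x - (Qb b / 2 : ℝ)) * -conj (pt b v) =
      conj ((x - (Qb b / 2 : ℝ)) * pt b v) := by
    simp only [map_mul, map_sub, conj_ofReal]
    push_cast; ring
  simp only
  rw [hp, kern_neg, kern_conj, e, exp_conj, map_div₀, map_mul, map_pow]
  rw [show (-conj (pt b v)) ^ 3 = -(conj (pt b v) ^ 3) by ring, div_neg]

theorem gConst_inv (b : ℝ) : gConst b⁻¹ = gConst b := by
  simp only [gConst, W_inv, Qb_inv]

theorem Gb_inv {b : ℝ} (hb : 0 < b) {x : ℂ} (hx : x ∈ strip b) : Gb b⁻¹ x = Gb b x := by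
  rw [Gb_eq hb hx, Gb_eq (inv_pos.2 hb) (by rwa [strip_inv]), gConst_inv, W_inv]

theorem gConst_ne_zero (b : ℝ) : gConst b ≠ 0 := exp_ne_zero _

theorem Gb_add {b : ℝ} (hb : 0 < b) {x : ℂ} (h0 : 0 < x.re) (h1 : x.re < b⁻¹) :
    Gb b (x + b) = (1 - exp (2 * Real.pi * I * b * x)) * Gb b x := by
  obtain ⟨hx, hxb⟩ := mem_strip_of_lt_inv hb h0 h1
  rw [Gb_eq hb hx, Gb_eq hb hxb, exp_neg_W_add hb h0 h1]
  ring

theorem continuousAt_Gb {b : ℝ} (hb : 0 < b) {x : ℂ} (hx : x ∈ strip b) :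
    ContinuousAt (Gb b) x := by
  have h : ContinuousAt (fun x => gConst b * exp (-W b x)) x :=
    continuousAt_const.mul (continuousAt_W hb hx).neg.cexp
  refine h.congr ?_
  filter_upwards [(isOpen_strip b).mem_nhds hx] with z hz using (Gb_eq hb hz).symm

theorem self_mem_strip {b : ℝ} (hb : 0 < b) : (b : ℂ) ∈ strip b := by
  have := inv_pos.2 hb
  simp only [strip, Qb, mem_ofPred_eq, ofReal_re]
  exact ⟨hb, by linarith⟩

theorem tendsto_ofReal_nhdsGT_zero : Tendsto (fun x : ℝ => (x : ℂ)) (𝓝[>] 0) (𝓝 0) := by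
  have := (continuous_ofReal.tendsto (0 : ℝ)).mono_left (nhdsWithin_le_nhds (s := Ioi 0))
  simpa using this

/-- Write G_b(x) = G_b(x + b)/(1 - e^{2πibx}) and use the derivative of the denominator at 0. Since
b(b - Q) = -1, the prefactor of G_b(b) is -i. -/
theorem tendsto_mul_Gb_aux {b : ℝ} (hb : 0 < b) :
    Tendsto (fun x : ℝ => (x : ℂ) * Gb b x) (𝓝[>] 0) (𝓝 (Sb b b / (2 * Real.pi * b))) := by
  have hpi : (Real.pi : ℂ) ≠ 0 := ofReal_ne_zero.2 Real.pi_ne_zero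
  have hbC : (b : ℂ) ≠ 0 := ofReal_ne_zero.2 hb.ne'
  have hder : HasDerivAt (fun z : ℂ => 1 - exp (2 * Real.pi * I * b * z))
      (-(2 * Real.pi * I * b)) 0 := by
    have := ((hasDerivAt_id (0 : ℂ)).const_mul (2 * Real.pi * I * b)).cexp.const_sub 1
    simpa using this
  have hx0 : Tendsto (fun x : ℝ => (x : ℂ)) (𝓝[>] 0) (𝓝[≠] 0) := by
    refine tendsto_nhdsWithin_iff.2 ⟨tendsto_ofReal_nhdsGT_zero, ?_⟩
    filter_upwards [self_mem_nhdsWithin] with x hx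
    exact ofReal_ne_zero.2 (ne_of_gt hx)
  have hslope := (hasDerivAt_iff_tendsto_slope.1 hder).comp hx0
  have hG : Tendsto (fun x : ℝ => Gb b (x + b)) (𝓝[>] 0) (𝓝 (Gb b b)) := by
    have h1 : Tendsto (fun x : ℝ => (x : ℂ) + b) (𝓝[>] 0) (𝓝 b) := by
      simpa using tendsto_ofReal_nhdsGT_zero.add_const (b : ℂ)
    exact (continuousAt_Gb hb (self_mem_strip hb)).tendsto.comp h1
  have hGb : Gb b b = -I * Sb b b := by
    rw [Gb]
    congr 1
    rw [show (Real.pi : ℂ) * I / 2 * b * (b - Qb b) = -(Real.pi / 2 * I) by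
      unfold Qb; push_cast; field_simp; ring, exp_neg, exp_pi_div_two_mul_I, inv_I]
  have hne : -(2 * Real.pi * I * b) ≠ 0 := by
    simp [hpi, hbC]
  have hlim := hG.div hslope hne
  have e : Gb b b / -(2 * Real.pi * I * b) = Sb b b / (2 * Real.pi * b) := by
    rw [hGb]
    have := I_ne_zero
    field_simp
  rw [e] at hlim
  refine hlim.congr' ?_
  filter_upwards [self_mem_nhdsWithin, (tendsto_nhdsWithin_of_tendsto_nhds tendsto_id).eventually
    (Iio_mem_nhds (inv_pos.2 hb))] with x hx hx1
  have hx' : 0 < x := hx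
  have hx1' : x < b⁻¹ := hx1
  have hxC : (x : ℂ) ≠ 0 := ofReal_ne_zero.2 hx'.ne'
  have hadd := Gb_add hb (x := x) (by simpa using hx') (by simpa using hx1')
  have hfac : (1 - exp (2 * Real.pi * I * b * x)) ≠ 0 := by
    have hxs := (mem_strip_of_lt_inv hb (x := x) (by simpa using hx') (by simpa using hx1')).2
    intro h0
    rw [h0, zero_mul, Gb_eq hb hxs] at hadd
    exact mul_ne_zero (gConst_ne_zero b) (exp_ne_zero _) hadd
  simp only [Pi.div_apply, Function.comp_apply, slope_def_field, mul_zero, exp_zero, sub_self,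
    sub_zero]
  rw [hadd]
  field_simp

/-- At x = b the exponent (W(Q - b) - W(b))/2 is real by conjugation symmetry. Since 1/b = Q - b,
replacing b by 1/b changes the sign of the exponent. -/
theorem Sb_self_eq_ofReal {b : ℝ} (hb : 0 < b) :
    ∃ ρ : ℝ, 0 < ρ ∧ Sb b b = ρ ∧ Sb b⁻¹ (b⁻¹ : ℝ) = (ρ⁻¹ : ℝ) := by
  have h1 := W_sub_conj b b
  rw [conj_ofReal] at h1
  have e : (W b (Qb b - b) - W b b) / 2 = ((-(W b b).re : ℝ) : ℂ) := by
    rw [h1, ofReal_neg, re_eq_add_conj]; ring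
  refine ⟨Real.exp (-(W b b).re), Real.exp_pos _, ?_, ?_⟩
  · rw [Sb_eq hb (self_mem_strip hb), e, ofReal_exp]
  · rw [Sb_eq (inv_pos.2 hb) (self_mem_strip (inv_pos.2 hb)), Qb_inv, W_inv, W_inv]
    have e1 : ((Qb b : ℂ) - (b⁻¹ : ℝ)) = b := by unfold Qb; push_cast; ring
    have e2 : (((b⁻¹ : ℝ) : ℂ)) = Qb b - b := by unfold Qb; push_cast; ring
    rw [e1, ← Real.exp_neg, ofReal_exp, ofReal_neg, ← e, e2]
    congr 1
    ring

/-- The leading behaviour of `G_b` at its pole `0`. -/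
theorem tendsto_mul_Gb {b : ℝ} (hb : 0 < b) :
    Tendsto (fun x : ℝ => (x : ℂ) * Gb b x) (𝓝[>] 0) (𝓝 (1 / (2 * Real.pi))) := by
  obtain ⟨ρ, hρ, h1, h2⟩ := Sb_self_eq_ofReal hb
  have hbi := inv_pos.2 hb
  have l1 := tendsto_mul_Gb_aux hb
  have l2 : Tendsto (fun x : ℝ => (x : ℂ) * Gb b x) (𝓝[>] 0)
      (𝓝 (Sb b⁻¹ (b⁻¹ : ℝ) / (2 * Real.pi * (b⁻¹ : ℝ)))) := by
    refine (tendsto_mul_Gb_aux hbi).congr' ?_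
    filter_upwards [self_mem_nhdsWithin,
      (tendsto_nhdsWithin_of_tendsto_nhds tendsto_id).eventually
      (Iio_mem_nhds (Qb_pos hb))] with x hx hx1
    rw [Gb_inv hb ⟨by simpa using hx, by simpa using hx1⟩]
  -- The same limit computed with the steps b and 1/b: equality of ρ/(2πb) and ρ⁻¹b/(2π) forces ρ =
  -- b, so S_b(b) is found without evaluating an integral.
  have h := tendsto_nhds_unique l1 l2
  rw [h1, h2] at h
  have hpi := Real.pi_pos
  have h' : ρ / (2 * Real.pi * b) = ρ⁻¹ / (2 * Real.pi * b⁻¹) := by exact_mod_cast h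
  have h3 : ρ = b := by
    field_simp at h'
    nlinarith
  rw [h1, h3] at l1
  convert l1 using 2
  have hbC : (b : ℂ) ≠ 0 := ofReal_ne_zero.2 hb.ne'
  have hpiC : (Real.pi : ℂ) ≠ 0 := ofReal_ne_zero.2 Real.pi_ne_zero
  field_simp

/-- The size of `exp (-W)` on closed substrips, uniformly in the imaginary direction. -/
theorem exists_re_W_bound {b δ : ℝ} (hb : 0 < b) (hδ : 0 < δ) :
    ∃ C : ℝ, 0 ≤ C ∧ ∀ x : ℂ, δ ≤ x.re → x.re ≤ Qb b - δ →
      |(-W b x).re - Real.pi * (2 * x.re - Qb b) * max (-x.im) 0| ≤ C := by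
  obtain ⟨C, hC0, hC⟩ := exists_norm_W_le hb hδ
  have hh := height_pos hb
  have hup (x : ℂ) (h1 : δ ≤ x.re) (h2 : x.re ≤ Qb b - δ) (h3 : 0 ≤ x.im) : |(W b x).re| ≤ C := by
    refine (abs_re_le_norm _).trans ((hC x h1 h2).trans ?_)
    have : Real.exp (-height b * x.im) ≤ 1 := Real.exp_le_one_iff.2 (by nlinarith)
    nlinarith
  refine ⟨2 * ‖W b (Qb b / 2 : ℝ)‖ + C, by positivity, fun x h1 h2 => ?_⟩
  rcases le_total 0 x.im with h3 | h3
  · rw [max_eq_right (by linarith), mul_zero, sub_zero, neg_re, abs_neg]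
    linarith [hup x h1 h2 h3, norm_nonneg (W b (Qb b / 2 : ℝ))]
  -- Reflection moves x to the upper half plane, where W is bounded; the quadratic term of the
  -- reflection formula supplies the linear growth in Im x.
  · rw [max_eq_left (by linarith)]
    have h4 := hup (Qb b - x) (by simp; linarith) (by simp; linarith) (by simpa using h3)
    have h5 := W_add_W_sub hb (x := x) ⟨by linarith, by linarith⟩
    have h6 : (-W b x).re - Real.pi * (2 * x.re - Qb b) * -x.im =
        (W b (Qb b - x)).re - 2 * (W b (Qb b / 2 : ℝ)).re := by
      have h7 := congrArg Complex.re h5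
      have h8 : (Real.pi * I * (x - (Qb b / 2 : ℝ)) ^ 2 : ℂ).re =
          -(Real.pi * (2 * x.re - Qb b) * x.im) := by
        simp only [pow_two, mul_re, mul_im, ofReal_re, ofReal_im, I_re, I_im, sub_re, sub_im]
        ring
      rw [sub_re, h8, add_re, mul_re, re_ofNat, im_ofNat, zero_mul, sub_zero] at h7
      rw [neg_re]
      linarith
    rw [h6]
    have h9 := abs_re_le_norm (W b (Qb b / 2 : ℝ))
    refine (abs_sub _ _).trans ?_
    rw [abs_mul, abs_two]
    linarith

end BBeta

end

/-! ### The beta integral: convergence, independence of the line, difference equation. -/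

noncomputable section

namespace BBeta

open Filter Topology Set

/-- The integrand of the beta integral in terms of `W`. -/
def betaKern (b : ℝ) (α β τ : ℂ) : ℂ :=
  exp (2 * Real.pi * I * τ * β - W b (τ + α) + W b (τ + Qb b))

theorem bbetaIntegrand_eq {b : ℝ} (hb : 0 < b) {α β τ : ℂ} (h1 : 0 < τ.re + α.re) (h2 : τ.re < 0)
    (h3 : α.re ≤ Qb b) : bbetaIntegrand b α β τ = betaKern b α β τ := by
  have m1 : τ + α ∈ strip b := ⟨by simpa using h1, by rw [add_re]; linarith⟩
  have m2 : τ + Qb b ∈ strip b :=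
    ⟨by rw [add_re, ofReal_re]; linarith, by rw [add_re, ofReal_re]; linarith⟩
  rw [bbetaIntegrand, Gb_eq hb m1, Gb_eq hb m2, mul_div_mul_left _ _ (gConst_ne_zero b), ← exp_sub,
    ← exp_add, betaKern]
  congr 1
  ring

theorem exists_betaKern_bound {b δ : ℝ} (hb : 0 < b) (hδ : 0 < δ) (M : ℝ) :
    ∃ C : ℝ, 0 ≤ C ∧ ∀ (α β : ℂ) (c t : ℝ), δ ≤ c + α.re → c ≤ -δ → α.re ≤ Qb b → |α.im| ≤ M →
      ‖betaKern b α β (c + t * I)‖ ≤ C * Real.exp (-(2 * Real.pi * (c * β.im + t * β.re)) -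
        2 * Real.pi * (Qb b - α.re) * max (-t) 0) := by
  obtain ⟨C, hC0, hC⟩ := exists_re_W_bound hb hδ
  have hQ := Qb_pos hb
  have hpi := Real.pi_pos
  refine ⟨Real.exp (2 * C + Real.pi * Qb b * M), (Real.exp_pos _).le,
    fun α β c t h1 h2 h3 h4 => ?_⟩
  rw [betaKern, norm_exp, ← Real.exp_add]
  refine Real.exp_le_exp.2 ?_
  have b1 := hC (c + t * I + α) (by simpa using h1) (by simp; linarith)
  have b2 := hC (c + t * I + Qb b) (by simp; linarith) (by simp; linarith)
  have e1 : (c + t * I + α : ℂ).re = c + α.re := by simp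
  have e2 : (c + t * I + α : ℂ).im = t + α.im := by simp
  have e3 : (c + t * I + Qb b : ℂ).re = c + Qb b := by simp
  have e4 : (c + t * I + Qb b : ℂ).im = t := by simp
  rw [e1, e2, neg_re] at b1
  rw [e3, e4, neg_re] at b2
  have e5 : (2 * Real.pi * I * (c + t * I) * β - W b (c + t * I + α) + W b (c + t * I + Qb b)).re =
      -(2 * Real.pi * (c * β.im + t * β.re)) + -(W b (c + t * I + α)).re +
        (W b (c + t * I + Qb b)).re := by
    have : (2 * Real.pi * I * (c + t * I) * β : ℂ).re = -(2 * Real.pi * (c * β.im + t * β.re)) := by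
      simp
      ring
    rw [add_re, sub_re, this]
    ring
  rw [e5]
  -- Replacing Im(τ + α) by Im τ in the growth estimate costs a factor bounded in terms of M.
  have e6 : |max (-(t + α.im)) 0 - max (-t) 0| ≤ M := by
    refine (abs_max_sub_max_le_abs _ _ _).trans ?_
    rw [show -(t + α.im) - -t = -α.im by ring, abs_neg]
    exact h4
  have e7 : |2 * (c + α.re) - Qb b| ≤ Qb b := abs_le.2 ⟨by linarith, by linarith⟩
  have e8 : Real.pi * (2 * (c + α.re) - Qb b) * (max (-(t + α.im)) 0 - max (-t) 0) ≤
      Real.pi * Qb b * M := by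
    refine (le_abs_self _).trans ?_
    rw [abs_mul, abs_mul, abs_of_pos hpi]
    gcongr
  have b1' := (abs_le.1 b1).2
  have b2' := (abs_le.1 b2).1
  generalize max (-(t + α.im)) 0 = m1 at *
  generalize max (-t) 0 = m2 at *
  linarith

/-- For t → +∞ the decay rate is 2π Re β, and for t → -∞ it is 2π(Q - Re(α + β)). The hypotheses on
α and β are exactly what makes both positive. -/
theorem exists_betaKern_bound_div {b δ : ℝ} (hb : 0 < b) (hδ : 0 < δ) (M : ℝ) :
    ∃ C : ℝ, 0 ≤ C ∧ ∀ (α β : ℂ) (c t : ℝ), δ ≤ c + α.re → c ≤ -δ → |α.im| ≤ M →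
      δ ≤ β.re → (α + β).re ≤ Qb b - δ →
      ‖betaKern b α β (c + t * I)‖ ≤ C * Real.exp (-(2 * Real.pi * c * β.im)) / (1 + t ^ 2) := by
  obtain ⟨C, hC0, hC⟩ := exists_betaKern_bound hb hδ M
  have hpi := Real.pi_pos
  obtain ⟨D, hD0, hD⟩ := exists_pow_mul_exp_le (A := 0) le_rfl
    (show 0 < 2 * Real.pi * δ by positivity) 0
  refine ⟨C * D, by positivity, fun α β c t h1 h2 h3 h4 h5 => ?_⟩
  rw [add_re] at h5
  refine (hC α β c t h1 h2 (by linarith) h3).trans ?_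
  have hdecay : -(2 * Real.pi * (c * β.im + t * β.re)) - 2 * Real.pi * (Qb b - α.re) * max (-t) 0 ≤
      -(2 * Real.pi * c * β.im) + -(2 * Real.pi * δ) * |t| := by
    rcases le_total 0 t with h | h
    · rw [max_eq_right (by linarith), abs_of_nonneg h]
      have := mul_le_mul_of_nonneg_left (mul_le_mul_of_nonneg_left h4 h)
        (show 0 ≤ 2 * Real.pi by positivity)
      linarith
    · rw [max_eq_left (by linarith), abs_of_nonpos h]
      have := mul_le_mul_of_nonneg_left (mul_le_mul_of_nonneg_left
        (show δ ≤ Qb b - α.re - β.re by linarith) (show 0 ≤ -t by linarith))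
        (show 0 ≤ 2 * Real.pi by positivity)
      linarith
  have hD' := hD t
  rw [pow_zero, one_mul] at hD'
  calc _ ≤ C * Real.exp (-(2 * Real.pi * c * β.im) + -(2 * Real.pi * δ) * |t|) := by gcongr
    _ = C * Real.exp (-(2 * Real.pi * c * β.im)) * Real.exp (-(2 * Real.pi * δ) * |t|) := by
        rw [Real.exp_add]; ring
    _ ≤ C * Real.exp (-(2 * Real.pi * c * β.im)) * (D / (1 + t ^ 2)) := by gcongr
    _ = _ := by ring

theorem differentiableAt_betaKern {b : ℝ} (hb : 0 < b) {α τ : ℂ} (β : ℂ) (h1 : 0 < τ.re + α.re)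
    (h2 : τ.re < 0) (h3 : α.re ≤ Qb b) : DifferentiableAt ℂ (betaKern b α β) τ := by
  have m1 : τ + α ∈ strip b := ⟨by simpa using h1, by rw [add_re]; linarith⟩
  have m2 : τ + Qb b ∈ strip b :=
    ⟨by rw [add_re, ofReal_re]; linarith, by rw [add_re, ofReal_re]; linarith⟩
  have d1 : DifferentiableAt ℂ (fun τ => W b (τ + α)) τ :=
    (hasDerivAt_W hb m1).comp_add_const τ α |>.differentiableAt
  have d2 : DifferentiableAt ℂ (fun τ => W b (τ + Qb b)) τ :=
    (hasDerivAt_W hb m2).comp_add_const τ (Qb b : ℂ) |>.differentiableAt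
  unfold betaKern
  fun_prop

theorem continuous_betaKern_line {b : ℝ} (hb : 0 < b) {α : ℂ} (β : ℂ) {c : ℝ} (h1 : 0 < c + α.re)
    (h2 : c < 0) (h3 : α.re ≤ Qb b) : Continuous fun t : ℝ => betaKern b α β (c + t * I) := by
  refine continuous_iff_continuousAt.2 fun t => ?_
  exact ContinuousAt.comp (f := fun t : ℝ => (c + t * I : ℂ)) (g := betaKern b α β)
    (differentiableAt_betaKern hb β (by simpa using h1) (by simpa using h2) h3).continuousAt
    (by fun_prop)

/-- The beta integral in terms of `W`. -/
def betaInt (b : ℝ) (α β : ℂ) (c : ℝ) : ℂ := ∫ t : ℝ, betaKern b α β (c + t * I)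

theorem integrable_betaKern {b : ℝ} (hb : 0 < b) {α β : ℂ} {c : ℝ} (hβ : 0 < β.re)
    (hαβ : (α + β).re < Qb b) (hc : 0 < c + α.re) (hc0 : c < 0) :
    Integrable fun t : ℝ => betaKern b α β (c + t * I) := by
  obtain ⟨δ, hδ, d1, d2, d3, d4⟩ : ∃ δ > 0, δ ≤ c + α.re ∧ c ≤ -δ ∧ δ ≤ β.re ∧
      (α + β).re ≤ Qb b - δ := by
    refine ⟨min (min (c + α.re) (-c)) (min β.re (Qb b - (α + β).re)), ?_, ?_, ?_, ?_, ?_⟩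
    · exact lt_min (lt_min hc (by linarith)) (lt_min hβ (by linarith))
    · exact (min_le_left _ _).trans (min_le_left _ _)
    · linarith [(min_le_left (min (c + α.re) (-c)) (min β.re (Qb b - (α + β).re))).trans
        (min_le_right _ _)]
    · exact (min_le_right _ _).trans (min_le_left _ _)
    · linarith [(min_le_right (min (c + α.re) (-c)) (min β.re (Qb b - (α + β).re))).trans
        (min_le_right _ _)]
  obtain ⟨C, hC0, hC⟩ := exists_betaKern_bound_div hb hδ |α.im|
  rw [add_re] at hαβ
  exact (integrable_div_one_add_sq _).mono'
    (continuous_betaKern_line hb β hc hc0 (by linarith)).aestronglyMeasurable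
    (ae_of_all _ fun t => hC α β c t d1 d2 le_rfl d3 d4)

/-- The beta integral does not depend on the line. -/
theorem betaInt_eq {b : ℝ} (hb : 0 < b) {α β : ℂ} {c c' : ℝ} (hβ : 0 < β.re)
    (hαβ : (α + β).re < Qb b) (hc : 0 < c' + α.re) (hcc : c' ≤ c) (hc0 : c < 0) :
    betaInt b α β c = betaInt b α β c' := by
  obtain ⟨δ, hδ, d1, d2, d3, d4⟩ : ∃ δ > 0, δ ≤ c' + α.re ∧ c ≤ -δ ∧ δ ≤ β.re ∧
      (α + β).re ≤ Qb b - δ := by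
    refine ⟨min (min (c' + α.re) (-c)) (min β.re (Qb b - (α + β).re)), ?_, ?_, ?_, ?_, ?_⟩
    · exact lt_min (lt_min hc (by linarith)) (lt_min hβ (by linarith))
    · exact (min_le_left _ _).trans (min_le_left _ _)
    · linarith [(min_le_left (min (c' + α.re) (-c)) (min β.re (Qb b - (α + β).re))).trans
        (min_le_right _ _)]
    · exact (min_le_right _ _).trans (min_le_left _ _)
    · linarith [(min_le_right (min (c' + α.re) (-c)) (min β.re (Qb b - (α + β).re))).trans
        (min_le_right _ _)]
  obtain ⟨C, hC0, hC⟩ := exists_betaKern_bound_div hb hδ |α.im|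
  rw [add_re] at hαβ
  have hpi := Real.pi_pos
  have hd (u : ℂ) (hu : u.im ∈ Icc (-c) (-c')) :
      DifferentiableAt ℂ (fun u => betaKern b α β (I * u)) u := by
    have hre : (I * u).re = -u.im := by simp
    have := hu.1
    have := hu.2
    exact DifferentiableAt.comp (g := betaKern b α β) (f := fun u => I * u) u
      (differentiableAt_betaKern hb β (by rw [hre]; linarith) (by rw [hre]; linarith)
        (by linarith)) (by fun_prop)
  have hline (y : ℝ) (v : ℝ) : I * (v + (-y : ℝ) * I) = y + v * I := by
    push_cast; linear_combination (-(y : ℂ)) * I_sq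
  have h := integral_horizontal_line_eq (g := fun u => betaKern b α β (I * u)) (y₁ := -c)
    (y₂ := -c') (C := C * Real.exp (2 * Real.pi * (-c') * |β.im|))
    (fun u hu => (hd u (by simpa [mem_reProdIm] using hu)).continuousAt.continuousWithinAt)
    (fun u hu => hd u (Ioo_subset_Icc_self hu)) (fun u hu => ?_) (by linarith)
  · simp only [hline] at h
    exact h
  · have e : I * u = ((-u.im : ℝ) : ℂ) + u.re * I := by
      conv_lhs => rw [← re_add_im u]
      push_cast; linear_combination (u.im : ℂ) * I_sq
    rw [e]
    refine (hC α β (-u.im) u.re (by linarith [hu.2]) (by linarith [hu.1]) le_rfl d3 d4).trans ?_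
    have h1 : -(2 * Real.pi * -u.im * β.im) ≤ 2 * Real.pi * (-c') * |β.im| := by
      have h2 : u.im * β.im ≤ -c' * |β.im| := by
        have h3 : 0 ≤ u.im := by linarith [hu.1]
        have h4 : u.im * β.im ≤ u.im * |β.im| := by gcongr; exact le_abs_self _
        have h5 : u.im * |β.im| ≤ -c' * |β.im| := by gcongr; exact hu.2
        linarith
      have := mul_le_mul_of_nonneg_left h2 (show 0 ≤ 2 * Real.pi by positivity)
      linarith
    gcongr

/-- The difference equation of the beta integral. -/
theorem betaInt_add {b : ℝ} (hb : 0 < b) {α β : ℂ} {c : ℝ} (hα : α.re < b⁻¹) (hβ : 0 < β.re)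
    (hαβ : (α + β).re < b⁻¹) (hc : 0 < c + α.re) (hc0 : c < 0) :
    betaInt b α (β + b) c * (1 - exp (2 * Real.pi * I * b * (α + β))) =
      betaInt b α β c * (1 - exp (2 * Real.pi * I * b * β)) := by
  have hbi := inv_pos.2 hb
  have hQ : Qb b = b + b⁻¹ := rfl
  -- J(α + b, β) is computed on the lines c and c - b; equating the two expressions gives the
  -- difference equation. Convergence for α + b requires Re(α + β) < 1/b.
  have hshift := betaInt_eq hb (α := α + b) (β := β) (c := c) (c' := c - b) hβ
    (by simp only [add_re, ofReal_re] at hαβ ⊢; rw [hQ]; linarith)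
    (by simp only [add_re, ofReal_re]; linarith) (by linarith) hc0
  have i1 := integrable_betaKern hb hβ (α := α) (c := c) (by rw [hQ]; linarith) hc hc0
  have i2 := integrable_betaKern hb (α := α) (β := β + b) (c := c)
    (by simp only [add_re, ofReal_re]; linarith)
    (by simp only [add_re, ofReal_re] at hαβ ⊢; rw [hQ]; linarith) hc hc0
  have hexpβ (τ : ℂ) : exp (2 * Real.pi * I * τ * (β + b)) =
      exp (2 * Real.pi * I * τ * β) * exp (2 * Real.pi * I * b * τ) := by
    rw [← exp_add]; congr 1; ring
  -- On the line c the functional equation acts on the numerator G_b(τ + α + b), and the factor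
  -- e^{2πibτ} shifts β to β + b.
  have e1 : betaInt b (α + b) β c =
      betaInt b α β c - exp (2 * Real.pi * I * b * α) * betaInt b α (β + b) c := by
    unfold betaInt
    rw [← integral_const_mul, ← integral_sub i1 (i2.const_mul _)]
    refine integral_congr_ae (ae_of_all _ fun t => ?_)
    have hW := exp_neg_W_add hb (x := c + t * I + α) (by simpa using hc) (by simp; linarith)
    simp only [betaKern]
    generalize (c + t * I : ℂ) = τ at *
    rw [← add_assoc]
    simp only [exp_add, sub_eq_add_neg] at hW ⊢
    rw [hW, hexpβ, mul_add, exp_add]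
    ring
  -- After τ ↦ τ - b the numerator is the original one, and the functional equation at τ + 1/b acts
  -- on the denominator; the extra e^{2πi} is 1.
  have e2 : betaInt b (α + b) β (c - b) =
      exp (-(2 * Real.pi * I * b * β)) * (betaInt b α β c - betaInt b α (β + b) c) := by
    unfold betaInt
    rw [← integral_sub i1 i2, ← integral_const_mul]
    refine integral_congr_ae (ae_of_all _ fun t => ?_)
    have hW := exp_neg_W_add hb (x := c + t * I + (b⁻¹ : ℝ)) (by simp [-ofReal_inv]; linarith)
      (by simp [-ofReal_inv]; linarith)
    have hτ : (((c - b : ℝ) : ℂ) + t * I) = c + t * I - b := by push_cast; ring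
    simp only [betaKern]
    rw [hτ]
    generalize (c + t * I : ℂ) = τ at *
    have a1 : τ - b + (α + b) = τ + α := by ring
    have a2 : τ - b + Qb b = τ + (b⁻¹ : ℝ) := by rw [hQ]; push_cast; ring
    have a3 : τ + (b⁻¹ : ℝ) + b = τ + Qb b := by rw [hQ]; push_cast; ring
    have a4 : exp (2 * Real.pi * I * b * (τ + (b⁻¹ : ℝ))) = exp (2 * Real.pi * I * b * τ) := by
      have hbC : (b : ℂ) ≠ 0 := ofReal_ne_zero.2 hb.ne'
      rw [show 2 * Real.pi * I * b * (τ + (b⁻¹ : ℝ)) =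
        2 * Real.pi * I * b * τ + 2 * Real.pi * I by push_cast; field_simp, exp_add,
        exp_two_pi_mul_I, mul_one]
    have a5 : 2 * Real.pi * I * (τ - b) * β = 2 * Real.pi * I * τ * β +
      -(2 * Real.pi * I * b * β) := by ring
    rw [a3, a4] at hW
    rw [a1, a2, a5]
    have a6 : exp (W b (τ + (b⁻¹ : ℝ))) =
        (1 - exp (2 * Real.pi * I * b * τ)) * exp (W b (τ + Qb b)) := by
      rw [exp_neg, exp_neg] at hW
      have n1 := exp_ne_zero (W b (τ + Qb b))
      have n2 := exp_ne_zero (W b (τ + (b⁻¹ : ℝ)))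
      generalize exp (W b (τ + (b⁻¹ : ℝ))) = w1 at *
      generalize exp (W b (τ + Qb b)) = w2 at *
      generalize exp (2 * Real.pi * I * b * τ) = w3 at *
      field_simp at hW
      linear_combination hW
    simp only [exp_add, sub_eq_add_neg] at a6 ⊢
    rw [a6, hexpβ]
    ring
  rw [e1, e2] at hshift
  have hE : exp (-(2 * Real.pi * I * b * β)) * exp (2 * Real.pi * I * b * β) = 1 := by
    rw [← exp_add, neg_add_cancel, exp_zero]
  rw [mul_add (2 * Real.pi * I * b), exp_add]
  linear_combination exp (2 * Real.pi * I * b * β) * hshift +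
    (betaInt b α β c - betaInt b α (β + b) c) * hE

end BBeta

end

/-! ### Constancy of the quotient in β, and its value from β → 0. -/

noncomputable section

namespace BBeta

open Filter Topology Set

theorem differentiable_betaKern_right (b : ℝ) (α τ : ℂ) :
    Differentiable ℂ fun β => betaKern b α β τ :=
  (((differentiable_id.const_mul (2 * Real.pi * I * τ)).sub_const (W b (τ + α))).add_const
    (W b (τ + Qb b))).cexp

theorem differentiableOn_betaInt_right {b : ℝ} (hb : 0 < b) {α : ℂ} {c : ℝ} (hc : 0 < c + α.re)
    (hc0 : c < 0) :
    DifferentiableOn ℂ (fun β => betaInt b α β c) {β | 0 < β.re ∧ β.re < Qb b - α.re} := by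
  have hU : IsOpen {β : ℂ | 0 < β.re ∧ β.re < Qb b - α.re} :=
    (isOpen_lt continuous_const continuous_re).inter (isOpen_lt continuous_re continuous_const)
  refine differentiableOn_integral_of_locally_dominated (μ := volume) hU ?_ ?_ ?_
  · intro z hz
    exact (continuous_betaKern_line hb z hc hc0 (by linarith [hz.1, hz.2])).aestronglyMeasurable
  · exact fun t => (differentiable_betaKern_right b α (c + t * I)).differentiableOn
  · intro z hz
    obtain ⟨δ, hδ, d1, d2, d3, d4⟩ : ∃ δ > 0, δ ≤ c + α.re ∧ c ≤ -δ ∧ 2 * δ ≤ z.re ∧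
        z.re ≤ Qb b - α.re - 2 * δ := by
      refine ⟨min (min (c + α.re) (-c)) (min (z.re / 2) ((Qb b - α.re - z.re) / 2)),
        lt_min (lt_min hc (by linarith)) (lt_min (by linarith [hz.1]) (by linarith [hz.2])),
        (min_le_left _ _).trans (min_le_left _ _), ?_, ?_, ?_⟩
      · linarith [(min_le_left (min (c + α.re) (-c))
          (min (z.re / 2) ((Qb b - α.re - z.re) / 2))).trans (min_le_right _ _)]
      · linarith [(min_le_right (min (c + α.re) (-c))
          (min (z.re / 2) ((Qb b - α.re - z.re) / 2))).trans (min_le_left _ _)]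
      · linarith [(min_le_right (min (c + α.re) (-c))
          (min (z.re / 2) ((Qb b - α.re - z.re) / 2))).trans (min_le_right _ _)]
    obtain ⟨C, hC0, hC⟩ := exists_betaKern_bound_div hb hδ |α.im|
    refine ⟨δ, hδ, fun t => C * Real.exp (2 * Real.pi * |c| * (|z.im| + δ)) / (1 + t ^ 2),
      integrable_div_one_add_sq _, ae_of_all _ fun t w hw => ?_⟩
    have hwz : ‖w - z‖ < δ := by simpa [dist_eq] using hw.1
    have h1 := abs_le.1 ((abs_re_le_norm (w - z)).trans hwz.le)
    have h2 := (abs_im_le_norm (w - z)).trans hwz.le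
    rw [sub_re] at h1
    rw [sub_im] at h2
    refine (hC α w c t d1 d2 le_rfl (by linarith [h1.1])
      (by rw [add_re]; linarith [h1.2])).trans ?_
    have h3 : |w.im| ≤ |z.im| + δ := by
      have := abs_add_le z.im (w.im - z.im)
      rw [add_sub_cancel] at this
      linarith
    have hpi := Real.pi_pos
    have h4 : -(2 * Real.pi * c * w.im) ≤ 2 * Real.pi * |c| * (|z.im| + δ) := by
      calc _ ≤ |-(2 * Real.pi * c * w.im)| := le_abs_self _
        _ = 2 * Real.pi * |c| * |w.im| := by
            rw [abs_neg, abs_mul, abs_mul, abs_of_pos (by positivity : 0 < 2 * Real.pi)]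
        _ ≤ _ := by gcongr
    beta_reduce
    gcongr

/-- The quotient of the beta integral by its expected value, up to a function of `α`. -/
def betaQuot (b : ℝ) (α β : ℂ) : ℂ :=
  betaInt b α β (-(α.re / 2)) * exp (W b β - W b (α + β))

theorem differentiableOn_betaQuot {b : ℝ} (hb : 0 < b) {α : ℂ} (hα : 0 < α.re) :
    DifferentiableOn ℂ (betaQuot b α) {β | 0 < β.re ∧ β.re < Qb b - α.re} := by
  intro β hβ
  have d1 := differentiableOn_betaInt_right hb (α := α) (c := -(α.re / 2)) (by linarith)
    (by linarith) β hβ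
  have d2 : DifferentiableAt ℂ (W b) β :=
    (hasDerivAt_W hb ⟨hβ.1, by linarith [hβ.2]⟩).differentiableAt
  have d3 : DifferentiableAt ℂ (fun β => W b (α + β)) β :=
    (hasDerivAt_W hb (x := α + β) ⟨by rw [add_re]; linarith [hβ.1],
      by rw [add_re]; linarith [hβ.2]⟩).comp_const_add α β |>.differentiableAt
  exact d1.mul (d2.sub d3).cexp.differentiableWithinAt

/-- The difference equation of J and the functional equation at β and α + β produce the same
factors. The factor 1 - e^{2πibβ} may be cancelled because exp(-W) never vanishes. -/
theorem betaQuot_add {b : ℝ} (hb : 0 < b) {α β : ℂ} (hα : 0 < α.re) (hβ : 0 < β.re)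
    (hαβ : (α + β).re < b⁻¹) : betaQuot b α (β + b) = betaQuot b α β := by
  rw [add_re] at hαβ
  have hJ := betaInt_add hb (α := α) (β := β) (c := -(α.re / 2)) (by linarith) hβ
    (by rw [add_re]; exact hαβ) (by linarith) (by linarith)
  have h1 := exp_neg_W_add hb hβ (by linarith)
  have h2 := exp_neg_W_add hb (x := α + β) (by rw [add_re]; linarith) (by rw [add_re]; linarith)
  have hne : 1 - exp (2 * Real.pi * I * b * β) ≠ 0 := by
    intro h
    rw [h, zero_mul] at h1
    exact exp_ne_zero _ h1
  refine mul_right_cancel₀ hne ?_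
  rw [betaQuot, betaQuot, exp_sub, exp_sub, ← add_assoc]
  rw [exp_neg, exp_neg] at h1 h2
  have n1 := exp_ne_zero (W b β)
  have n2 := exp_ne_zero (W b (α + β))
  have n3 := exp_ne_zero (W b (β + b))
  have n4 := exp_ne_zero (W b (α + β + b))
  generalize exp (W b β) = w1 at *
  generalize exp (W b (α + β)) = w2 at *
  generalize exp (W b (β + b)) = w3 at *
  generalize exp (W b (α + β + b)) = w4 at *
  generalize exp (2 * Real.pi * I * b * β) = E at *
  generalize exp (2 * Real.pi * I * b * (α + β)) = E' at *
  have h1' : w3 * (1 - E) = w1 := by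
    field_simp at h1
    linear_combination -h1
  rw [div_eq_mul_inv w3, h2, div_eq_mul_inv w1]
  linear_combination w1 * w2⁻¹ * hJ +
    betaInt b α (β + b) (-(α.re / 2)) * (1 - E') * w2⁻¹ * h1'

/-- On the line Re τ = -Re α/2 the integral contributes e^{π Re α Im β}, and the other factor e^{2π
Re α max(-Im β, 0)}; the product is symmetric in the sign of Im β. -/
theorem exists_betaQuot_le {b x₀ x₁ : ℝ} (hb : 0 < b) {α : ℂ} (hα : 0 < α.re) (h0 : 0 < x₀)
    (h1 : x₁ + α.re < Qb b) :
    ∃ C : ℝ, ∀ β : ℂ, β.re ∈ Icc x₀ x₁ →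
      ‖betaQuot b α β‖ ≤ C * Real.exp (Real.pi * α.re * |β.im|) := by
  obtain ⟨δ, hδ, d1, d2, d3⟩ : ∃ δ > 0, δ ≤ α.re / 2 ∧ δ ≤ x₀ ∧ δ ≤ Qb b - (x₁ + α.re) :=
    ⟨min (α.re / 2) (min x₀ (Qb b - (x₁ + α.re))),
      lt_min (by linarith) (lt_min h0 (by linarith)), min_le_left _ _,
      (min_le_right _ _).trans (min_le_left _ _), (min_le_right _ _).trans (min_le_right _ _)⟩
  obtain ⟨C, hC0, hC⟩ := exists_betaKern_bound_div hb hδ |α.im|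
  obtain ⟨D, hD0, hD⟩ := exists_re_W_bound hb hδ
  have hpi := Real.pi_pos
  refine ⟨C * Real.pi * Real.exp (2 * D + Real.pi * Qb b * |α.im|), fun β hβ => ?_⟩
  have hβ1 := hβ.1
  have hβ2 := hβ.2
  have k1 : ‖betaInt b α β (-(α.re / 2))‖ ≤ C * Real.pi * Real.exp (Real.pi * α.re * β.im) := by
    refine (norm_integral_le_of_norm_le (integrable_div_one_add_sq
      (C * Real.exp (Real.pi * α.re * β.im))) (ae_of_all _ fun t => ?_)).trans_eq ?_
    · have := hC α β (-(α.re / 2)) t (by linarith) (by linarith) le_rfl (by linarith)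
        (by rw [add_re]; linarith)
      rwa [show -(2 * Real.pi * -(α.re / 2) * β.im) = Real.pi * α.re * β.im by ring] at this
    · simp_rw [div_eq_mul_inv]
      rw [integral_const_mul, integral_univ_inv_one_add_sq]
      ring
  have k2 : ‖exp (W b β - W b (α + β))‖ ≤ Real.exp (2 * D + Real.pi * Qb b * |α.im| +
      2 * Real.pi * α.re * max (-β.im) 0) := by
    rw [norm_exp]
    refine Real.exp_le_exp.2 ?_
    have b1 := hD β (by linarith) (by linarith)
    have b2 := hD (α + β) (by rw [add_re]; linarith) (by rw [add_re]; linarith)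
    rw [neg_re] at b1 b2
    rw [add_re, add_im] at b2
    rw [sub_re]
    have e6 : |max (-(α.im + β.im)) 0 - max (-β.im) 0| ≤ |α.im| := by
      refine (abs_max_sub_max_le_abs _ _ _).trans ?_
      rw [show -(α.im + β.im) - -β.im = -α.im by ring, abs_neg]
    have e7 : |2 * (α.re + β.re) - Qb b| ≤ Qb b := abs_le.2 ⟨by linarith, by linarith⟩
    have hQ := Qb_pos hb
    have e8 : Real.pi * (2 * (α.re + β.re) - Qb b) * (max (-(α.im + β.im)) 0 - max (-β.im) 0) ≤
        Real.pi * Qb b * |α.im| := by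
      refine (le_abs_self _).trans ?_
      rw [abs_mul, abs_mul, abs_of_pos hpi]
      gcongr
    have b1' := (abs_le.1 b1).1
    have b2' := (abs_le.1 b2).2
    generalize max (-(α.im + β.im)) 0 = m1 at *
    generalize max (-β.im) 0 = m2 at *
    linarith
  rw [betaQuot, norm_mul]
  refine (mul_le_mul k1 k2 (norm_nonneg _) (by positivity)).trans_eq ?_
  have e : Real.pi * α.re * |β.im| =
      Real.pi * α.re * β.im + 2 * Real.pi * α.re * max (-β.im) 0 := by
    rcases le_total 0 β.im with h | h
    · rw [abs_of_nonneg h, max_eq_right (by linarith)]; ring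
    · rw [abs_of_nonpos h, max_eq_left (by linarith)]; ring
  rw [e, Real.exp_add, Real.exp_add (Real.pi * α.re * β.im)]
  ring

theorem exists_betaQuot_eq {b : ℝ} (hb : 0 < b) {α : ℂ} (hα : 0 < α.re) (hα1 : α.re < b⁻¹) :
    ∃ a : ℂ, ∀ β : ℂ, 0 < β.re → β.re < Qb b - α.re → betaQuot b α β = a := by
  have hQ : Qb b = b + b⁻¹ := rfl
  have hpi := Real.pi_pos
  have hU : IsOpen {β : ℂ | 0 < β.re ∧ β.re < Qb b - α.re} :=
    (isOpen_lt continuous_const continuous_re).inter (isOpen_lt continuous_re continuous_const)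
  have hD := differentiableOn_betaQuot hb hα
  -- This centres a strip of width b inside 0 < Re β < Q - Re α, which is possible because Re α <
  -- 1/b.
  set x₀ := (b⁻¹ - α.re) / 2 with hx₀
  have p0 : 0 < x₀ := by rw [hx₀]; linarith
  have p1 : x₀ + α.re < b⁻¹ := by rw [hx₀]; linarith
  obtain ⟨C, hC⟩ := exists_betaQuot_le hb hα p0 (x₁ := x₀ + b) (by rw [hQ]; linarith)
  obtain ⟨a, ha⟩ := eq_of_periodic_strip (R := betaQuot b α) (x₀ := x₀) hb
    (show Real.pi * α.re < 2 * Real.pi / b by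
      rw [div_eq_mul_inv]
      have := mul_lt_mul_of_pos_left hα1 hpi
      have := mul_pos hpi (inv_pos.2 hb)
      linarith)
    (fun z hz => (hD z ⟨by linarith [hz.1], by rw [hQ]; linarith [hz.2]⟩).differentiableAt
      (hU.mem_nhds ⟨by linarith [hz.1], by rw [hQ]; linarith [hz.2]⟩))
    (fun z hz => betaQuot_add hb hα (by linarith) (by rw [add_re]; linarith))
    hC
  refine ⟨a, fun β h1 h2 => ?_⟩
  have hpre : IsPreconnected {β : ℂ | 0 < β.re ∧ β.re < Qb b - α.re} :=
    ((convex_halfSpace_re_gt 0).inter (convex_halfSpace_re_lt _)).isPreconnected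
  refine (hD.analyticOnNhd hU).eqOn_of_preconnected_of_eventuallyEq
    (g := fun _ => a) analyticOnNhd_const hpre
    (z₀ := ((x₀ + b / 2 : ℝ) : ℂ)) ⟨?_, ?_⟩ ?_ ⟨h1, h2⟩
  · rw [ofReal_re]; linarith
  · rw [ofReal_re, hQ]; linarith
  · have : {β : ℂ | x₀ < β.re ∧ β.re < x₀ + b} ∈ 𝓝 ((x₀ + b / 2 : ℝ) : ℂ) :=
      ((isOpen_lt continuous_const continuous_re).inter
        (isOpen_lt continuous_re continuous_const)).mem_nhds
        ⟨by rw [mem_ofPred_eq, ofReal_re]; linarith, by rw [mem_ofPred_eq, ofReal_re]; linarith⟩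
    filter_upwards [this] with z hz
    exact ha z ⟨hz.1.le, hz.2⟩

/-- As β = x → 0+ the mass of the integral escapes to t → +∞, where both W terms vanish. Rescaling t
= s/x gives the limit ∫₀^∞ e^{-2πs} ds; the half line s < 0 is exponentially suppressed. -/
theorem tendsto_mul_betaInt {b : ℝ} (hb : 0 < b) {α : ℂ} {c : ℝ} (hc : 0 < c + α.re)
    (hc0 : c < 0) (hα : α.re < Qb b) :
    Tendsto (fun x : ℝ => (x : ℂ) * betaInt b α x c) (𝓝[>] 0) (𝓝 (1 / (2 * Real.pi))) := by
  have hpi := Real.pi_pos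
  obtain ⟨δ, hδ, d1, d2⟩ : ∃ δ > 0, δ ≤ c + α.re ∧ c ≤ -δ :=
    ⟨min (c + α.re) (-c), lt_min hc (by linarith), min_le_left _ _,
      by linarith [min_le_right (c + α.re) (-c)]⟩
  obtain ⟨C, hC0, hC⟩ := exists_betaKern_bound hb hδ |α.im|
  obtain ⟨D, hD0, hD⟩ := exists_norm_W_le hb hδ
  obtain ⟨A, hA0, hA⟩ := exists_pow_mul_exp_le (A := 0) le_rfl
    (show 0 < 2 * Real.pi by positivity) 0
  have hbound (x s : ℝ) (hx : 0 < x) : ‖betaKern b α x (c + (s / x : ℝ) * I)‖ ≤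
      C * Real.exp (-(2 * Real.pi * s) - 2 * Real.pi * ((Qb b - α.re) / x) * max (-s) 0) := by
    refine (hC α x c (s / x) d1 d2 hα.le le_rfl).trans_eq ?_
    have hmax : max (-(s / x)) 0 = max (-s) 0 / x := by
      rw [← max_div_div_right hx.le, zero_div, neg_div]
    rw [ofReal_im, ofReal_re, mul_zero, zero_add, div_mul_cancel₀ _ hx.ne', hmax]
    congr 2
    ring
  have hlim : Tendsto (fun x : ℝ => ∫ s : ℝ, betaKern b α x (c + (s / x : ℝ) * I)) (𝓝[>] 0)
      (𝓝 (∫ s : ℝ, (Ioi 0).indicator (fun s : ℝ => exp (-(2 * Real.pi) * s)) s)) := by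
    refine tendsto_integral_filter_of_dominated_convergence (fun s => C * A / (1 + s ^ 2))
      ?_ ?_ (integrable_div_one_add_sq _) ?_
    · filter_upwards with x
      exact ((continuous_betaKern_line hb x hc hc0 hα.le).comp
        (continuous_id.div_const x)).aestronglyMeasurable
    · have hx : Ioo (0 : ℝ) ((Qb b - α.re) / 2) ∈ 𝓝[>] (0 : ℝ) :=
        Ioo_mem_nhdsGT (by linarith)
      filter_upwards [hx] with x hx
      refine ae_of_all _ fun s => (hbound x s hx.1).trans ?_
      have h1 : -(2 * Real.pi * s) - 2 * Real.pi * ((Qb b - α.re) / x) * max (-s) 0 ≤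
          -(2 * Real.pi) * |s| := by
        -- With this factor at least 2, the exponent for s < 0 is at most 2π|s| - 4π|s| = -2π|s|, a
        -- bound uniform in x.
        have h2 : 2 ≤ (Qb b - α.re) / x := by
          rw [le_div_iff₀ hx.1]
          linarith [hx.2]
        rcases le_total 0 s with h | h
        · rw [max_eq_right (by linarith), abs_of_nonneg h]
          linarith
        · rw [max_eq_left (by linarith), abs_of_nonpos h]
          have := mul_le_mul_of_nonneg_left (mul_le_mul_of_nonneg_right h2
            (show 0 ≤ -s by linarith)) (show 0 ≤ 2 * Real.pi by positivity)
          linarith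
      have h3 := hA s
      rw [pow_zero, one_mul] at h3
      calc _ ≤ C * Real.exp (-(2 * Real.pi) * |s|) := by gcongr
        _ ≤ C * (A / (1 + s ^ 2)) := by gcongr
        _ = _ := by ring
    · filter_upwards [Measure.ae_ne volume (0 : ℝ)] with s hs
      have hinv := tendsto_inv_nhdsGT_zero (𝕜 := ℝ)
      rcases lt_or_gt_of_ne hs with h | h
      · rw [indicator_of_notMem (by simpa using h.le)]
        have hz : Tendsto (fun x : ℝ => C * Real.exp (-(2 * Real.pi * s) -
            2 * Real.pi * ((Qb b - α.re) / x) * max (-s) 0)) (𝓝[>] 0) (𝓝 0) := by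
          suffices h : Tendsto (fun x : ℝ => -(2 * Real.pi * s) -
              2 * Real.pi * ((Qb b - α.re) / x) * max (-s) 0) (𝓝[>] 0) atBot by
            have := (Real.tendsto_exp_atBot.comp h).const_mul C
            rwa [mul_zero] at this
          rw [max_eq_left (by linarith)]
          have hpos : 0 < 2 * Real.pi * (Qb b - α.re) * (-s) :=
            mul_pos (mul_pos (by positivity) (by linarith)) (by linarith)
          have := tendsto_atBot_add_const_left _ (-(2 * Real.pi * s))
            (tendsto_neg_atTop_atBot.comp (hinv.const_mul_atTop hpos))
          refine this.congr fun x => ?_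
          simp only [Function.comp]
          ring
        refine squeeze_zero_norm' ?_ hz
        filter_upwards [self_mem_nhdsWithin] with x hx
        exact hbound x s hx
      · rw [indicator_of_mem (show s ∈ Ioi (0 : ℝ) from h)]
        have hsx : Tendsto (fun x : ℝ => s / x) (𝓝[>] 0) atTop :=
          (hinv.const_mul_atTop h).congr fun x => (div_eq_mul_inv _ _).symm
        have hW (y : ℂ) (h1 : δ ≤ c + y.re) (h2 : c + y.re ≤ Qb b - δ) :
            Tendsto (fun x : ℝ => W b (c + (s / x : ℝ) * I + y)) (𝓝[>] 0) (𝓝 0) := by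
          have hz : Tendsto (fun x : ℝ => D * Real.exp (-height b * (s / x + y.im))) (𝓝[>] 0)
              (𝓝 0) := by
            have h := (tendsto_atTop_add_const_right _ y.im hsx).const_mul_atTop_of_neg
              (neg_neg_of_pos (height_pos hb))
            have := (Real.tendsto_exp_atBot.comp h).const_mul D
            rwa [mul_zero] at this
          refine squeeze_zero_norm (fun x => ?_) hz
          have hre : (c + (s / x : ℝ) * I + y : ℂ).re = c + y.re := by simp [-ofReal_div]
          have him : (c + (s / x : ℝ) * I + y : ℂ).im = s / x + y.im := by simp [-ofReal_div]
          have := hD (c + (s / x : ℝ) * I + y) (by rw [hre]; exact h1) (by rw [hre]; exact h2)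
          rwa [him] at this
        have hWα := hW α d1 (by linarith)
        have hWQ := hW (Qb b) (by rw [ofReal_re]; linarith) (by rw [ofReal_re]; linarith)
        have he : Tendsto (fun x : ℝ => 2 * Real.pi * I * (c + (s / x : ℝ) * I) * x) (𝓝[>] 0)
            (𝓝 (-(2 * Real.pi) * s)) := by
          have := (tendsto_ofReal_nhdsGT_zero.const_mul (2 * Real.pi * I * c)).add_const
            (-(2 * Real.pi) * s : ℂ)
          rw [mul_zero, zero_add] at this
          refine this.congr' ?_
          filter_upwards [self_mem_nhdsWithin] with x hx
          have hx0 : (x : ℂ) ≠ 0 := ofReal_ne_zero.2 (ne_of_gt hx)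
          push_cast
          field_simp
          linear_combination (-s : ℂ) * I_sq
        have := ((he.sub hWα).add hWQ).cexp
        rwa [sub_zero, add_zero] at this
  rw [integral_indicator measurableSet_Ioi, integral_exp_mul_complex_Ioi (by simpa using hpi)]
    at hlim
  have hval : -exp (-(2 * Real.pi) * (0 : ℝ)) / (-(2 * Real.pi)) = (1 / (2 * Real.pi) : ℂ) := by
    rw [ofReal_zero, mul_zero, exp_zero, neg_div_neg_eq]
  rw [hval] at hlim
  refine hlim.congr' ?_
  filter_upwards [self_mem_nhdsWithin] with x hx
  rw [Measure.integral_comp_div (fun t : ℝ => betaKern b α x (c + t * I)) x,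
    abs_of_pos (show 0 < x from hx), betaInt, real_smul]

/-- Let β → 0+ in the constant quotient: e^{W(x)} = g/G_b(x), and x J(α, x) and x G_b(x) have the
same limit 1/(2π), so only g e^{-W(α)} remains. -/
theorem betaQuot_eq {b : ℝ} (hb : 0 < b) {α β : ℂ} (hα : 0 < α.re) (hα1 : α.re < b⁻¹)
    (hβ : 0 < β.re) (hαβ : β.re < Qb b - α.re) :
    betaQuot b α β = gConst b * exp (-W b α) := by
  have hQ : Qb b = b + b⁻¹ := rfl
  have hpi : (Real.pi : ℂ) ≠ 0 := ofReal_ne_zero.2 Real.pi_ne_zero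
  have hg := gConst_ne_zero b
  obtain ⟨a, ha⟩ := exists_betaQuot_eq hb hα hα1
  rw [ha β hβ hαβ]
  have l1 := tendsto_mul_betaInt hb (α := α) (c := -(α.re / 2)) (by linarith) (by linarith)
    (by linarith)
  have l2 := ((tendsto_mul_Gb hb).inv₀ (by simp [hpi])).const_mul (gConst b)
  have hα0 : α ∈ strip b := ⟨hα, by linarith⟩
  have l3 : Tendsto (fun x : ℝ => exp (-W b (α + x))) (𝓝[>] 0) (𝓝 (exp (-W b α))) := by
    have h1 : Tendsto (fun x : ℝ => α + (x : ℂ)) (𝓝[>] 0) (𝓝 α) := by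
      simpa using tendsto_ofReal_nhdsGT_zero.const_add α
    exact (((continuousAt_W hb hα0).tendsto.comp h1).neg).cexp
  have l := (l1.mul l2).mul l3
  have hval : 1 / (2 * Real.pi) * (gConst b * (1 / (2 * Real.pi) : ℂ)⁻¹) * exp (-W b α) =
      gConst b * exp (-W b α) := by
    field_simp
  rw [hval] at l
  refine tendsto_nhds_unique (tendsto_const_nhds.congr' ?_) l
  have hx : Ioo (0 : ℝ) (Qb b - α.re) ∈ 𝓝[>] (0 : ℝ) := Ioo_mem_nhdsGT (by linarith)
  filter_upwards [hx] with x hx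
  have hx0 : (x : ℂ) ≠ 0 := ofReal_ne_zero.2 hx.1.ne'
  rw [← ha x (by simpa using hx.1) (by simpa using hx.2), betaQuot,
    Gb_eq hb (x := x) ⟨by simpa using hx.1, by rw [ofReal_re]; linarith [hx.2]⟩, exp_sub, exp_neg,
    exp_neg]
  have n1 := exp_ne_zero (W b x)
  have n2 := exp_ne_zero (W b (α + x))
  generalize exp (W b x) = w1 at *
  generalize exp (W b (α + x)) = w2 at *
  generalize betaInt b α x (-(α.re / 2)) = J at *
  field_simp

end BBeta

end

/-! ### Removing the restriction Re α < 1/b. -/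

noncomputable section

namespace BBeta

open Filter Topology Set

theorem betaInt_eq_of_re_lt {b : ℝ} (hb : 0 < b) {α β : ℂ} {c : ℝ} (hα1 : α.re < b⁻¹)
    (hβ : 0 < β.re) (hαβ : (α + β).re < Qb b) (hc : 0 < c + α.re) (hc0 : c < 0) :
    betaInt b α β c = gConst b * exp (-W b α - W b β + W b (α + β)) := by
  have h1 : betaInt b α β c = betaInt b α β (-(α.re / 2)) := by
    rcases le_total c (-(α.re / 2)) with h | h
    · exact (betaInt_eq hb hβ hαβ hc h (by linarith)).symm
    · exact betaInt_eq hb hβ hαβ (by linarith) h hc0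
  have h2 := betaQuot_eq hb (α := α) (β := β) (by linarith) hα1 hβ
    (by rw [add_re] at hαβ; linarith)
  rw [betaQuot, ← h1] at h2
  rw [show -W b α - W b β + W b (α + β) = -W b α + -(W b β - W b (α + β)) by ring, exp_add,
    exp_neg (W b β - W b (α + β)), ← mul_assoc, ← h2, mul_inv_cancel_right₀ (exp_ne_zero _)]

theorem differentiableOn_betaInt_left {b : ℝ} (hb : 0 < b) {β : ℂ} {c : ℝ} (hβ : 0 < β.re)
    (hc0 : c < 0) :
    DifferentiableOn ℂ (fun α => betaInt b α β c) {α | -c < α.re ∧ α.re < Qb b - β.re} := by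
  have hU : IsOpen {α : ℂ | -c < α.re ∧ α.re < Qb b - β.re} :=
    (isOpen_lt continuous_const continuous_re).inter (isOpen_lt continuous_re continuous_const)
  refine differentiableOn_integral_of_locally_dominated (μ := volume) hU ?_ ?_ ?_
  · intro z hz
    exact (continuous_betaKern_line hb β (by linarith [hz.1]) hc0
      (by linarith [hz.2])).aestronglyMeasurable
  · intro t α hα
    have hre : (c + t * I + α : ℂ).re = c + α.re := by simp
    have d : DifferentiableAt ℂ (fun α => W b (c + t * I + α)) α :=
      (hasDerivAt_W hb (x := c + t * I + α) ⟨by rw [hre]; linarith [hα.1],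
        by rw [hre]; linarith [hα.2]⟩).comp_const_add _ α |>.differentiableAt
    exact ((d.const_sub (2 * Real.pi * I * (c + t * I) * β)).add_const
      (W b (c + t * I + Qb b))).cexp.differentiableWithinAt
  · intro z hz
    obtain ⟨δ, hδ, d1, d2, d3, d4⟩ : ∃ δ > 0, 2 * δ ≤ c + z.re ∧ c ≤ -δ ∧ δ ≤ β.re ∧
        z.re ≤ Qb b - β.re - 2 * δ := by
      refine ⟨min (min ((c + z.re) / 2) (-c)) (min β.re ((Qb b - β.re - z.re) / 2)),
        lt_min (lt_min (by linarith [hz.1]) (by linarith)) (lt_min hβ (by linarith [hz.2])),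
        ?_, ?_, (min_le_right _ _).trans (min_le_left _ _), ?_⟩
      · linarith [(min_le_left (min ((c + z.re) / 2) (-c))
          (min β.re ((Qb b - β.re - z.re) / 2))).trans (min_le_left _ _)]
      · linarith [(min_le_left (min ((c + z.re) / 2) (-c))
          (min β.re ((Qb b - β.re - z.re) / 2))).trans (min_le_right _ _)]
      · linarith [(min_le_right (min ((c + z.re) / 2) (-c))
          (min β.re ((Qb b - β.re - z.re) / 2))).trans (min_le_right _ _)]
    obtain ⟨C, hC0, hC⟩ := exists_betaKern_bound_div hb hδ (|z.im| + δ)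
    refine ⟨δ, hδ, fun t => C * Real.exp (-(2 * Real.pi * c * β.im)) / (1 + t ^ 2),
      integrable_div_one_add_sq _, ae_of_all _ fun t w hw => ?_⟩
    have hwz : ‖w - z‖ < δ := by simpa [dist_eq] using hw.1
    have h1 := abs_le.1 ((abs_re_le_norm (w - z)).trans hwz.le)
    have h2 := (abs_im_le_norm (w - z)).trans hwz.le
    rw [sub_re] at h1
    rw [sub_im] at h2
    have h3 : |w.im| ≤ |z.im| + δ := by
      have := abs_add_le z.im (w.im - z.im)
      rw [add_sub_cancel] at this
      linarith
    exact hC w β c t (by linarith [h1.1]) d2 h3 d3 (by rw [add_re]; linarith [h1.2])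

/-- The beta integral, evaluated. -/
theorem betaInt_eq_gConst_mul {b : ℝ} (hb : 0 < b) {α β : ℂ} {c : ℝ} (hβ : 0 < β.re)
    (hαβ : (α + β).re < Qb b) (hc : 0 < c + α.re) (hc0 : c < 0) :
    betaInt b α β c = gConst b * exp (-W b α - W b β + W b (α + β)) := by
  have hbi := inv_pos.2 hb
  rw [add_re] at hαβ
  -- The line is moved to the right until -c' < 1/b. Then the α with -c' < Re α < 1/b, where the
  -- evaluation is known, can serve as the starting region for the identity theorem in α on this
  -- fixed line.
  obtain ⟨c', hcc, hc', hc'0⟩ : ∃ c', c ≤ c' ∧ -b⁻¹ < c' ∧ c' < 0 :=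
    ⟨max c (-b⁻¹ / 2), le_max_left _ _, lt_max_of_lt_right (by linarith),
      max_lt hc0 (by linarith)⟩
  rw [← betaInt_eq hb hβ (by rwa [add_re]) hc hcc hc'0]
  have hU : IsOpen {α : ℂ | -c' < α.re ∧ α.re < Qb b - β.re} :=
    (isOpen_lt continuous_const continuous_re).inter (isOpen_lt continuous_re continuous_const)
  have hpre : IsPreconnected {α : ℂ | -c' < α.re ∧ α.re < Qb b - β.re} :=
    ((convex_halfSpace_re_gt _).inter (convex_halfSpace_re_lt _)).isPreconnected
  have hR : DifferentiableOn ℂ (fun α => gConst b * exp (-W b α - W b β + W b (α + β)))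
      {α : ℂ | -c' < α.re ∧ α.re < Qb b - β.re} := by
    intro z hz
    have d1 : DifferentiableAt ℂ (W b) z :=
      (hasDerivAt_W hb ⟨by linarith [hz.1], by linarith [hz.2]⟩).differentiableAt
    have d2 : DifferentiableAt ℂ (fun α => W b (α + β)) z :=
      (hasDerivAt_W hb (x := z + β) ⟨by rw [add_re]; linarith [hz.1],
        by rw [add_re]; linarith [hz.2]⟩).comp_add_const z β |>.differentiableAt
    exact (((d1.neg.sub_const _).add d2).cexp.const_mul _).differentiableWithinAt
  have hm : -c' < min b⁻¹ (Qb b - β.re) := lt_min (by linarith) (by linarith)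
  have m1 := min_le_left b⁻¹ (Qb b - β.re)
  have m2 := min_le_right b⁻¹ (Qb b - β.re)
  have hL := (differentiableOn_betaInt_left hb hβ hc'0).analyticOnNhd hU
  refine hL.eqOn_of_preconnected_of_eventuallyEq
    (hR.analyticOnNhd hU) hpre
    (z₀ := (((-c' + min b⁻¹ (Qb b - β.re)) / 2 : ℝ) : ℂ)) ⟨?_, ?_⟩ ?_ ⟨by linarith, by linarith⟩
  · rw [ofReal_re]; linarith
  · rw [ofReal_re]; linarith
  · have : {α : ℂ | -c' < α.re ∧ α.re < min b⁻¹ (Qb b - β.re)} ∈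
        𝓝 (((-c' + min b⁻¹ (Qb b - β.re)) / 2 : ℝ) : ℂ) :=
      ((isOpen_lt continuous_const continuous_re).inter
        (isOpen_lt continuous_re continuous_const)).mem_nhds
        ⟨by rw [mem_ofPred_eq, ofReal_re]; linarith, by rw [mem_ofPred_eq, ofReal_re]; linarith⟩
    filter_upwards [this] with z hz
    exact betaInt_eq_of_re_lt hb (by linarith [hz.2]) hβ (by rw [add_re]; linarith [hz.2])
      (by linarith [hz.1]) hc'0

end BBeta

end

theorem mainTheorem12 (b : ℝ) (hb : 0 < b) (α β : ℂ)
    (hα : 0 < α.re) (hβ : 0 < β.re) (hαβ : (α + β).re < BBeta.Qb b)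
    (c : ℝ) (hcα : -α.re < c) (hc0 : c < 0) :
    Integrable (fun t : ℝ => BBeta.bbetaIntegrand b α β (c + t * I)) ∧
      1 / I * BBeta.lineIntegral c (BBeta.bbetaIntegrand b α β) =
        BBeta.Gb b α * BBeta.Gb b β / BBeta.Gb b (α + β) := by
  have hαβ' : α.re + β.re < BBeta.Qb b := by rwa [add_re] at hαβ
  have hc : 0 < c + α.re := by linarith
  have hk (t : ℝ) : BBeta.bbetaIntegrand b α β (c + t * I) = BBeta.betaKern b α β (c + t * I) :=
    BBeta.bbetaIntegrand_eq hb (by simpa using hc) (by simpa using hc0) (by linarith)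
  refine ⟨?_, ?_⟩
  · simp_rw [hk]
    exact BBeta.integrable_betaKern hb hβ hαβ hc hc0
  · rw [BBeta.lineIntegral, integral_mul_const, mul_comm _ I, ← mul_assoc,
      one_div_mul_cancel I_ne_zero, one_mul]
    simp_rw [hk]
    rw [BBeta.Gb_eq hb ⟨hα, by linarith⟩, BBeta.Gb_eq hb ⟨hβ, by linarith⟩,
      BBeta.Gb_eq hb (x := α + β) ⟨by rw [add_re]; linarith, hαβ⟩]
    refine (BBeta.betaInt_eq_gConst_mul hb hβ hαβ hc hc0).trans ?_
    have hg := BBeta.gConst_ne_zero b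
    rw [exp_add, exp_sub, exp_neg, exp_neg, exp_neg]
    have n1 := exp_ne_zero (BBeta.W b α)
    have n2 := exp_ne_zero (BBeta.W b β)
    have n3 := exp_ne_zero (BBeta.W b (α + β))
    -- Two factors g in the numerator against one in the denominator leave the single g of the
    -- evaluated integral.
    field_simp
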